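/- **Macroscopic equations at high Reynolds number.** Let $\nu,D,R>0$ and $a,b,\lambda,Re,\bar c\in\mathbb R$, let $\kappa=\nu/D$, and let $K\ge 0$ be a sensing function on $[0,\infty)$ with $0<\int_{\mathbb R^3}K(|z|)\,dz<\infty$ and $\int_{\mathbb R^3}K(|z|)|z|^2dz<\infty$. Let $d\omega$ be the uniform probability measure on $\mathbb S^2$; for $f=f(x,\omega,t)\ge0$ put $\rho_f=\int f\,d\omega$, $j_f=\int\omega f\,d\omega$, $\Omega_f=j_f/|j_f|$, $Q_f=\int(\omega\otimes\omega-\frac13\mathrm{Id})f\,d\omega$. With $P_{\omega^\perp}=\mathrm{Id}-\omega\otimes\omega$, $(\nabla_xv)_{ij}=\partial_{x_i}v_j$, and $S(v),A(v)$ the symmetric and antisymmetric parts of $\nabla_xv$, consider for $\varepsilon>0$, $x\in\mathbb R^3$, $\omega\in\mathbb S^2$ and $t$ in an open set $I\subset\mathbb R$ the rescaled mean-field Vicsek–Navier–Stokes system in the large friction regime $$\varepsilon\big[\partial_tf^\varepsilon+\nabla_x\cdot((v^\varepsilon+a\omega)f^\varepsilon)\big]+\nabla_\omega\cdot\Big(P_{\omega^\perp}\big\{\nu\bar\omega^\varepsilon_{f^\varepsilon}+\varepsilon(\lambda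 S(v^\varepsilon)+A(v^\varepsilon))\omega\big\}f^\varepsilon\Big)=D\Delta_\omega f^\varepsilon,$$ $$\bar\omega^\varepsilon_f=\frac{J^\varepsilon_f}{|J^\varepsilon_f|},\qquad J^\varepsilon_f(x,t)=\int_{\mathbb S^2\times\mathbb R^3}\omega\,K\Big(\frac{|x-y|}{\sqrt\varepsilon R}\Big)f(y,\omega,t)\,d\omega\,dy,$$ $$\partial_t\big[(Re+\bar c\rho_{f^\varepsilon})v^\varepsilon+a\bar c\,j_{f^\varepsilon}\big]+\nabla_x\cdot\big[(Re+\bar c\rho_{f^\varepsilon})v^\varepsilon\otimes v^\varepsilon+a\bar c(v^\varepsilon\otimes j_{f^\varepsilon}+j_{f^\varepsilon}\otimes v^\varepsilon)+(a^2\bar c+b)Q_{f^\varepsilon}\big]=-\nabla_x\Big(p^\varepsilon+\frac{a^2\bar c}3\rho_{f^\varepsilon}\Big)+\Delta_xv^\varepsilon,\qquad\nabla_x\cdot v^\varepsilon=0.$$ Suppose that, for all small $\varepsilon>0$, $(f^\varepsilon,v^\varepsilon,p^\varepsilon)$ is a classical solution with $f^\varepsilon\ge0$, $f^\varepsilon$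 and $v^\varepsilon$ of class $C^2$, $p^\varepsilon$ of class $C^1$, and $J^\varepsilon_{f^\varepsilon}\neq0$ wherever $\rho_{f^\varepsilon}\ne0$. Suppose that, as $\varepsilon\to0$, $f^\varepsilon\to f$ and $v^\varepsilon\to v$ in $C^2_{loc}$ and $p^\varepsilon\to p$ in $C^1_{loc}$, with $f,v\in C^2$, $p\in C^1$, and that for each $t\in I$ there is a constant $C$ with $f^\varepsilon(\cdot,\cdot,t)\le C$ for all small $\varepsilon$. Then, with $\rho=\rho_f\ge0$, there is $\Omega=\Omega(x,t)\in\mathbb S^2$ such that $f=\rho M_\Omega$, where $M_\Omega(\omega)=e^{\kappa\,\Omega\cdot\omega}/\int_{\mathbb S^2}e^{\kappa\,\Omega\cdot\omega'}d\omega'$. Moreover, for every such $\Omega$: $\rho_{f^\varepsilon}\to\rho$ locally uniformly; $\Omega_{f^\varepsilon}\to\Omega$ locally uniformly on $\{\rho>0\}$; $\rho$ and $\rho\Omega$ are $C^2$, and $\Omega$ is $C^2$ on $\{\rho>0\}$; and $$\partial_t\rho+\nabla_x\cdot(\rho U)=0,$$ $$\rho\,\partial_t\Omega+\rho(V\cdot\nabla_x)\Omega+\frac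 a\kappa P_{\Omega^\perp}\nabla_x\rho=\gamma P_{\Omega^\perp}\Delta_x(\rho\Omega)+\rho P_{\Omega^\perp}\big(\tilde\lambda S(v)+A(v)\big)\Omega,$$ $$\partial_t\big[(Re+\bar c\rho)v+c_1a\bar c\rho\,\Omega\big]+\nabla_x\cdot\big[(Re+\bar c\rho)v\otimes v+c_1a\bar c\rho(v\otimes\Omega+\Omega\otimes v)\big]+\nabla_x\cdot\big[(a^2\bar c+b)\,\rho\,\mathcal Q(\Omega)\big]=-\nabla_x\Big(p+\frac{a^2\bar c}3\rho\Big)+\Delta_xv,$$ $$\nabla_x\cdot v=0.$$ The second equation holds at every point near which $\Omega$ is $C^2$ (in particular wherever $\rho>0$), the others hold everywhere. Here $U=ac_1\Omega+v$, $V=ac_2\Omega+v$, $\mathcal Q(\Omega)=c_4(\Omega\otimes\Omega-\frac13\mathrm{Id})$, $$\gamma=k_0\nu\Big(c_2+\frac2\kappa\Big),\quad\tilde\lambda=\lambda\Big(\frac6\kappa c_2+c_3-1\Big),\quad k_0=\frac{R^2}6\,\frac{\int_{\mathbb R^3}K(|z|)|z|^2dz}{\int_{\mathbb R^3}K(|z|)\,dz},$$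 $$c_1=\langle\cos\theta\rangle_{\sin\theta\,\tilde M},\quad c_2=\langle\cos\theta\rangle_{\sin^3\theta\,\tilde M\tilde h},\quad c_3=2\langle\cos^2\theta\rangle_{\sin^3\theta\,\tilde M\tilde h},\quad c_4=1-\tfrac32\langle\sin^2\theta\rangle_{\sin\theta\,\tilde M},$$ with $\langle g\rangle_\ell=\int_0^\pi g\,\ell\,d\theta\big/\int_0^\pi\ell\,d\theta$, $\tilde M(\theta)=e^{\kappa\cos\theta}/Z$ ($Z$ the normalising constant of $M_\Omega$), $\tilde h(\theta)=h(\cos\theta)$, $h(\mu)=(1-\mu^2)^{-1/2}g(\mu)$, where $g$ is the unique solution of $$-(1-\mu^2)\,\partial_\mu\big(e^{\kappa\mu}(1-\mu^2)\,\partial_\mu g\big)+e^{\kappa\mu}g=-(1-\mu^2)^{3/2}e^{\kappa\mu}\quad\text{on }(-1,1)$$ with $(1-\mu^2)^{-1/2}g\in L^2(-1,1)$ and $(1-\mu^2)^{1/2}\partial_\mu g\in L^2(-1,1)$. -/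

import Mathlib

open MeasureTheory Filter Topology Set
open scoped Matrix

namespace VicsekNS

noncomputable section

/-! ### Euclidean space, the sphere, differential operators -/

/-- Physical space `ℝ³` with its Euclidean structure. -/
abbrev E3 : Type := EuclideanSpace ℝ (Fin 3)

/-- The unit sphere `𝕊²` of orientations. -/
abbrev S2 : Type := Metric.sphere (0 : E3) 1

/-- The canonical basis vectors of `ℝ³`. -/
def e (i : Fin 3) : E3 := EuclideanSpace.single i 1

/-- A reference point of `𝕊²`. -/
def pole : S2 := ⟨e 0, by simp [e]⟩

/-- The direction `y / |y| ∈ 𝕊²` of a nonzero vector `y` (a dummy value at `y = 0`). -/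
def dir (y : E3) : S2 :=
  if h : y = 0 then pole
  else ⟨‖y‖⁻¹ • y, by simp [norm_smul, h]⟩

/-- The uniform probability measure on `𝕊²`: normalised surface measure, `∫_{𝕊²} dω = 1`. -/
def sigma : Measure S2 :=
  ((volume : Measure E3).toSphere univ)⁻¹ • (volume : Measure E3).toSphere

/-- Divergence of a vector field on `ℝ³`. -/
def divg (F : E3 → E3) (x : E3) : ℝ := ∑ i, fderiv ℝ F x (e i) i

/-- Divergence of a tensor field on `ℝ³`: `(∇·T)_j = ∑_i ∂_i T_{ij}`. -/
def divT (T : E3 → Matrix (Fin 3) (Fin 3) ℝ) (x : E3) : E3 :=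
  WithLp.toLp 2 fun j => ∑ i, fderiv ℝ (fun y => T y i j) x (e i)

/-- Laplacian on `ℝ³` (of scalar or vector fields). -/
def lapl {G : Type*} [NormedAddCommGroup G] [NormedSpace ℝ G] (F : E3 → G) (x : E3) : G :=
  Laplacian.laplacian F x

/-- Divergence on the sphere of a tangential vector field, computed as the Euclidean divergence
of its extension to `ℝ³ ∖ {0}` that is constant along rays. -/
def sphDiv (F : S2 → E3) (ω : S2) : ℝ := divg (fun y => F (dir y)) (ω : E3)

/-- The Laplace-Beltrami operator of the sphere, computed as the Euclidean Laplacian of the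
extension to `ℝ³ ∖ {0}` that is constant along rays. -/
def sphLap (F : S2 → ℝ) (ω : S2) : ℝ := lapl (fun y => F (dir y)) (ω : E3)

/-- The orthogonal projection `P_{Ω^⊥} w = w - (Ω · w) Ω` onto the tangent plane at `Ω ∈ 𝕊²`. -/
def proj (Ω : S2) (w : E3) : E3 := w - (inner ℝ (Ω : E3) w) • (Ω : E3)

/-- The action of a matrix on a vector of `ℝ³`. -/
def act (B : Matrix (Fin 3) (Fin 3) ℝ) (w : E3) : E3 := WithLp.toLp 2 (B *ᵥ w.ofLp)

/-- The tensor product `v ⊗ w`, with entries `v_i w_j`. -/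
def tens (v w : E3) : Matrix (Fin 3) (Fin 3) ℝ := Matrix.of fun i j => v i * w j

/-- The velocity gradient, `(∇v)_{ij} = ∂_i v_j`. -/
def gradV (v : E3 → E3) (x : E3) : Matrix (Fin 3) (Fin 3) ℝ :=
  Matrix.of fun i j => fderiv ℝ v x (e i) j

/-- Symmetric part `S(v)` of the velocity gradient. -/
def symV (v : E3 → E3) (x : E3) : Matrix (Fin 3) (Fin 3) ℝ :=
  (1 / 2 : ℝ) • (gradV v x + (gradV v x)ᵀ)

/-- Antisymmetric part `A(v)` of the velocity gradient. -/
def antiV (v : E3 → E3) (x : E3) : Matrix (Fin 3) (Fin 3) ℝ :=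
  (1 / 2 : ℝ) • (gradV v x - (gradV v x)ᵀ)

/-! ### Moments in the orientation variable -/

/-- Density `∫ F dω`. -/
def density (F : S2 → ℝ) : ℝ := ∫ ω, F ω ∂sigma

/-- Flux `∫ ω F dω`. -/
def flux (F : S2 → ℝ) : E3 := ∫ ω, F ω • (ω : E3) ∂sigma

/-- Local mean orientation `j / |j|`, where `j` is the flux; only meaningful if `j ≠ 0`. -/
def meanOrientation (F : S2 → ℝ) : E3 := ‖flux F‖⁻¹ • flux F

/-- The Q-tensor `∫ (ω ⊗ ω - Id/3) F dω`, entry by entry. -/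
def qTensor (F : S2 → ℝ) : Matrix (Fin 3) (Fin 3) ℝ :=
  Matrix.of fun i j =>
    ∫ ω, (tens (ω : E3) (ω : E3) - (1 / 3 : ℝ) • (1 : Matrix (Fin 3) (Fin 3) ℝ)) i j * F ω ∂sigma

/-! ### Parameters and the rescaled kinetic system -/

/-- The parameters of the model: self-propulsion speed `a`, dipole strength `b`, alignment
intensity `nu`, noise intensity `D`, shape parameter `lam`, interaction range `R`, Reynolds
number `Re`, particle inertia `cbar`, sensing function `K`. -/
structure Params where
  a : ℝ
  b : ℝ
  nu : ℝ
  D : ℝ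
  lam : ℝ
  R : ℝ
  Re : ℝ
  cbar : ℝ
  K : ℝ → ℝ

namespace Params

/-- `κ = ν / D`. -/
def kappa (P : Params) : ℝ := P.nu / P.D

/-- `k₀ = (R²/6) ∫ K(|z|) |z|² dz / ∫ K(|z|) dz`. -/
def k0 (P : Params) : ℝ :=
  P.R ^ 2 / 6 * (∫ z : E3, P.K ‖z‖ * ‖z‖ ^ 2) * (∫ z : E3, P.K ‖z‖)⁻¹

end Params

/-- The nonlocal flux
`J^ε(x) = ∫∫ ω K(|x - y| / (√ε R)) F(y, ω) dω dy` of a distribution `F(y, ω)`. -/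
def nonlocalFlux (P : Params) (ε : ℝ) (F : E3 → S2 → ℝ) (x : E3) : E3 :=
  ∫ y : E3, ∫ ω, (P.K (‖x - y‖ / (Real.sqrt ε * P.R)) * F y ω) • (ω : E3) ∂sigma

/-- The nonlocal mean orientation `J^ε / |J^ε|`; only meaningful if `J^ε ≠ 0`. -/
def nonlocalOrientation (P : Params) (ε : ℝ) (F : E3 → S2 → ℝ) (x : E3) : E3 :=
  ‖nonlocalFlux P ε F x‖⁻¹ • nonlocalFlux P ε F x

/-- A distribution `f(t, x, ω)`, extended constantly along rays in `ω`, as a function on the open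
subset `y ≠ 0` of `ℝ × ℝ³ × ℝ³`. -/
def ext (f : ℝ → E3 → S2 → ℝ) : ℝ × E3 × E3 → ℝ := fun q => f q.1 q.2.1 (dir q.2.2)

/-- Times in `I`, all positions, all nonzero `y` (whose direction is the orientation). -/
def domF (I : Set ℝ) : Set (ℝ × E3 × E3) := I ×ˢ (univ ×ˢ {0}ᶜ)

/-- Times in `I`, all positions. -/
def dom (I : Set ℝ) : Set (ℝ × E3) := I ×ˢ univ

/-- A field `g(t, x)` as a function on space-time. -/
def unc {G : Type*} (g : ℝ → E3 → G) : ℝ × E3 → G := fun q => g q.1 q.2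

/-- Convergence in `C^k_loc(U)` as `ε → 0⁺`, for an open set `U`: all derivatives of order at most
`k` converge locally uniformly on `U`. -/
def TendstoCk {X G : Type*} [NormedAddCommGroup X] [NormedSpace ℝ X]
    [NormedAddCommGroup G] [NormedSpace ℝ G]
    (k : ℕ) (U : Set X) (gε : ℝ → X → G) (g : X → G) : Prop :=
  ∀ m ≤ k, TendstoLocallyUniformlyOn (fun ε => iteratedFDeriv ℝ m (gε ε)) (iteratedFDeriv ℝ m g)
    (𝓝[>] (0 : ℝ)) U

/-- Total momentum density `(Re + c̄ ρ_f) v + a c̄ j_f`. -/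
def kinMomentum (P : Params) (F : S2 → ℝ) (v : E3) : E3 :=
  (P.Re + P.cbar * density F) • v + (P.a * P.cbar) • flux F

/-- Momentum flux `(Re + c̄ ρ_f) v ⊗ v + a c̄ (v ⊗ j_f + j_f ⊗ v) + (a² c̄ + b) Q_f`. -/
def kinMomentumFlux (P : Params) (F : S2 → ℝ) (v : E3) : Matrix (Fin 3) (Fin 3) ℝ :=
  (P.Re + P.cbar * density F) • tens v v + (P.a * P.cbar) • (tens v (flux F) + tens (flux F) v)
    + (P.a ^ 2 * P.cbar + P.b) • qTensor F

/-- Classical solutions `(f, v, p)`, on the time set `I`, of the rescaled mean-field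
Vicsek-Navier-Stokes system with scaling parameter `ε`. -/
structure IsScaledSolution (P : Params) (ε : ℝ) (I : Set ℝ)
    (f : ℝ → E3 → S2 → ℝ) (v : ℝ → E3 → E3) (p : ℝ → E3 → ℝ) : Prop where
  smooth_f : ContDiffOn ℝ 2 (ext f) (domF I)
  smooth_v : ContDiffOn ℝ 2 (unc v) (dom I)
  smooth_p : ContDiffOn ℝ 1 (unc p) (dom I)
  nonneg : ∀ t ∈ I, ∀ x ω, 0 ≤ f t x ω
  /-- The nonlocal mean orientation is well defined wherever there are particles. -/
  flux_ne : ∀ t ∈ I, ∀ x, density (f t x) ≠ 0 → nonlocalFlux P ε (f t) x ≠ 0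
  /-- `ε [∂_t f + ∇_x·((v + a ω) f)]
  + ∇_ω·(P_{ω^⊥}{ν ω̄ + ε (λ S(v) + A(v)) ω} f) = D Δ_ω f`. -/
  kinetic : ∀ t ∈ I, ∀ x, ∀ ω : S2,
    ε * (deriv (fun s => f s x ω) t
        + divg (fun y => f t y ω • (v t y + P.a • (ω : E3))) x)
      + sphDiv (fun ω' => f t x ω' • proj ω'
          (P.nu • nonlocalOrientation P ε (f t) x
            + ε • act (P.lam • symV (v t) x + antiV (v t) x) (ω' : E3))) ω
      = P.D * sphLap (f t x) ω
  /-- `∂_t[(Re + c̄ρ_f) v + a c̄ j_f] + ∇·[(Re + c̄ρ_f) v⊗v + a c̄ (v⊗j_f + j_f⊗v)]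
  + ∇·[(a²c̄ + b) Q_f] = -∇(p + (a²c̄/3) ρ_f) + Δv`. -/
  momentum : ∀ t ∈ I, ∀ x,
    deriv (fun s => kinMomentum P (f s x) (v s x)) t
      + divT (fun y => kinMomentumFlux P (f t y) (v t y)) x
      = - gradient (fun y => p t y + P.a ^ 2 * P.cbar / 3 * density (f t y)) x + lapl (v t) x
  incompressible : ∀ t ∈ I, ∀ x, divg (v t) x = 0

/-! ### Equilibria, generalised collision invariant, macroscopic constants -/

/-- The von Mises density `M_Ω(ω) = exp(κ Ω·ω) / Z`, `∫ M_Ω dω = 1`. -/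
def vonMises (κ : ℝ) (Ω ω : S2) : ℝ :=
  Real.exp (κ * inner ℝ (Ω : E3) (ω : E3))
    / ∫ ω' : S2, Real.exp (κ * inner ℝ (Ω : E3) (ω' : E3)) ∂sigma

/-- The von Mises density as a function of the angle `θ` between `Ω` and `ω` (the normalising
constant does not depend on `Ω`). -/
def vonMisesAngle (κ θ : ℝ) : ℝ :=
  Real.exp (κ * Real.cos θ) / ∫ ω' : S2, Real.exp (κ * inner ℝ (pole : E3) (ω' : E3)) ∂sigma

/-- `g` belongs to the weighted space
`V = {g | (1-μ²)^{-1/2} g ∈ L²(-1,1), (1-μ²)^{1/2} g' ∈ L²(-1,1)}` and solves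
`-(1-μ²) (e^{κμ} (1-μ²) g')' + e^{κμ} g = -(1-μ²)^{3/2} e^{κμ}` on `(-1,1)`.
(Solutions in `V` are automatically smooth in the open interval; there is exactly one.) -/
structure IsGCIProfile (κ : ℝ) (g : ℝ → ℝ) : Prop where
  differentiable : ∀ μ ∈ Ioo (-1 : ℝ) 1, DifferentiableAt ℝ g μ
  differentiable_flux : ∀ μ ∈ Ioo (-1 : ℝ) 1,
    DifferentiableAt ℝ (fun s => Real.exp (κ * s) * (1 - s ^ 2) * deriv g s) μ
  equation : ∀ μ ∈ Ioo (-1 : ℝ) 1,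
    -(1 - μ ^ 2) * deriv (fun s => Real.exp (κ * s) * (1 - s ^ 2) * deriv g s) μ
      + Real.exp (κ * μ) * g μ = -(1 - μ ^ 2) ^ (3 / 2 : ℝ) * Real.exp (κ * μ)
  memLp : MemLp (fun μ => (Real.sqrt (1 - μ ^ 2))⁻¹ * g μ) 2 (volume.restrict (Ioo (-1 : ℝ) 1))
  memLp_deriv :
    MemLp (fun μ => Real.sqrt (1 - μ ^ 2) * deriv g μ) 2 (volume.restrict (Ioo (-1 : ℝ) 1))

/-- The unique solution of the equation for the generalised collision invariant
(unique on `(-1,1)`; its values elsewhere play no role). -/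
def gciG (κ : ℝ) : ℝ → ℝ := Classical.epsilon (IsGCIProfile κ)

/-- `h(μ) = (1-μ²)^{-1/2} g(μ)`; the vector generalised collision invariant is
`(Ω × ω) h(Ω·ω)`. -/
def gciH (κ μ : ℝ) : ℝ := (Real.sqrt (1 - μ ^ 2))⁻¹ * gciG κ μ

/-- The weighted average `⟨g⟩_ℓ = ∫₀^π g(θ) ℓ(θ) / (∫₀^π ℓ(θ') dθ') dθ`. -/
def avg (g l : ℝ → ℝ) : ℝ :=
  ∫ θ in (0 : ℝ)..Real.pi, g θ * (l θ / ∫ θ' in (0 : ℝ)..Real.pi, l θ')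

/-- The weight `sin θ M̃(θ)`. -/
def weightM (κ θ : ℝ) : ℝ := Real.sin θ * vonMisesAngle κ θ

/-- The weight `sin³ θ M̃(θ) h̃(θ)`, `h̃(θ) = h(cos θ)`. -/
def weightH (κ θ : ℝ) : ℝ := Real.sin θ ^ 3 * vonMisesAngle κ θ * gciH κ (Real.cos θ)

/-- `c₁ = ⟨cos θ⟩` with weight `sin θ M̃`. -/
def c1 (κ : ℝ) : ℝ := avg Real.cos (weightM κ)

/-- `c₂ = ⟨cos θ⟩` with weight `sin³ θ M̃ h̃`. -/
def c2 (κ : ℝ) : ℝ := avg Real.cos (weightH κ)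

/-- `c₃ = 2 ⟨cos² θ⟩` with weight `sin³ θ M̃ h̃`. -/
def c3 (κ : ℝ) : ℝ := 2 * avg (fun θ => Real.cos θ ^ 2) (weightH κ)

/-- `c₄ = 1 - (3/2) ⟨sin² θ⟩` with weight `sin θ M̃`. -/
def c4 (κ : ℝ) : ℝ := 1 - 3 / 2 * avg (fun θ => Real.sin θ ^ 2) (weightM κ)

namespace Params

/-- `γ = k₀ ν (c₂ + 2/κ)`. -/
def gamma (P : Params) : ℝ := P.k0 * P.nu * (c2 P.kappa + 2 / P.kappa)

/-- `λ₀ = (6/κ) c₂ + c₃ - 1`. -/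
def lambda0 (P : Params) : ℝ := 6 / P.kappa * c2 P.kappa + c3 P.kappa - 1

/-- `λ̃ = λ λ₀`. -/
def lambdaTilde (P : Params) : ℝ := P.lam * P.lambda0

end Params

/-! ### The macroscopic system -/

/-- `U = a c₁ Ω + v`. -/
def velU (P : Params) (Ω : S2) (v : E3) : E3 := (P.a * c1 P.kappa) • (Ω : E3) + v

/-- `V = a c₂ Ω + v`. -/
def velV (P : Params) (Ω : S2) (v : E3) : E3 := (P.a * c2 P.kappa) • (Ω : E3) + v

/-- `𝒬(Ω) = c₄ (Ω ⊗ Ω - Id/3)`. -/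
def macroQ (P : Params) (Ω : S2) : Matrix (Fin 3) (Fin 3) ℝ :=
  c4 P.kappa • (tens (Ω : E3) (Ω : E3) - (1 / 3 : ℝ) • (1 : Matrix (Fin 3) (Fin 3) ℝ))

/-- Total momentum density `(Re + c̄ρ) v + c₁ a c̄ ρ Ω`. -/
def macroMomentum (P : Params) (ρ : ℝ) (Ω : S2) (v : E3) : E3 :=
  (P.Re + P.cbar * ρ) • v + (c1 P.kappa * P.a * P.cbar * ρ) • (Ω : E3)

/-- Momentum flux
`(Re + c̄ρ) v⊗v + c₁ a c̄ ρ (v⊗Ω + Ω⊗v) + (a²c̄ + b) ρ 𝒬(Ω)`. -/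
def macroMomentumFlux (P : Params) (ρ : ℝ) (Ω : S2) (v : E3) : Matrix (Fin 3) (Fin 3) ℝ :=
  (P.Re + P.cbar * ρ) • tens v v
    + (c1 P.kappa * P.a * P.cbar * ρ) • (tens v (Ω : E3) + tens (Ω : E3) v)
    + (P.a ^ 2 * P.cbar + P.b) • (ρ • macroQ P Ω)

/-- The orientation equation at the point `(t, x)`:
`ρ ∂_tΩ + ρ (V·∇)Ω + (a/κ) P_{Ω^⊥}∇ρ = γ P_{Ω^⊥} Δ(ρΩ) + ρ P_{Ω^⊥} (λ̃ S(v) + A(v)) Ω`. -/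
def OrientationEq (P : Params) (ρ : ℝ → E3 → ℝ) (Ω : ℝ → E3 → S2) (v : ℝ → E3 → E3)
    (t : ℝ) (x : E3) : Prop :=
  ρ t x • deriv (fun s => (Ω s x : E3)) t
      + ρ t x • fderiv ℝ (fun y => (Ω t y : E3)) x (velV P (Ω t x) (v t x))
      + (P.a / P.kappa) • proj (Ω t x) (gradient (ρ t) x)
    = P.gamma • proj (Ω t x) (lapl (fun y => ρ t y • (Ω t y : E3)) x)
      + ρ t x • proj (Ω t x)
          (act (P.lambdaTilde • symV (v t) x + antiV (v t) x) (Ω t x : E3))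

/-- The macroscopic Self-Organised Hydrodynamics / Navier-Stokes system on the time set `I`.
In vacuum (`ρ = 0`) the orientation `Ω` is not determined and need not be regular; the orientation
equation, which is not in divergence form, is required wherever `Ω` is `C²`, and `Ω` has to be `C²`
wherever `ρ > 0`. -/
structure IsMacroSolution (P : Params) (I : Set ℝ) (ρ : ℝ → E3 → ℝ) (Ω : ℝ → E3 → S2)
    (v : ℝ → E3 → E3) (p : ℝ → E3 → ℝ) : Prop where
  nonneg : ∀ t ∈ I, ∀ x, 0 ≤ ρ t x
  smooth_rho : ContDiffOn ℝ 2 (unc ρ) (dom I)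
  smooth_rhoOmega : ContDiffOn ℝ 2 (unc fun t x => ρ t x • (Ω t x : E3)) (dom I)
  smooth_Omega : ∀ t ∈ I, ∀ x, 0 < ρ t x →
    ContDiffAt ℝ 2 (unc fun t x => (Ω t x : E3)) (t, x)
  /-- `∂_tρ + ∇·(ρU) = 0`. -/
  continuity : ∀ t ∈ I, ∀ x,
    deriv (fun s => ρ s x) t + divg (fun y => ρ t y • velU P (Ω t y) (v t y)) x = 0
  orientation : ∀ t ∈ I, ∀ x, ContDiffAt ℝ 2 (unc fun t x => (Ω t x : E3)) (t, x) →
    OrientationEq P ρ Ω v t x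
  /-- `∂_t[(Re + c̄ρ) v + c₁ a c̄ ρΩ] + ∇·[(Re + c̄ρ) v⊗v + c₁ a c̄ ρ (v⊗Ω + Ω⊗v)]
  + ∇·[(a²c̄ + b) ρ 𝒬(Ω)] = -∇(p + (a²c̄/3) ρ) + Δv`. -/
  momentum : ∀ t ∈ I, ∀ x,
    deriv (fun s => macroMomentum P (ρ s x) (Ω s x) (v s x)) t
      + divT (fun y => macroMomentumFlux P (ρ t y) (Ω t y) (v t y)) x
      = - gradient (fun y => p t y + P.a ^ 2 * P.cbar / 3 * ρ t y) x + lapl (v t) x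
  incompressible : ∀ t ∈ I, ∀ x, divg (v t) x = 0

end

end VicsekNS

namespace VicsekNS

/-! ### Directions and polar coordinates -/

/-! Tested against a function `ψ(ω)`, the kinetic equation becomes `ε · transport(ψ) = D ∫ f^ε (Δψ +
κ ω̄^ε·∇ψ) dω` (`IsScaledSolution.weak_transport`). The equilibrium, the continuity equation and the
orientation equation all come from suitable choices of `ψ`.

Equilibrium. The left side tends to zero. Where `ρ ≠ 0` the `ω̄^ε` are eventually unit vectors, so
along every ultrafilter finer than `ε → 0⁺` they converge to some `Ω`, and `f` is a weak solution of
the Fokker-Planck equation with drift `κΩ`. Testing with `ψ = f/M_Ω` gives `∫ M_Ω |∇(f/M_Ω)|² = 0`,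
hence `f = ρ M_Ω` (`eq_vonMises_of_weak`). The flux of `ρ M_Ω` is `c₁ρΩ` with `c₁ > 0`, which
determines `Ω` outside vacuum. So the whole family `ω̄^ε` converges, and `ρΩ`, a multiple of the
flux, is `C²` even across vacuum.

Conservation laws. `ψ = 1` is annihilated by collisions and yields the continuity equation. The
momentum balance passes to the limit as it stands, because all its moments converge together with
their first derivatives; it is then closed by the moments of `M_Ω`.

Orientation. For `w ⊥ Ω` the function `ψ = h(Ω·ω)(w·ω)` solves `Δψ + κΩ·∇ψ = w·ω`
(`generator_gciTest`). It is used with `Ω` replaced by `ω̄^ε` and `w` by its projection `w^ε ⊥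
ω̄^ε`, so that the collision term is exactly `D w^ε·j^ε`. Since `w^ε` is orthogonal to the nonlocal
flux, and the normalised nonlocal flux is `j^ε + ε k₀ Δj + o(ε)` (`tendsto_nonlocalFlux`), division
by `ε` leaves `-D k₀ w·Δj` (`transport_gciTest`). The transport side is evaluated at `ρ M_Ω` by
symmetry about the axis `Ω`. It involves only the moments `B_k = ∫ M h μ^k (1-μ²)/2 dω`, and `c₂ =
B₁/B₀`, `c₃ = 2B₂/B₀`, `c₁ = -κ(2B₀+κB₁)` produce the stated coefficients.

The profile `h`. Its equation has regular singular points at `μ = ±1`. Power series give a bounded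
branch at each pole, and the two branches are matched at `μ = 0`, where an energy identity shows the
matching determinant to be nonzero. The same identity gives `B₀ < 0`. Uniqueness in the weighted
space identifies the smooth solution with the `g` of the statement.

Calculus on the sphere is done through extensions constant along rays, and integrals over the sphere
are reduced to integrals over space against a radial bump. -/

theorem coe_dir {y : E3} (hy : y ≠ 0) : (dir y : E3) = ‖y‖⁻¹ • y := by
  simp [dir, hy]

theorem S2.norm_eq (ω : S2) : ‖(ω : E3)‖ = 1 := by simp

theorem S2.ne_zero (ω : S2) : (ω : E3) ≠ 0 := by
  intro h
  have := S2.norm_eq ω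
  simp [h] at this

theorem dir_coe (ω : S2) : dir (ω : E3) = ω := by
  apply Subtype.ext
  rw [coe_dir (S2.ne_zero ω)]
  simp

theorem dir_smul {c : ℝ} (hc : 0 < c) (y : E3) : dir (c • y) = dir y := by
  by_cases hy : y = 0
  · simp [hy]
  apply Subtype.ext
  rw [coe_dir hy, coe_dir (smul_ne_zero hc.ne' hy), norm_smul, smul_smul, Real.norm_eq_abs,
    abs_of_pos hc]
  congr 1
  field_simp

theorem contDiffOn_dir {n : WithTop ℕ∞} : ContDiffOn ℝ n (fun y => (dir y : E3)) {0}ᶜ := by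
  have : ContDiffOn ℝ n (fun y : E3 => ‖y‖⁻¹ • y) {0}ᶜ := by
    intro y hy
    have : ContDiffAt ℝ n (fun y : E3 => ‖y‖⁻¹) y :=
      (contDiffAt_norm ℝ hy).inv (norm_ne_zero_iff.2 hy)
    exact (this.smul contDiffAt_id).contDiffWithinAt
  exact this.congr fun y hy => coe_dir hy

/-- Polar coordinates: Lebesgue measure off the origin is the product of surface measure and `r²
dr`. The product formula holds for arbitrary factors, so no measurability or integrability is
required. -/
theorem integral_radial_mul_dir (k : ℝ → ℝ) (φ : S2 → ℝ) :
    ∫ y : E3, k ‖y‖ * φ (dir y) =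
      (∫ r in Ioi (0 : ℝ), r ^ 2 * k r) * ∫ ω, φ ω ∂(volume : Measure E3).toSphere := by
  have hdim : Module.finrank ℝ E3 - 1 = 2 := by simp
  calc
    ∫ y : E3, k ‖y‖ * φ (dir y)
      = ∫ x : ({(0)}ᶜ : Set E3), k ‖x.1‖ * φ (dir x.1) ∂(volume.comap Subtype.val) := by
      rw [integral_subtype_comap (measurableSet_singleton _).compl fun y : E3 => k ‖y‖ * φ (dir y),
        restrict_compl_singleton]
    _ = ∫ x : S2 × Ioi (0 : ℝ), φ x.1 * k x.2.1 ∂(volume : Measure E3).toSphere.prod (.volumeIoiPow 2) := by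
      have := (volume : Measure E3).measurePreserving_homeomorphUnitSphereProd.integral_comp
        (Homeomorph.measurableEmbedding _) (fun x : S2 × Ioi (0 : ℝ) => φ x.1 * k x.2.1)
      rw [hdim] at this
      rw [← this]
      refine integral_congr_ae (.of_forall fun x => ?_)
      have h1 : dir x.1 = (homeomorphUnitSphereProd E3 x).1 := by
        apply Subtype.ext
        rw [coe_dir x.2]
        simp
      simp [h1, mul_comm]
    _ = (∫ ω, φ ω ∂(volume : Measure E3).toSphere) * ∫ r : Ioi (0 : ℝ), k r ∂.volumeIoiPow 2 :=
      integral_prod_mul (f := φ) (g := fun r : Ioi (0 : ℝ) => k r)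
    _ = _ := by
      rw [mul_comm]
      congr 1
      simp only [Measure.volumeIoiPow, ENNReal.ofReal]
      rw [integral_withDensity_eq_integral_smul,
        integral_subtype_comap measurableSet_Ioi fun a ↦ Real.toNNReal (a ^ 2) • k a,
        setIntegral_congr_fun measurableSet_Ioi fun x hx ↦ ?_]
      · rw [NNReal.smul_def, Real.coe_toNNReal _ (pow_nonneg hx.out.le _), smul_eq_mul]
      · exact (measurable_subtype_coe.pow_const _).real_toNNReal

/-! ### The uniform measure on the sphere. -/

instance : IsProbabilityMeasure sigma := by
  constructor
  rw [sigma, Measure.smul_apply, smul_eq_mul]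
  refine ENNReal.inv_mul_cancel ?_ (measure_ne_top _ _)
  rw [Measure.measure_univ_ne_zero]
  exact Measure.toSphere_ne_zero _

/-- Full support is what upgrades almost everywhere identities between continuous functions to
pointwise ones. -/
instance : sigma.IsOpenPosMeasure := by
  refine ⟨fun U hU hne => ?_⟩
  rw [sigma, Measure.smul_apply, smul_eq_mul]
  refine mul_ne_zero ?_ (hU.measure_ne_zero _ hne)
  simp only [ne_eq, ENNReal.inv_eq_zero]
  exact measure_ne_top _ _

theorem exists_integral_eq_sigma :
    ∃ c : ℝ, c ≠ 0 ∧ ∀ φ : S2 → ℝ, ∫ ω, φ ω ∂(volume : Measure E3).toSphere = c * ∫ ω, φ ω ∂sigma := by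
  set m := (volume : Measure E3).toSphere univ with hm
  have h0 : m ≠ 0 := by
    rw [hm, Measure.measure_univ_ne_zero]
    exact Measure.toSphere_ne_zero _
  have ht : m ≠ ⊤ := measure_ne_top _ _
  refine ⟨m.toReal, ENNReal.toReal_ne_zero.2 ⟨h0, ht⟩, fun φ => ?_⟩
  rw [sigma, integral_smul_measure, ← hm, smul_eq_mul, ENNReal.toReal_inv,
    mul_inv_cancel_left₀ (ENNReal.toReal_ne_zero.2 ⟨h0, ht⟩)]

/-- A smooth radial cut-off supported in an annulus. -/
noncomputable def annulusBump : ContDiffBump (2 : ℝ) := ⟨1 / 2, 1, by norm_num, by norm_num⟩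

theorem annulusBump_integral_pos (k : ℝ → ℝ) (hk : ContinuousOn k (Ioi 0)) (hpos : ∀ r, 0 < r → 0 < k r) :
    0 < ∫ r in Ioi (0 : ℝ), k r * annulusBump (r ^ 2) := by
  -- The bump is evaluated at `r²`, with centre `2` and outer radius `1`, so it lives on `1 ≤ r ≤ √3
  -- < 2`. It equals one at `r = √2`, the witness of positivity below.
  have hsub : ∀ r : ℝ, r ∉ Icc (1 : ℝ) 2 → 0 < r → annulusBump (r ^ 2) = 0 := by
    intro r hr h0
    apply annulusBump.zero_of_le_dist
    rw [Real.dist_eq]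
    change 1 ≤ _
    by_contra hlt
    push Not at hlt
    rw [abs_lt] at hlt
    exact hr ⟨by nlinarith, by nlinarith⟩
  have heq : ∫ r in Ioi (0 : ℝ), k r * annulusBump (r ^ 2) =
      ∫ r in (1:ℝ)..2, k r * annulusBump (r ^ 2) := by
    rw [intervalIntegral.integral_of_le (by norm_num), ← integral_Icc_eq_integral_Ioc]
    refine setIntegral_eq_of_subset_of_forall_sdiff_eq_zero measurableSet_Ioi
      (fun r hr => lt_of_lt_of_le one_pos hr.1) ?_
    rintro r ⟨h0, h1⟩
    rw [hsub r h1 h0, mul_zero]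
  rw [heq]
  have hc : ContinuousOn (fun r : ℝ => k r * annulusBump (r ^ 2)) (Icc 1 2) := by
    refine (hk.mono fun r hr => lt_of_lt_of_le one_pos hr.1).mul ?_
    exact (annulusBump.continuous.comp (continuous_pow 2)).continuousOn
  refine intervalIntegral.integral_pos (by norm_num) hc
    (fun r hr => mul_nonneg (hpos r (by linarith [hr.1])).le annulusBump.nonneg)
    ⟨Real.sqrt 2, ⟨Real.le_sqrt_of_sq_le (by norm_num), Real.sqrt_le_iff.2 (by norm_num)⟩, ?_⟩
  refine mul_pos (hpos _ (by positivity)) ?_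
  rw [Real.sq_sqrt (by norm_num)]
  exact annulusBump.pos_of_mem_ball (by simp [annulusBump])

/-- Integration over the sphere as integration over space against a radial bump. -/
theorem exists_integral_sigma_eq (p : ℝ → ℝ) (hp : ContinuousOn p (Ioi 0))
    (hpos : ∀ r, 0 < r → 0 < p r) :
    ∃ c : ℝ, c ≠ 0 ∧ ∀ φ : S2 → ℝ,
      ∫ y : E3, annulusBump (‖y‖ ^ 2) * p ‖y‖ * φ (dir y) = c * ∫ ω, φ ω ∂sigma := by
  obtain ⟨c, hc, h⟩ := exists_integral_eq_sigma
  have hI := annulusBump_integral_pos (fun r => r ^ 2 * p r)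
    ((continuous_pow 2).continuousOn.mul hp) (fun r hr => mul_pos (by positivity) (hpos r hr))
  refine ⟨_, mul_ne_zero hI.ne' hc, fun φ => ?_⟩
  rw [integral_radial_mul_dir (fun r => annulusBump (r ^ 2) * p r), h, mul_assoc]
  congr 2
  funext r
  ring

/-! ### The divergence theorem on the sphere -/

theorem inner_eq_sum (x y : E3) : inner ℝ x y = ∑ i, x i * y i := by
  simp [PiLp.inner_apply, mul_comm]

theorem sum_e (x : E3) : ∑ i, x i • e i = x := by
  ext j
  simp [e, Finset.sum_apply, Pi.single_apply]

theorem inner_e (x : E3) (i : Fin 3) : inner ℝ x (e i) = x i := by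
  simp [e, EuclideanSpace.inner_single_right]

theorem fderiv_apply_coord {X : Type*} [NormedAddCommGroup X] [NormedSpace ℝ X]
    {F : X → E3} {x : X} (hF : DifferentiableAt ℝ F x) (w : X) (i : Fin 3) :
    fderiv ℝ (fun y => F y i) x w = fderiv ℝ F x w i := by
  have h := (EuclideanSpace.proj (𝕜 := ℝ) i).hasFDerivAt.comp x hF.hasFDerivAt
  exact congrArg (fun l => l w) h.fderiv

/-- Extensions constant along rays are singular at the origin; a cut-off supported away from it
makes products globally continuous. -/
theorem continuous_mul_of_tsupport {X : Type*} [TopologicalSpace X] {u g : X → ℝ} {U : Set X}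
    (hU : IsOpen U) (hu : Continuous u) (hsupp : tsupport u ⊆ U) (hg : ContinuousOn g U) :
    Continuous fun x => u x * g x := by
  rw [continuous_iff_continuousAt]
  intro x
  by_cases hx : x ∈ tsupport u
  · exact hu.continuousAt.mul (hg.continuousAt (hU.mem_nhds (hsupp hx)))
  · have : (fun x => u x * g x) =ᶠ[𝓝 x] fun _ => 0 := by
      filter_upwards [notMem_tsupport_iff_eventuallyEq.1 hx] with y hy
      simp [hy]
    exact continuousAt_const.congr this.symm

theorem contDiff_annulus : ContDiff ℝ 1 fun y : E3 => annulusBump (‖y‖ ^ 2) :=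
  annulusBump.contDiff.comp (contDiff_norm_sq ℝ)

theorem annulus_zero {y : E3} (hy : ‖y‖ ^ 2 ∉ Icc (1 : ℝ) 3) : annulusBump (‖y‖ ^ 2) = 0 := by
  apply annulusBump.zero_of_le_dist
  rw [Real.dist_eq]
  change 1 ≤ _
  by_contra hlt
  push Not at hlt
  rw [abs_lt] at hlt
  exact hy ⟨by linarith, by linarith⟩

theorem tsupport_annulus :
    tsupport (fun y : E3 => annulusBump (‖y‖ ^ 2)) ⊆ {y | ‖y‖ ^ 2 ∈ Icc (1 : ℝ) 3} := by
  refine closure_minimal (fun y hy => ?_) (isClosed_Icc.preimage (by fun_prop))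
  by_contra h
  exact hy (annulus_zero h)

theorem tsupport_annulus_subset :
    tsupport (fun y : E3 => annulusBump (‖y‖ ^ 2)) ⊆ {0}ᶜ := by
  intro y hy h0
  have := tsupport_annulus hy
  rw [mem_singleton_iff] at h0
  subst h0
  simp at this
  linarith

theorem hasCompactSupport_annulus :
    HasCompactSupport fun y : E3 => annulusBump (‖y‖ ^ 2) := by
  refine (isCompact_closedBall (0 : E3) 3).of_isClosed_subset (isClosed_tsupport _) fun y hy => ?_
  have := (tsupport_annulus hy).2
  rw [mem_closedBall_zero_iff]
  nlinarith [norm_nonneg y]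

theorem fderiv_annulus (y w : E3) :
    fderiv ℝ (fun y : E3 => annulusBump (‖y‖ ^ 2)) y w =
      deriv annulusBump (‖y‖ ^ 2) * (2 * inner ℝ y w) := by
  have h1 : HasFDerivAt (fun y : E3 => ‖y‖ ^ 2) (2 • innerSL ℝ y) y :=
    (hasStrictFDerivAt_norm_sq y).hasFDerivAt
  have h2 : HasDerivAt annulusBump (deriv annulusBump (‖y‖ ^ 2)) (‖y‖ ^ 2) :=
    ((annulusBump.contDiff (n := 1)).differentiable (by norm_num) _).hasDerivAt
  have := (h2.comp_hasFDerivAt y h1).fderiv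
  change fderiv ℝ (annulusBump ∘ fun y : E3 => ‖y‖ ^ 2) y w = _
  rw [this]
  simp

/-- The derivative of a function that is constant along rays is homogeneous of degree `-1`. -/
theorem fderiv_comp_dir {G : Type*} [NormedAddCommGroup G] [NormedSpace ℝ G] (F : S2 → G)
    {y : E3} (hy : y ≠ 0) :
    fderiv ℝ (fun z => F (dir z)) y = ‖y‖⁻¹ • fderiv ℝ (fun z => F (dir z)) (dir y : E3) := by
  have hc : 0 < ‖y‖⁻¹ := by positivity
  have := fderiv_comp_smul (𝕜 := ℝ) (f := fun z => F (dir z)) (x := y) ‖y‖⁻¹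
  rw [← coe_dir hy] at this
  rw [← this]
  congr 1
  funext z
  rw [dir_smul hc]

theorem divg_comp_dir (F : S2 → E3) {y : E3} (hy : y ≠ 0) :
    divg (fun z => F (dir z)) y = ‖y‖⁻¹ * sphDiv F (dir y) := by
  simp only [sphDiv, divg]
  rw [fderiv_comp_dir F hy, Finset.mul_sum]
  simp

/-- The integral over the sphere of the divergence of a tangential field vanishes. -/
theorem integral_sphDiv {F : S2 → E3} (hF : ContDiffOn ℝ 1 (fun y => F (dir y)) {0}ᶜ)
    (htan : ∀ ω : S2, inner ℝ (ω : E3) (F ω) = 0) : ∫ ω, sphDiv F ω ∂sigma = 0 := by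
  -- The weight `r⁻¹` matches the degree of homogeneity of the Euclidean divergence of a field
  -- constant along rays (`divg_comp_dir`).
  obtain ⟨c, hc, h⟩ := exists_integral_sigma_eq (fun r => r⁻¹)
    (continuousOn_inv₀.mono fun r hr => ne_of_gt hr) (fun r hr => inv_pos.2 hr)
  have hopen : IsOpen ({0}ᶜ : Set E3) := isOpen_compl_singleton
  have hdiff : ∀ y : E3, y ≠ 0 → DifferentiableAt ℝ (fun y => F (dir y)) y := fun y hy =>
    (hF.differentiableOn (by norm_num)).differentiableAt (hopen.mem_nhds hy)
  set η : E3 → ℝ := fun y => annulusBump (‖y‖ ^ 2) with hη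
  set G : Fin 3 → E3 → ℝ := fun i y => F (dir y) i with hG
  have hηc : Continuous η := contDiff_annulus.continuous
  have hGc : ∀ i, ContinuousOn (G i) {0}ᶜ := fun i =>
    (EuclideanSpace.proj (𝕜 := ℝ) i).continuous.comp_continuousOn hF.continuousOn
  have hGd : ∀ i, ∀ y : E3, y ≠ 0 → DifferentiableAt ℝ (G i) y := fun i y hy =>
    (EuclideanSpace.proj (𝕜 := ℝ) i).differentiableAt.comp y (hdiff y hy)
  have hG' : ∀ i, ContinuousOn (fun y => fderiv ℝ (G i) y (e i)) {0}ᶜ := by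
    intro i
    have : ContDiffOn ℝ 1 (G i) {0}ᶜ := (EuclideanSpace.proj (𝕜 := ℝ) i).contDiff.comp_contDiffOn hF
    exact (this.continuousOn_fderiv_of_isOpen hopen (by norm_num)).clm_apply continuousOn_const
  have hη' : ∀ i, Continuous fun y => fderiv ℝ η y (e i) := fun i =>
    (contDiff_annulus.continuous_fderiv (by norm_num)).clm_apply continuous_const
  have hsupp' : ∀ i, tsupport (fun y => fderiv ℝ η y (e i)) ⊆ tsupport η := fun i =>
    tsupport_fderiv_apply_subset ℝ (e i)
  have i1 : ∀ i, Integrable fun y => fderiv ℝ η y (e i) * G i y := fun i =>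
    (continuous_mul_of_tsupport hopen (hη' i) ((hsupp' i).trans tsupport_annulus_subset)
      (hGc i)).integrable_of_hasCompactSupport
      ((hasCompactSupport_annulus.fderiv_apply ℝ (e i)).mul_right)
  have i2 : ∀ i, Integrable fun y => η y * fderiv ℝ (G i) y (e i) := fun i =>
    (continuous_mul_of_tsupport hopen hηc tsupport_annulus_subset
      (hG' i)).integrable_of_hasCompactSupport hasCompactSupport_annulus.mul_right
  have i3 : ∀ i, Integrable fun y => η y * G i y := fun i =>
    (continuous_mul_of_tsupport hopen hηc tsupport_annulus_subset
      (hGc i)).integrable_of_hasCompactSupport hasCompactSupport_annulus.mul_right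
  -- Coordinatewise integration by parts in space; the cut-off removes both the origin and infinity.
  have key : ∀ i, ∫ y, η y * fderiv ℝ (G i) y (e i) = - ∫ y, fderiv ℝ η y (e i) * G i y := fun i =>
    integral_mul_fderiv_eq_neg_fderiv_mul_of_integrable (i1 i) (i2 i) (i3 i)
      (fun y _ => contDiff_annulus.differentiable (by norm_num) y)
      (fun y hy => hGd i y (tsupport_annulus_subset hy))
  have hsum : ∫ y, η y * divg (fun y => F (dir y)) y = 0 := by
    have e1 : ∀ y, η y * divg (fun y => F (dir y)) y = ∑ i, η y * fderiv ℝ (G i) y (e i) := by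
      intro y
      by_cases hy : y = 0
      · have : η y = 0 := by simp [hη, hy, annulus_zero]
        simp [this]
      · simp only [divg, Finset.mul_sum]
        exact Finset.sum_congr rfl fun i _ => by rw [fderiv_apply_coord (hdiff y hy)]
    simp_rw [e1]
    rw [integral_finsetSum _ fun i _ => i2 i]
    simp_rw [key]
    rw [Finset.sum_neg_distrib, ← integral_finsetSum _ fun i _ => i1 i, neg_eq_zero]
    refine integral_eq_zero_of_ae (.of_forall fun y => ?_)
    simp only [hη, fderiv_annulus, inner_e, Pi.zero_apply]
    by_cases hy : y = 0
    · simp [hy]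
    -- The gradient of the radial cut-off is radial and the field is tangential, so the remaining
    -- integrand vanishes pointwise.
    have h0 : ∑ i, y i * F (dir y) i = 0 := by
      have := htan (dir y)
      rw [coe_dir hy, real_inner_smul_left, inner_eq_sum] at this
      exact (mul_eq_zero.1 this).resolve_left (by simpa using hy)
    rw [show ∑ i, deriv annulusBump (‖y‖ ^ 2) * (2 * y i) * G i y =
      2 * deriv annulusBump (‖y‖ ^ 2) * ∑ i, y i * F (dir y) i by
        rw [Finset.mul_sum]; exact Finset.sum_congr rfl fun i _ => by simp only [hG]; ring, h0,
      mul_zero]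
  have h1 := h (sphDiv F)
  rw [show ∫ y : E3, annulusBump (‖y‖ ^ 2) * ‖y‖⁻¹ * sphDiv F (dir y) = 0 from ?_] at h1
  · exact (mul_eq_zero.1 h1.symm).resolve_left hc
  · rw [← hsum]
    refine integral_congr_ae (.of_forall fun y => ?_)
    by_cases hy : y = 0
    · have : η y = 0 := by simp [hη, hy, annulus_zero]
      simp only [hη] at this
      simp [hη, this]
    · simp only [hη]
      rw [divg_comp_dir F hy, mul_assoc]

/-! ### Calculus on the sphere -/

/-- `C^n` regularity of a function on the sphere, through its extension along rays. -/
def SphSmooth {G : Type*} [NormedAddCommGroup G] [NormedSpace ℝ G] (n : WithTop ℕ∞) (φ : S2 → G) :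
    Prop :=
  ContDiffOn ℝ n (fun y => φ (dir y)) {0}ᶜ

/-- Tangential gradient of a function on the sphere. -/
noncomputable def sphGrad (φ : S2 → ℝ) (ω : S2) : E3 := gradient (fun y => φ (dir y)) (ω : E3)

section
variable {G : Type*} [NormedAddCommGroup G] [NormedSpace ℝ G] {n : WithTop ℕ∞}

theorem SphSmooth.contDiffAt {φ : S2 → G} (h : SphSmooth n φ) {y : E3} (hy : y ≠ 0) :
    ContDiffAt ℝ n (fun y => φ (dir y)) y :=
  ContDiffOn.contDiffAt h (isOpen_compl_singleton.mem_nhds hy)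

theorem SphSmooth.differentiableAt {φ : S2 → G} (h : SphSmooth n φ) (hn : n ≠ 0) (ω : S2) :
    DifferentiableAt ℝ (fun y => φ (dir y)) (ω : E3) :=
  (h.contDiffAt (S2.ne_zero ω)).differentiableAt hn

theorem SphSmooth.of_le {m : WithTop ℕ∞} {φ : S2 → G} (h : SphSmooth n φ) (hm : m ≤ n) :
    SphSmooth m φ := ContDiffOn.of_le h hm

theorem SphSmooth.continuous {φ : S2 → G} (h : SphSmooth n φ) : Continuous φ := by
  have : Continuous fun ω : S2 => φ (dir (ω : E3)) :=
    (ContDiffOn.continuousOn h).comp_continuous continuous_subtype_val fun ω => S2.ne_zero ω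
  simpa only [dir_coe] using this

theorem sphSmooth_const (c : G) : SphSmooth n fun _ : S2 => c := contDiffOn_const

theorem sphSmooth_coe : SphSmooth n fun ω : S2 => (ω : E3) := contDiffOn_dir

theorem SphSmooth.smul {φ : S2 → ℝ} {F : S2 → G} (h : SphSmooth n φ) (hF : SphSmooth n F) :
    SphSmooth n fun ω => φ ω • F ω := ContDiffOn.smul h hF

theorem SphSmooth.mul {φ ψ : S2 → ℝ} (h : SphSmooth n φ) (hF : SphSmooth n ψ) :
    SphSmooth n fun ω => φ ω * ψ ω := ContDiffOn.mul h hF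

theorem SphSmooth.add {φ ψ : S2 → G} (h : SphSmooth n φ) (hF : SphSmooth n ψ) :
    SphSmooth n fun ω => φ ω + ψ ω := ContDiffOn.add h hF

theorem SphSmooth.sub {φ ψ : S2 → G} (h : SphSmooth n φ) (hF : SphSmooth n ψ) :
    SphSmooth n fun ω => φ ω - ψ ω := ContDiffOn.sub h hF

theorem SphSmooth.inner {φ ψ : S2 → E3} (h : SphSmooth n φ) (hF : SphSmooth n ψ) :
    SphSmooth n fun ω => inner ℝ (φ ω) (ψ ω) := ContDiffOn.inner ℝ h hF

theorem SphSmooth.comp {H : ℝ → G} {φ : S2 → ℝ} (hH : ContDiff ℝ n H) (h : SphSmooth n φ) :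
    SphSmooth n fun ω => H (φ ω) := hH.comp_contDiffOn h

theorem SphSmooth.clm {G' : Type*} [NormedAddCommGroup G'] [NormedSpace ℝ G'] (A : G →L[ℝ] G')
    {φ : S2 → G} (h : SphSmooth n φ) : SphSmooth n fun ω => A (φ ω) :=
  A.contDiff.comp_contDiffOn h

theorem sphSmooth_inner_left (w : E3) : SphSmooth n fun ω : S2 => Inner.inner ℝ w (ω : E3) :=
  (sphSmooth_const w).inner sphSmooth_coe

theorem SphSmooth.proj {F : S2 → E3} (h : SphSmooth n F) : SphSmooth n fun ω => proj ω (F ω) :=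
  h.sub ((sphSmooth_coe.inner h).smul sphSmooth_coe)

end

theorem proj_inner_self (ω : S2) (w : E3) : inner ℝ (ω : E3) (proj ω w) = 0 := by
  simp [proj, inner_sub_right, real_inner_smul_right]

theorem inner_proj_of_tangent {ω : S2} {u : E3} (hu : inner ℝ (ω : E3) u = 0) (w : E3) :
    inner ℝ u (proj ω w) = inner ℝ u w := by
  rw [real_inner_comm] at hu
  simp [proj, inner_sub_right, real_inner_smul_right, hu]

theorem inner_proj_proj (ω : S2) (u w : E3) :
    inner ℝ (proj ω u) (proj ω w) = inner ℝ u w - inner ℝ (ω : E3) u * inner ℝ (ω : E3) w := by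
  rw [inner_proj_of_tangent (proj_inner_self ω u)]
  simp [proj, inner_sub_left, real_inner_smul_left]

/-- The function is constant along the ray through `ω`. Where it is not differentiable the
derivative is zero by convention, so no regularity is assumed. -/
theorem fderiv_comp_dir_self {G : Type*} [NormedAddCommGroup G] [NormedSpace ℝ G] (F : S2 → G)
    (ω : S2) : fderiv ℝ (fun y => F (dir y)) (ω : E3) (ω : E3) = 0 := by
  by_cases h : DifferentiableAt ℝ (fun y => F (dir y)) (ω : E3)
  · have h1 : HasDerivAt (fun s : ℝ => s • (ω : E3)) ((1 : ℝ) • (ω : E3)) 1 :=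
      (hasDerivAt_id (1 : ℝ)).smul_const _
    have h2 : HasFDerivAt (fun y => F (dir y)) (fderiv ℝ (fun y => F (dir y)) (ω : E3))
        ((1 : ℝ) • (ω : E3)) := by rw [one_smul]; exact h.hasFDerivAt
    have h3 := h2.comp_hasDerivAt (1 : ℝ) h1
    have h4 : (fun y => F (dir y)) ∘ (fun s : ℝ => s • (ω : E3)) =ᶠ[𝓝 1] fun _ => F ω := by
      filter_upwards [lt_mem_nhds (zero_lt_one' ℝ)] with s hs
      simp [dir_smul hs, dir_coe]
    have h5 := (hasDerivAt_const (1 : ℝ) (F ω)).congr_of_eventuallyEq h4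
    simpa using h3.unique h5
  · simp [fderiv_zero_of_not_differentiableAt h]

theorem inner_sphGrad_left (φ : S2 → ℝ) (ω : S2) (w : E3) :
    inner ℝ (sphGrad φ ω) w = fderiv ℝ (fun y => φ (dir y)) (ω : E3) w := by
  simp [sphGrad, gradient]

theorem sphGrad_tangent (φ : S2 → ℝ) (ω : S2) : inner ℝ (ω : E3) (sphGrad φ ω) = 0 := by
  rw [real_inner_comm, inner_sphGrad_left, fderiv_comp_dir_self]

theorem gradient_comp_dir (φ : S2 → ℝ) {y : E3} (hy : y ≠ 0) :
    gradient (fun z => φ (dir z)) y = ‖y‖⁻¹ • sphGrad φ (dir y) := by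
  simp [sphGrad, gradient, fderiv_comp_dir φ hy]

/-- The Euclidean gradient of the extension is homogeneous of degree `-1`; multiplied by `‖y‖` it
becomes the extension of the tangential gradient constant along rays. -/
theorem SphSmooth.sphGrad {φ : S2 → ℝ} (h : SphSmooth 2 φ) : SphSmooth 1 (sphGrad φ) := by
  have h1 : ContDiffOn ℝ 1 (fun y => fderiv ℝ (fun z => φ (dir z)) y) {0}ᶜ :=
    ContDiffOn.fderiv_of_isOpen h isOpen_compl_singleton (by norm_num)
  have h2 : ContDiffOn ℝ 1 (fun y => ‖y‖ • gradient (fun z => φ (dir z)) y) {0}ᶜ := by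
    refine ContDiffOn.smul (fun y hy => (contDiffAt_norm ℝ hy).contDiffWithinAt) ?_
    exact (InnerProductSpace.toDual ℝ E3).symm.toContinuousLinearEquiv.contDiff.comp_contDiffOn h1
  refine h2.congr fun y hy => ?_
  rw [gradient_comp_dir φ hy, smul_smul, mul_inv_cancel₀ (norm_ne_zero_iff.2 hy), one_smul]

theorem SphSmooth.continuous_sphDiv {F : S2 → E3} (h : SphSmooth 1 F) :
    Continuous (sphDiv F) := by
  have h1 : ContinuousOn (fun y => fderiv ℝ (fun z => F (dir z)) y) {0}ᶜ :=
    ContDiffOn.continuousOn_fderiv_of_isOpen h isOpen_compl_singleton (by norm_num)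
  have h2 : Continuous fun ω : S2 => fderiv ℝ (fun z => F (dir z)) (ω : E3) :=
    h1.comp_continuous continuous_subtype_val fun ω => S2.ne_zero ω
  unfold sphDiv divg
  fun_prop

theorem continuous_integrable {G : Type*} [NormedAddCommGroup G] {φ : S2 → G}
    (h : Continuous φ) : Integrable φ sigma :=
  h.integrable_of_hasCompactSupport (HasCompactSupport.of_compactSpace φ)

theorem divg_smul {φ : E3 → ℝ} {F : E3 → E3} {x : E3} (hφ : DifferentiableAt ℝ φ x)
    (hF : DifferentiableAt ℝ F x) :
    divg (fun y => φ y • F y) x = φ x * divg F x + fderiv ℝ φ x (F x) := by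
  have : fderiv ℝ φ x (F x) = ∑ i, F x i * fderiv ℝ φ x (e i) := by
    conv_lhs => rw [← sum_e (F x)]
    simp [map_sum]
  rw [this, divg, divg, Finset.mul_sum, ← Finset.sum_add_distrib]
  refine Finset.sum_congr rfl fun i _ => ?_
  rw [fderiv_fun_smul hφ hF]
  simp [mul_comm]

theorem sphDiv_smul {φ : S2 → ℝ} {F : S2 → E3} (hφ : SphSmooth 1 φ) (hF : SphSmooth 1 F) (ω : S2) :
    sphDiv (fun ω => φ ω • F ω) ω = φ ω * sphDiv F ω + inner ℝ (sphGrad φ ω) (F ω) := by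
  rw [inner_sphGrad_left]
  have := divg_smul (hφ.differentiableAt one_ne_zero ω) (hF.differentiableAt one_ne_zero ω)
  simp only [dir_coe] at this
  exact this

theorem sphDiv_add {F F' : S2 → E3} (hF : SphSmooth 1 F) (hF' : SphSmooth 1 F') (ω : S2) :
    sphDiv (fun ω => F ω + F' ω) ω = sphDiv F ω + sphDiv F' ω := by
  simp only [sphDiv, divg]
  rw [fderiv_fun_add (hF.differentiableAt one_ne_zero ω) (hF'.differentiableAt one_ne_zero ω)]
  simp [Finset.sum_add_distrib]

/-- Integration by parts on the sphere. -/
theorem integral_mul_sphDiv {ψ : S2 → ℝ} {F : S2 → E3} (hψ : SphSmooth 1 ψ) (hF : SphSmooth 1 F)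
    (htan : ∀ ω : S2, inner ℝ (ω : E3) (F ω) = 0) :
    ∫ ω, ψ ω * sphDiv F ω ∂sigma = -∫ ω, inner ℝ (sphGrad ψ ω) (F ω) ∂sigma := by
  have h0 := integral_sphDiv (F := fun ω => ψ ω • F ω) (hψ.smul hF)
    (fun ω => by rw [real_inner_smul_right, htan, mul_zero])
  have h1 : Continuous fun ω => inner ℝ (sphGrad ψ ω) (F ω) := by
    have : Continuous fun ω => sphDiv (fun ω => ψ ω • F ω) ω - ψ ω * sphDiv F ω :=
      (hψ.smul hF).continuous_sphDiv.sub (hψ.continuous.mul hF.continuous_sphDiv)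
    refine this.congr fun ω => ?_
    rw [sphDiv_smul hψ hF]; ring
  simp_rw [sphDiv_smul hψ hF] at h0
  have h2 : Continuous fun ω => ψ ω * sphDiv F ω := hψ.continuous.mul hF.continuous_sphDiv
  rw [integral_add (continuous_integrable h2) (continuous_integrable h1)] at h0
  linarith

theorem lapl_eq_sum {G : Type*} [NormedAddCommGroup G] [NormedSpace ℝ G] (F : E3 → G) (x : E3) :
    lapl F x = ∑ i, fderiv ℝ (fderiv ℝ F) x (e i) (e i) := by
  have := congrFun (InnerProductSpace.laplacian_eq_iteratedFDeriv_orthonormalBasis F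
    (EuclideanSpace.basisFun (Fin 3) ℝ)) x
  rw [lapl, this]
  refine Finset.sum_congr rfl fun i _ => ?_
  rw [iteratedFDeriv_two_apply]
  simp [e]

/-- The Euclidean gradient is `‖y‖⁻¹` times the extended tangential gradient. In its divergence the
derivative of `‖y‖⁻¹` is radial and pairs to zero with the tangential gradient. -/
theorem sphLap_eq_sphDiv {φ : S2 → ℝ} (h : SphSmooth 2 φ) (ω : S2) :
    sphLap φ ω = sphDiv (sphGrad φ) ω := by
  have hG : DifferentiableAt ℝ (fun z => sphGrad φ (dir z)) (ω : E3) :=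
    h.sphGrad.differentiableAt one_ne_zero ω
  have hdd : DifferentiableAt ℝ (fun y => fderiv ℝ (fun z => φ (dir z)) y) (ω : E3) :=
    ((h.contDiffAt (S2.ne_zero ω)).fderiv_right (m := 1) (by norm_num)).differentiableAt one_ne_zero
  have hn : DifferentiableAt ℝ (fun y : E3 => ‖y‖⁻¹) (ω : E3) :=
    ((contDiffAt_norm ℝ (S2.ne_zero ω) (n := 1)).inv
      (norm_ne_zero_iff.2 (S2.ne_zero ω))).differentiableAt one_ne_zero
  have h1 : (fun y => gradient (fun z => φ (dir z)) y) =ᶠ[𝓝 (ω : E3)]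
      fun y => ‖y‖⁻¹ • sphGrad φ (dir y) := by
    filter_upwards [isOpen_compl_singleton.mem_nhds (S2.ne_zero ω)] with y hy
    exact gradient_comp_dir φ hy
  have h2 : divg (fun y => gradient (fun z => φ (dir z)) y) (ω : E3) = sphLap φ ω := by
    rw [sphLap, lapl_eq_sum, divg]
    refine Finset.sum_congr rfl fun i _ => ?_
    have hgd : DifferentiableAt ℝ (fun y => gradient (fun z => φ (dir z)) y) (ω : E3) :=
      (InnerProductSpace.toDual ℝ E3).symm.toContinuousLinearEquiv.differentiableAt.comp _ hdd
    rw [← fderiv_apply_coord hgd]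
    have : (fun y => gradient (fun z => φ (dir z)) y i) =
        fun y => fderiv ℝ (fun z => φ (dir z)) y (e i) := by
      funext y
      rw [← inner_e]
      simp [gradient]
    rw [this, fderiv_clm_apply hdd (differentiableAt_const _)]
    simp
  rw [← h2, sphDiv]
  have h3 : divg (fun y => gradient (fun z => φ (dir z)) y) (ω : E3) =
      divg (fun y => ‖y‖⁻¹ • sphGrad φ (dir y)) (ω : E3) := by
    simp only [divg, h1.fderiv_eq]
  rw [h3, divg_smul hn hG]
  have h4 : fderiv ℝ (fun y : E3 => ‖y‖⁻¹) (ω : E3) (sphGrad φ ω) = 0 := by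
    have e2 : (fun y : E3 => ‖y‖⁻¹) = fun y => (Real.sqrt (‖y‖ ^ 2))⁻¹ := by
      funext y; rw [Real.sqrt_sq (norm_nonneg y)]
    have e3 : HasFDerivAt (fun y : E3 => ‖y‖ ^ 2) (2 • innerSL ℝ (ω : E3)) (ω : E3) :=
      (hasStrictFDerivAt_norm_sq (ω : E3)).hasFDerivAt
    have e4 : HasDerivAt (fun s : ℝ => (Real.sqrt s)⁻¹)
        (deriv (fun s : ℝ => (Real.sqrt s)⁻¹) (‖(ω : E3)‖ ^ 2)) (‖(ω : E3)‖ ^ 2) := by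
      refine DifferentiableAt.hasDerivAt ?_
      refine (DifferentiableAt.sqrt differentiableAt_id ?_).inv ?_ <;> simp
    have e5 := (e4.comp_hasFDerivAt (ω : E3) e3).fderiv
    rw [e2]
    change fderiv ℝ ((fun s : ℝ => (Real.sqrt s)⁻¹) ∘ fun y : E3 => ‖y‖ ^ 2) (ω : E3) _ = 0
    rw [e5]
    simp [sphGrad_tangent]
  rw [dir_coe, h4]
  simp

/-- The Laplace-Beltrami operator is symmetric. -/
theorem integral_mul_sphLap {ψ φ : S2 → ℝ} (hψ : SphSmooth 1 ψ) (hφ : SphSmooth 2 φ) :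
    ∫ ω, ψ ω * sphLap φ ω ∂sigma = -∫ ω, inner ℝ (sphGrad ψ ω) (sphGrad φ ω) ∂sigma := by
  simp_rw [sphLap_eq_sphDiv hφ]
  exact integral_mul_sphDiv hψ hφ.sphGrad (sphGrad_tangent φ)

theorem integral_mul_sphLap_comm {ψ φ : S2 → ℝ} (hψ : SphSmooth 2 ψ) (hφ : SphSmooth 2 φ) :
    ∫ ω, ψ ω * sphLap φ ω ∂sigma = ∫ ω, φ ω * sphLap ψ ω ∂sigma := by
  rw [integral_mul_sphLap (hψ.of_le (by norm_num)) hφ,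
    integral_mul_sphLap (hφ.of_le (by norm_num)) hψ]
  simp_rw [real_inner_comm]

/-! ### Explicit gradients and divergences -/

theorem hasFDerivAt_dir (ω : S2) :
    HasFDerivAt (fun y => (dir y : E3))
      (ContinuousLinearMap.id ℝ E3 - (innerSL ℝ (ω : E3)).smulRight (ω : E3)) (ω : E3) := by
  have e3 : HasFDerivAt (fun y : E3 => ‖y‖ ^ 2) (2 • innerSL ℝ (ω : E3)) (ω : E3) :=
    (hasStrictFDerivAt_norm_sq (ω : E3)).hasFDerivAt
  have e4 : HasFDerivAt (fun y : E3 => ‖y‖⁻¹) (-innerSL ℝ (ω : E3)) (ω : E3) := by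
    have h1 : HasDerivAt (fun s : ℝ => (Real.sqrt s)⁻¹) (-(1 / 2)) (‖(ω : E3)‖ ^ 2) := by
      have := (Real.hasDerivAt_sqrt (x := ‖(ω : E3)‖ ^ 2) (by simp)).inv (by simp)
      refine this.congr_deriv ?_
      simp
    have h2 := h1.comp_hasFDerivAt (ω : E3) e3
    have e2 : (fun y : E3 => ‖y‖⁻¹) = (fun s : ℝ => (Real.sqrt s)⁻¹) ∘ fun y => ‖y‖ ^ 2 := by
      funext y; simp
    rw [e2]
    refine h2.congr_fderiv ?_
    ext v
    simp
  have e5 := e4.smul (hasFDerivAt_id (ω : E3))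
  have e6 : (fun y => (dir y : E3)) =ᶠ[𝓝 (ω : E3)] fun y => ‖y‖⁻¹ • y := by
    filter_upwards [isOpen_compl_singleton.mem_nhds (S2.ne_zero ω)] with y hy
    exact coe_dir hy
  refine (e5.congr_of_eventuallyEq e6).congr_fderiv ?_
  ext v
  simp [sub_eq_add_neg]

theorem fderiv_dir_apply (ω : S2) (v : E3) :
    fderiv ℝ (fun y => (dir y : E3)) (ω : E3) v = proj ω v := by
  rw [(hasFDerivAt_dir ω).fderiv]
  simp [proj]

theorem sphGrad_eq {φ : S2 → ℝ} {ω : S2} {g : E3}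
    (h : ∀ w, fderiv ℝ (fun y => φ (dir y)) (ω : E3) w = inner ℝ g w) : sphGrad φ ω = g := by
  refine ext_inner_right ℝ fun w => ?_
  rw [inner_sphGrad_left, h]

theorem sphGrad_const (c : ℝ) (ω : S2) : sphGrad (fun _ => c) ω = 0 :=
  sphGrad_eq fun w => by simp

theorem sphGrad_inner (w : E3) (ω : S2) : sphGrad (fun ω => inner ℝ w (ω : E3)) ω = proj ω w := by
  refine sphGrad_eq fun u => ?_
  have := ((innerSL ℝ w).hasFDerivAt.comp (ω : E3) (hasFDerivAt_dir ω)).fderiv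
  change fderiv ℝ ((innerSL ℝ w) ∘ fun y => (dir y : E3)) (ω : E3) u = _
  rw [this]
  simp [proj, inner_sub_left, real_inner_smul_right, real_inner_comm, mul_comm]

theorem sphGrad_mul {φ ψ : S2 → ℝ} (hφ : SphSmooth 1 φ) (hψ : SphSmooth 1 ψ) (ω : S2) :
    sphGrad (fun ω => φ ω * ψ ω) ω = φ ω • sphGrad ψ ω + ψ ω • sphGrad φ ω := by
  refine sphGrad_eq fun w => ?_
  rw [fderiv_fun_mul (hφ.differentiableAt one_ne_zero ω) (hψ.differentiableAt one_ne_zero ω)]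
  simp [inner_add_left, real_inner_smul_left, inner_sphGrad_left, dir_coe]

theorem sphGrad_comp {H : ℝ → ℝ} {φ : S2 → ℝ} (hH : Differentiable ℝ H) (hφ : SphSmooth 1 φ)
    (ω : S2) : sphGrad (fun ω => H (φ ω)) ω = deriv H (φ ω) • sphGrad φ ω := by
  refine sphGrad_eq fun w => ?_
  have h1 := (hH (φ (dir (ω : E3)))).hasDerivAt.comp_hasFDerivAt (ω : E3)
    (hφ.differentiableAt one_ne_zero ω).hasFDerivAt
  change fderiv ℝ (H ∘ fun y => φ (dir y)) (ω : E3) w = _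
  rw [h1.fderiv]
  simp [real_inner_smul_left, inner_sphGrad_left, dir_coe]

/-- The tangential trace of `A` is `tr A - ω·Aω`, and removing the normal component `(ω·Aω) ω` costs
another `2 ω·Aω`, since `ω` has divergence `2` on the sphere. -/
theorem sphDiv_proj_clm (A : E3 →L[ℝ] E3) (ω : S2) :
    sphDiv (fun ω => proj ω (A ω)) ω = ∑ i, A (e i) i - 3 * inner ℝ (ω : E3) (A ω) := by
  have hd := hasFDerivAt_dir ω
  have hA := A.hasFDerivAt.comp (ω : E3) hd
  have hi := hd.inner ℝ hA
  have hall := (hA.sub (hi.smul hd)).fderiv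
  have hn : ∑ i, (ω : E3) i * (ω : E3) i = 1 := by
    rw [← inner_eq_sum, real_inner_self_eq_norm_sq]; simp
  rw [sphDiv, divg]
  have : ∀ i, fderiv ℝ (fun y => proj (dir y) (A (dir y))) (ω : E3) (e i) i =
      A (e i) i - (ω : E3) i * A ω i - (inner ℝ (ω : E3) (A (e i)) - (ω : E3) i * inner ℝ (ω : E3) (A ω)
        + (A ω i - (ω : E3) i * inner ℝ (ω : E3) (A ω))) * (ω : E3) i
       - inner ℝ (ω : E3) (A ω) * (1 - (ω : E3) i * (ω : E3) i) := by
    intro i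
    change fderiv ℝ ((⇑A ∘ fun y => (dir y : E3)) -
      (fun y => inner ℝ (dir y : E3) ((⇑A ∘ fun y => (dir y : E3)) y)) • fun y => (dir y : E3)) (ω : E3) (e i) i = _
    rw [hall]
    have hei : (e i : E3) i = 1 := by simp [e]
    have h6 : inner ℝ (e i) (A (ω : E3)) = A ω i := by rw [real_inner_comm, inner_e]
    simp [dir_coe, inner_e, hei, real_inner_smul_right, real_inner_smul_left, inner_sub_left, inner_sub_right, h6]
    ring
  simp_rw [this]
  have h3 : A (ω : E3) = ∑ i, (ω : E3) i • A (e i) := by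
    conv_lhs => rw [← sum_e (ω : E3)]
    simp
  have h4 : ∑ i, (ω : E3) i * inner ℝ (ω : E3) (A (e i)) = inner ℝ (ω : E3) (A ω) := by
    rw [h3, inner_sum]
    simp [real_inner_smul_right]
  have h5 := inner_eq_sum (ω : E3) (A ω)
  simp only [Fin.sum_univ_three] at *
  linear_combination 2 * h5 - h4 + 3 * inner ℝ (ω : E3) (A ω) * hn

theorem sphDiv_coe (ω : S2) : sphDiv (fun ω => (ω : E3)) ω = 2 := by
  have hn : ∑ i, (ω : E3) i * (ω : E3) i = 1 := by
    rw [← inner_eq_sum, real_inner_self_eq_norm_sq]; simp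
  simp only [sphDiv, divg, fderiv_dir_apply, proj, inner_e]
  simp only [PiLp.sub_apply, PiLp.smul_apply, smul_eq_mul, Finset.sum_sub_distrib, hn]
  simp [e]
  norm_num

theorem sphDiv_proj (w : E3) (ω : S2) :
    sphDiv (fun ω => proj ω w) ω = -2 * inner ℝ w (ω : E3) := by
  have h1 : SphSmooth 1 fun ω : S2 => -inner ℝ w (ω : E3) :=
    contDiff_neg.comp_contDiffOn (sphSmooth_inner_left (n := 1) w)
  have h2 : (fun ω : S2 => proj ω w) = fun ω : S2 => w + (-inner ℝ w (ω : E3)) • (ω : E3) := by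
    funext ω
    rw [proj, real_inner_comm, neg_smul, sub_eq_add_neg]
  have h3 := sphGrad_tangent (fun ω : S2 => -inner ℝ w (ω : E3)) ω
  rw [real_inner_comm] at h3
  rw [h2, sphDiv_add (sphSmooth_const w) (h1.smul sphSmooth_coe), sphDiv_smul h1 sphSmooth_coe,
    sphDiv_coe, h3]
  simp [sphDiv, divg, mul_comm]

/-- A function on the sphere with vanishing gradient is constant. -/
theorem eq_of_sphGrad_eq_zero {φ : S2 → ℝ} (h : SphSmooth 1 φ) (h0 : ∀ ω, sphGrad φ ω = 0)
    (ω ω' : S2) : φ ω = φ ω' := by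
  have hconn : IsPreconnected ({0}ᶜ : Set E3) :=
    (isConnected_compl_singleton_of_one_lt_rank (by
      rw [rank_eq_card_basis (EuclideanSpace.basisFun (Fin 3) ℝ).toBasis]; norm_num) 0).isPreconnected
  have := isOpen_compl_singleton.is_const_of_fderiv_eq_zero (𝕜 := ℝ) hconn
    (ContDiffOn.differentiableOn h one_ne_zero) (fun y hy => by
      rw [fderiv_comp_dir φ hy]
      have : fderiv ℝ (fun z => φ (dir z)) (dir y : E3) = 0 := by
        ext w
        rw [← inner_sphGrad_left, h0]
        simp
      rw [this]; simp) (S2.ne_zero ω) (S2.ne_zero ω')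
  simpa [dir_coe] using this

/-! ### Integrals of zonal functions -/

theorem sphere_integral_add {G : Type*} [NormedAddCommGroup G] [NormedSpace ℝ G] {f g : S2 → G}
    (hf : Continuous f) (hg : Continuous g) :
    ∫ ω, (f ω + g ω) ∂sigma = ∫ ω, f ω ∂sigma + ∫ ω, g ω ∂sigma :=
  integral_add (continuous_integrable hf) (continuous_integrable hg)

theorem sphere_integral_sub {G : Type*} [NormedAddCommGroup G] [NormedSpace ℝ G] {f g : S2 → G}
    (hf : Continuous f) (hg : Continuous g) :
    ∫ ω, (f ω - g ω) ∂sigma = ∫ ω, f ω ∂sigma - ∫ ω, g ω ∂sigma :=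
  integral_sub (continuous_integrable hf) (continuous_integrable hg)

theorem S2.inner_mem (Ω ω : S2) : inner ℝ (Ω : E3) (ω : E3) ∈ Icc (-1 : ℝ) 1 := by
  have h := abs_real_inner_le_norm (Ω : E3) (ω : E3)
  simp only [S2.norm_eq, mul_one] at h
  exact abs_le.1 h

theorem S2.inner_self (ω : S2) : inner ℝ (ω : E3) (ω : E3) = 1 := by
  rw [real_inner_self_eq_norm_sq, S2.norm_eq, one_pow]

/-- Divergence theorem for the field `H(Ω·ω) P_{ω^⊥}Ω`. For `H` a power it becomes the recursion
that computes all zonal moments. -/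
theorem integral_zonal_deriv {H : ℝ → ℝ} (hH : ContDiff ℝ 1 H) (Ω : S2) :
    ∫ ω : S2, ((1 - inner ℝ (Ω : E3) (ω : E3) ^ 2) * deriv H (inner ℝ (Ω : E3) (ω : E3))
      - 2 * inner ℝ (Ω : E3) (ω : E3) * H (inner ℝ (Ω : E3) (ω : E3))) ∂sigma = 0 := by
  have h1 : SphSmooth 1 fun ω : S2 => H (inner ℝ (Ω : E3) (ω : E3)) :=
    SphSmooth.comp hH (sphSmooth_inner_left _)
  have h2 : SphSmooth 1 fun ω : S2 => proj ω (Ω : E3) := (sphSmooth_const _).proj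
  have := integral_sphDiv (F := fun ω : S2 => H (inner ℝ (Ω : E3) (ω : E3)) • proj ω (Ω : E3))
    (h1.smul h2) fun ω => by rw [real_inner_smul_right, proj_inner_self, mul_zero]
  rw [← this]
  refine integral_congr_ae (.of_forall fun ω => ?_)
  simp only
  rw [sphDiv_smul h1 h2, sphDiv_proj, sphGrad_comp (hH.differentiable one_ne_zero)
    (sphSmooth_inner_left _), sphGrad_inner, real_inner_smul_left, inner_proj_proj, S2.inner_self,
    real_inner_comm (Ω : E3) (ω : E3)]
  ring

theorem continuous_zonal {φ : ℝ → ℝ} (hφ : Continuous φ) (Ω : S2) :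
    Continuous fun ω : S2 => φ (inner ℝ (Ω : E3) (ω : E3)) := by
  fun_prop

/-- With `H = x^(n+1)` the divergence identity reads `(n+3) m_{n+2} = (n+1) m_n`. The recursion
jumps by two, hence two base cases. -/
theorem integral_zonal_pow (Ω : S2) (n : ℕ) :
    ∫ ω : S2, inner ℝ (Ω : E3) (ω : E3) ^ n ∂sigma = (1 / 2) * ∫ x in (-1 : ℝ)..1, x ^ n := by
  induction n using Nat.strong_induction_on with
  | _ n ih =>
    match n with
    | 0 => simp; norm_num
    | 1 =>
      have := integral_zonal_deriv (H := fun _ => 1) contDiff_const Ω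
      simp only [deriv_const', mul_zero, mul_one, zero_sub] at this
      rw [integral_neg, integral_const_mul] at this
      simp only [pow_one]
      simp
      linarith
    | n + 2 =>
      have h := integral_zonal_deriv (H := fun x => x ^ (n + 1)) (by fun_prop) Ω
      have h2 : ∀ ω : S2, (1 - inner ℝ (Ω : E3) (ω : E3) ^ 2) *
          deriv (fun x : ℝ => x ^ (n + 1)) (inner ℝ (Ω : E3) (ω : E3))
          - 2 * inner ℝ (Ω : E3) (ω : E3) * inner ℝ (Ω : E3) (ω : E3) ^ (n + 1) =
          (n + 1) * inner ℝ (Ω : E3) (ω : E3) ^ n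
            - (n + 3) * inner ℝ (Ω : E3) (ω : E3) ^ (n + 2) := by
        intro ω
        simp
        ring
      simp_rw [h2] at h
      have i1 : ∀ k : ℕ, Integrable (fun ω : S2 => inner ℝ (Ω : E3) (ω : E3) ^ k) sigma := fun k =>
        continuous_integrable (continuous_zonal (continuous_pow k) Ω)
      rw [integral_sub ((i1 n).const_mul _) ((i1 _).const_mul _), integral_const_mul,
        integral_const_mul, ih n (by omega)] at h
      rw [integral_pow] at h ⊢
      have h3 : (n : ℝ) + 1 ≠ 0 := by positivity
      have h4 : (n : ℝ) + 3 ≠ 0 := by positivity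
      have h5 : ((n : ℝ) + 1) * (1 / 2 * ((1 ^ (n + 1) - (-1) ^ (n + 1)) / (n + 1))) =
        1 / 2 * (1 - (-1) ^ (n + 1)) := by field_simp; simp
      rw [h5] at h
      push_cast
      have h6 : ((n : ℝ) + 2 + 1) = n + 3 := by ring
      rw [h6]
      field_simp
      rw [show n + 2 + 1 = n + 1 + 2 by ring, pow_add (-1 : ℝ) (n + 1) 2]
      simp only [one_pow]
      linarith

theorem integral_zonal_polynomial (Ω : S2) (p : Polynomial ℝ) :
    ∫ ω : S2, p.eval (inner ℝ (Ω : E3) (ω : E3)) ∂sigma =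
      (1 / 2) * ∫ x in (-1 : ℝ)..1, p.eval x := by
  simp_rw [Polynomial.eval_eq_sum_range]
  rw [integral_finsetSum _ fun i _ =>
      (continuous_integrable (continuous_zonal (continuous_pow i) Ω)).const_mul _,
    intervalIntegral.integral_finsetSum fun i _ =>
      Continuous.intervalIntegrable (by fun_prop) _ _, Finset.mul_sum]
  refine Finset.sum_congr rfl fun i _ => ?_
  rw [integral_const_mul, intervalIntegral.integral_const_mul, integral_zonal_pow]
  ring

/-- Archimedes' hat-box theorem. -/
theorem integral_zonal {φ : ℝ → ℝ} (hφ : Continuous φ) (Ω : S2) :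
    ∫ ω : S2, φ (inner ℝ (Ω : E3) (ω : E3)) ∂sigma = (1 / 2) * ∫ x in (-1 : ℝ)..1, φ x := by
  rw [← sub_eq_zero, ← abs_eq_zero]
  refine le_antisymm (le_of_forall_pos_le_add fun δ hδ => ?_) (abs_nonneg _)
  -- Weierstrass approximation. The error is at most `δ/2` on the sphere, of mass one, and at most
  -- half of `2 · δ/2` on the interval, of length two.
  obtain ⟨p, hp⟩ := exists_polynomial_near_of_continuousOn (-1) 1 φ hφ.continuousOn (δ / 2)
    (by positivity)
  have h1 : |∫ ω : S2, (φ (inner ℝ (Ω : E3) (ω : E3)) - p.eval (inner ℝ (Ω : E3) (ω : E3))) ∂sigma|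
      ≤ δ / 2 := by
    have := norm_integral_le_of_norm_le_const (μ := sigma)
      (f := fun ω : S2 => φ (inner ℝ (Ω : E3) (ω : E3)) - p.eval (inner ℝ (Ω : E3) (ω : E3)))
      (C := δ / 2) (.of_forall fun ω => by
        rw [Real.norm_eq_abs, abs_sub_comm]; exact (hp _ (S2.inner_mem Ω ω)).le)
    simpa using this
  have h2 : |∫ x in (-1 : ℝ)..1, (φ x - p.eval x)| ≤ δ := by
    have := intervalIntegral.norm_integral_le_of_norm_le_const (a := -1) (b := 1)
      (f := fun x : ℝ => φ x - p.eval x) (C := δ / 2) (fun x hx => by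
        rw [uIoc_of_le (by norm_num)] at hx
        rw [Real.norm_eq_abs, abs_sub_comm]; exact (hp _ ⟨hx.1.le, hx.2⟩).le)
    rw [Real.norm_eq_abs] at this
    norm_num at this
    linarith
  rw [integral_sub (continuous_integrable (continuous_zonal hφ Ω))
    (continuous_integrable (continuous_zonal p.continuous Ω)), integral_zonal_polynomial] at h1
  rw [intervalIntegral.integral_sub (hφ.intervalIntegrable _ _)
    (p.continuous.intervalIntegrable _ _)] at h2
  rw [abs_le] at *
  constructor <;> linarith [h1.1, h1.2, h2.1, h2.2]

/-! ### Isometry invariance and moments about an axis -/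

/-- Transferred to space, both the radial cut-off and Lebesgue measure are invariant under linear
isometries. -/
theorem integral_comp_isometry (L : E3 ≃ₗᵢ[ℝ] E3) (φ : E3 → ℝ) :
    ∫ ω : S2, φ (L ω) ∂sigma = ∫ ω : S2, φ ω ∂sigma := by
  obtain ⟨c, hc, h⟩ := exists_integral_sigma_eq (fun _ => 1) continuousOn_const
    (fun _ _ => one_pos)
  have h1 := h fun ω => φ (L ω)
  have h2 := h fun ω => φ ω
  refine mul_left_cancel₀ hc ?_
  rw [← h1, ← h2, ← L.measurePreserving.integral_comp L.toHomeomorph.measurableEmbedding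
    fun y => annulusBump (‖y‖ ^ 2) * 1 * φ (dir y)]
  refine integral_congr_ae (.of_forall fun y => ?_)
  simp only [mul_one, LinearIsometryEquiv.norm_map]
  by_cases hy : y = 0
  · rw [hy, map_zero, annulus_zero (by simp), zero_mul, zero_mul]
  · rw [coe_dir hy, coe_dir (by simpa using hy : L y ≠ 0)]
    simp

variable {φ : ℝ → ℝ} {Ω : S2}

/-- The half turn about the axis `Ω`. -/
theorem exists_halfTurn (Ω : S2) : ∃ L : E3 ≃ₗᵢ[ℝ] E3,
    ∀ y, L y = (2 * inner ℝ (Ω : E3) y) • (Ω : E3) - y := by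
  refine ⟨(Submodule.span ℝ {(Ω : E3)}).reflection, fun y => ?_⟩
  rw [Submodule.reflection_apply, Submodule.starProjection_unit_singleton ℝ (S2.norm_eq Ω),
    mul_smul, two_smul, two_smul]

/-- The half turn about `Ω` preserves `Ω·ω` and changes the sign of `w·ω`. -/
theorem integral_zonal_mul_inner (φ : ℝ → ℝ) {w : E3} (hw : inner ℝ (Ω : E3) w = 0) :
    ∫ ω : S2, φ (inner ℝ (Ω : E3) (ω : E3)) * inner ℝ w (ω : E3) ∂sigma = 0 := by
  obtain ⟨L, hL⟩ := exists_halfTurn Ω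
  have h := integral_comp_isometry L fun y => φ (inner ℝ (Ω : E3) y) * inner ℝ w y
  have h1 : ∀ ω : S2, φ (inner ℝ (Ω : E3) (L ω)) * inner ℝ w (L ω) =
      -(φ (inner ℝ (Ω : E3) (ω : E3)) * inner ℝ w (ω : E3)) := by
    intro ω
    have e1 : inner ℝ (Ω : E3) (L ω) = inner ℝ (Ω : E3) (ω : E3) := by
      rw [hL, inner_sub_right, real_inner_smul_right, S2.inner_self]; ring
    have e2 : inner ℝ w (L ω) = -inner ℝ w (ω : E3) := by
      rw [hL, inner_sub_right, real_inner_smul_right, real_inner_comm (Ω : E3) w, hw]; ring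
    rw [e1, e2]; ring
  simp_rw [h1] at h
  rw [integral_neg] at h
  linarith

/-- For two orthonormal directions perpendicular to `Ω` the second moments agree, by a reflection
exchanging them, and their squares add up to `1 - (Ω·ω)²`. The divisor `4` combines this halving
with the `1/2` of the hat-box theorem. -/
theorem integral_zonal_mul_inner_sq (hφ : Continuous φ) {w : E3} (hw : inner ℝ (Ω : E3) w = 0) :
    ∫ ω : S2, φ (inner ℝ (Ω : E3) (ω : E3)) * inner ℝ w (ω : E3) ^ 2 ∂sigma =
      ‖w‖ ^ 2 * ∫ x in (-1 : ℝ)..1, φ x * (1 - x ^ 2) / 4 := by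
  by_cases hw0 : w = 0
  · simp [hw0]
  set u : E3 := ‖w‖⁻¹ • w with hu
  have hun : ‖u‖ = 1 := by simp [hu, norm_smul, hw0]
  have hwu : w = ‖w‖ • u := by
    rw [hu, smul_smul, mul_inv_cancel₀ (norm_ne_zero_iff.2 hw0), one_smul]
  have huΩ : inner ℝ (Ω : E3) u = 0 := by rw [hu, real_inner_smul_right, hw, mul_zero]
  obtain ⟨b, hb⟩ := Orthonormal.exists_orthonormalBasis_extension_of_card_eq (𝕜 := ℝ) (E := E3)
    (ι := Fin 3) (by simp) (v := ![(Ω : E3), u, 0]) (s := {0, 1}) (by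
      rw [orthonormal_iff_ite]
      rintro ⟨i, hi⟩ ⟨j, hj⟩
      simp only [mem_insert_iff, mem_singleton_iff] at hi hj
      rcases hi with rfl | rfl <;> rcases hj with rfl | rfl
      · simp
      · simpa using huΩ
      · simpa [real_inner_comm] using huΩ
      · simp [hun])
  have hb0 : b 0 = (Ω : E3) := by simpa using hb 0 (by simp)
  have hb1 : b 1 = u := by simpa using hb 1 (by simp)
  have hsum : ∀ ω : S2, inner ℝ u (ω : E3) ^ 2 + inner ℝ (b 2) (ω : E3) ^ 2 =
      1 - inner ℝ (Ω : E3) (ω : E3) ^ 2 := by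
    intro ω
    have := b.sum_sq_inner_left (ω : E3)
    simp only [Fin.sum_univ_three, hb0, hb1, S2.norm_eq] at this
    rw [real_inner_comm (ω : E3) u, real_inner_comm (ω : E3) (b 2), real_inner_comm (ω : E3) (Ω : E3)]
    linarith
  have hnorm : ‖u‖ = ‖b 2‖ := by rw [hun, b.orthonormal.1 2]
  have hsym : ∫ ω : S2, φ (inner ℝ (Ω : E3) (ω : E3)) * inner ℝ u (ω : E3) ^ 2 ∂sigma =
      ∫ ω : S2, φ (inner ℝ (Ω : E3) (ω : E3)) * inner ℝ (b 2) (ω : E3) ^ 2 ∂sigma := by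
    -- Reflection in the plane orthogonal to `u - b 2`: it exchanges the two directions and fixes
    -- `Ω`.
    set L := (Submodule.span ℝ {u - b 2})ᗮ.reflection with hL
    have h1 : L u = b 2 := Submodule.reflection_sub hnorm
    have h2 : L (Ω : E3) = Ω := by
      apply Submodule.reflection_mem_subspace_eq_self
      rw [Submodule.mem_orthogonal_singleton_iff_inner_right, inner_sub_left, ← hb1, ← hb0]
      simp [b.inner_eq_ite]
    rw [← integral_comp_isometry L fun y => φ (inner ℝ (Ω : E3) y) * inner ℝ (b 2) y ^ 2]
    refine integral_congr_ae (.of_forall fun ω => ?_)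
    have e1 := L.inner_map_map (Ω : E3) (ω : E3)
    have e2 := L.inner_map_map u (ω : E3)
    rw [h2] at e1
    rw [h1] at e2
    simp only [e1, e2]
  have i1 : ∀ v : E3, Integrable
      (fun ω : S2 => φ (inner ℝ (Ω : E3) (ω : E3)) * inner ℝ v (ω : E3) ^ 2) sigma := fun v =>
    continuous_integrable (by fun_prop)
  have htot : ∫ ω : S2, φ (inner ℝ (Ω : E3) (ω : E3)) * inner ℝ u (ω : E3) ^ 2 ∂sigma +
      ∫ ω : S2, φ (inner ℝ (Ω : E3) (ω : E3)) * inner ℝ (b 2) (ω : E3) ^ 2 ∂sigma =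
      (1 / 2) * ∫ x in (-1 : ℝ)..1, φ x * (1 - x ^ 2) := by
    rw [← integral_add (i1 _) (i1 _), ← integral_zonal (by fun_prop) Ω]
    refine integral_congr_ae (.of_forall fun ω => ?_)
    simp only
    rw [← hsum]; ring
  have hscale : ∀ ω : S2, φ (inner ℝ (Ω : E3) (ω : E3)) * inner ℝ w (ω : E3) ^ 2 =
      ‖w‖ ^ 2 * (φ (inner ℝ (Ω : E3) (ω : E3)) * inner ℝ u (ω : E3) ^ 2) := by
    intro ω
    nth_rw 1 [hwu]
    rw [real_inner_smul_left]; ring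
  simp_rw [hscale]
  rw [integral_const_mul, intervalIntegral.integral_div]
  congr 1
  linarith

/-- Polarisation of the quadratic moment for the tangential part of `u`; the part of `u` along `Ω`
gives an odd integrand. -/
theorem integral_zonal_mul_inner_mul_inner (hφ : Continuous φ) {w : E3}
    (hw : inner ℝ (Ω : E3) w = 0) (u : E3) :
    ∫ ω : S2, φ (inner ℝ (Ω : E3) (ω : E3)) * inner ℝ w (ω : E3) * inner ℝ u (ω : E3) ∂sigma =
      inner ℝ w u * ∫ x in (-1 : ℝ)..1, φ x * (1 - x ^ 2) / 4 := by
  set u' := proj Ω u with hu'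
  have hu0 : inner ℝ (Ω : E3) u' = 0 := proj_inner_self Ω u
  have hwu : inner ℝ w u = inner ℝ w u' := (inner_proj_of_tangent hw u).symm
  have h1 := integral_zonal_mul_inner_sq hφ (Ω := Ω) (w := w + u')
    (by rw [inner_add_right, hw, hu0, add_zero])
  have h2 := integral_zonal_mul_inner_sq hφ (Ω := Ω) (w := w - u')
    (by rw [inner_sub_right, hw, hu0, sub_zero])
  have h3 := integral_zonal_mul_inner (fun x => φ x * x) hw
  have i1 : ∀ v : E3, Integrable
      (fun ω : S2 => φ (inner ℝ (Ω : E3) (ω : E3)) * inner ℝ v (ω : E3) ^ 2) sigma := fun v =>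
    continuous_integrable (by fun_prop)
  have h4 : ∀ ω : S2,
      φ (inner ℝ (Ω : E3) (ω : E3)) * inner ℝ w (ω : E3) * inner ℝ u (ω : E3) =
      (1 / 4) * (φ (inner ℝ (Ω : E3) (ω : E3)) * inner ℝ (w + u') (ω : E3) ^ 2
        - φ (inner ℝ (Ω : E3) (ω : E3)) * inner ℝ (w - u') (ω : E3) ^ 2)
      + inner ℝ (Ω : E3) u *
        (φ (inner ℝ (Ω : E3) (ω : E3)) * inner ℝ (Ω : E3) (ω : E3) * inner ℝ w (ω : E3)) := by
    intro ω
    have : inner ℝ u (ω : E3) =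
        inner ℝ u' (ω : E3) + inner ℝ (Ω : E3) u * inner ℝ (Ω : E3) (ω : E3) := by
      rw [hu', proj, inner_sub_left, real_inner_smul_left]; ring
    rw [this, inner_add_left, inner_sub_left]
    ring
  simp_rw [h4]
  rw [sphere_integral_add (by fun_prop) (by fun_prop), integral_const_mul, integral_const_mul,
    integral_sub (i1 _) (i1 _), h1, h2, h3, hwu, norm_add_sq_real, norm_sub_sq_real]
  ring

/-- As `w·ω` is odd under the half turn about `Ω`, only the odd part of `ω·Aω` counts. Writing `ω =
xΩ + τ`, that part is `x τ·(AΩ + Aᵀ Ω)`, so the cubic moment reduces to a quadratic one. -/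
theorem integral_zonal_mul_inner_mul_quadratic (hφ : Continuous φ) {w : E3}
    (hw : inner ℝ (Ω : E3) w = 0) (A : E3 →L[ℝ] E3) :
    ∫ ω : S2, φ (inner ℝ (Ω : E3) (ω : E3)) * inner ℝ w (ω : E3) * inner ℝ (ω : E3) (A ω) ∂sigma =
      (inner ℝ w (A Ω) + inner ℝ (Ω : E3) (A w)) *
        ∫ x in (-1 : ℝ)..1, φ x * x * (1 - x ^ 2) / 4 := by
  obtain ⟨L, hL⟩ := exists_halfTurn Ω
  have hLΩ : ∀ ω : S2, inner ℝ (Ω : E3) (L ω) = inner ℝ (Ω : E3) (ω : E3) := by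
    intro ω
    rw [hL, inner_sub_right, real_inner_smul_right, S2.inner_self]; ring
  have hLw : ∀ ω : S2, inner ℝ w (L ω) = -inner ℝ w (ω : E3) := by
    intro ω
    rw [hL, inner_sub_right, real_inner_smul_right, real_inner_comm (Ω : E3) w, hw]; ring
  have h := integral_comp_isometry L fun y =>
    φ (inner ℝ (Ω : E3) y) * inner ℝ w y * inner ℝ y (A y)
  set v := A Ω + ContinuousLinearMap.adjoint A Ω with hv
  have hwv : inner ℝ w v = inner ℝ w (A Ω) + inner ℝ (Ω : E3) (A w) := by
    rw [hv, inner_add_right, ContinuousLinearMap.adjoint_inner_right, real_inner_comm (A w)]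
  have h1 := integral_zonal_mul_inner_mul_inner (φ := fun x => φ x * x) (by fun_prop) hw v
  have h2 := integral_zonal_mul_inner (fun x => φ x * x ^ 2) hw
  rw [hwv] at h1
  rw [← h1]
  -- The first bracket is the integrand minus its image under the half turn and integrates to zero.
  -- The remaining terms express the sum of the two through `v = AΩ + Aᵀ Ω`.
  have key : ∀ ω : S2, φ (inner ℝ (Ω : E3) (ω : E3)) * inner ℝ w (ω : E3) * inner ℝ (ω : E3) (A ω)
      = (1 / 2) * (φ (inner ℝ (Ω : E3) (ω : E3)) * inner ℝ w (ω : E3) * inner ℝ (ω : E3) (A ω)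
        - φ (inner ℝ (Ω : E3) (L ω)) * inner ℝ w (L ω) * inner ℝ (L ω) (A (L ω)))
        + ((φ (inner ℝ (Ω : E3) (ω : E3)) * inner ℝ (Ω : E3) (ω : E3)) * inner ℝ w (ω : E3) * inner ℝ v (ω : E3)
        - 2 * inner ℝ (Ω : E3) (A Ω) *
          (φ (inner ℝ (Ω : E3) (ω : E3)) * inner ℝ (Ω : E3) (ω : E3) ^ 2 * inner ℝ w (ω : E3))) := by
    intro ω
    rw [hLΩ, hLw, hL]
    have e1 : inner ℝ v (ω : E3) = inner ℝ (ω : E3) (A Ω) + inner ℝ (Ω : E3) (A ω) := by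
      rw [hv, inner_add_left, ContinuousLinearMap.adjoint_inner_left, real_inner_comm]
    simp only [map_sub, map_smul, inner_sub_left, inner_sub_right, real_inner_smul_left,
      real_inner_smul_right, e1]
    ring
  have c1 : Continuous fun ω : S2 =>
      φ (inner ℝ (Ω : E3) (ω : E3)) * inner ℝ w (ω : E3) * inner ℝ (ω : E3) (A ω) := by fun_prop
  have c2 : Continuous fun ω : S2 =>
      φ (inner ℝ (Ω : E3) (L ω)) * inner ℝ w (L ω) * inner ℝ (L ω) (A (L ω)) := by fun_prop
  have c3 : Continuous fun ω : S2 => (φ (inner ℝ (Ω : E3) (ω : E3)) * inner ℝ (Ω : E3) (ω : E3)) *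
      inner ℝ w (ω : E3) * inner ℝ v (ω : E3) := by fun_prop
  rw [integral_congr_ae (.of_forall key), sphere_integral_add (by fun_prop) (by fun_prop),
    integral_const_mul, sphere_integral_sub c1 c2, h, sphere_integral_sub c3 (by fun_prop),
    integral_const_mul, h2]
  ring

/-! ### Power series solutions of the equation for the generalised collision invariant -/

/-- Enlarging the geometric ratio absorbs the factor `n + 1` produced by differentiation. -/
theorem exists_bound_deriv_coeff {a : ℕ → ℝ} {q r : ℝ} (hq : 0 < q) (hqr : q < r)
    (ha : ∃ C, ∀ n, |a n| ≤ C * q ^ n) : ∃ C, ∀ n, |(n + 1) * a (n + 1)| ≤ C * r ^ n := by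
  obtain ⟨C, hC⟩ := ha
  have hr : 0 < r := hq.trans hqr
  have h1 : Tendsto (fun n : ℕ => (n : ℝ) ^ 1 * (q / r) ^ n) atTop (𝓝 0) :=
    tendsto_pow_const_mul_const_pow_of_lt_one 1 (by positivity) ((div_lt_one hr).2 hqr)
  obtain ⟨B, hB⟩ := h1.bddAbove_range
  have hC0 : 0 ≤ C := by simpa using (abs_nonneg _).trans (hC 0)
  refine ⟨C * B * r, fun n => ?_⟩
  have h2 := hB ⟨n + 1, rfl⟩
  simp only [pow_one] at h2
  rw [div_pow, mul_div_assoc', div_le_iff₀ (by positivity)] at h2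
  push_cast at h2
  rw [abs_mul, abs_of_nonneg (by positivity : (0 : ℝ) ≤ n + 1)]
  calc (n + 1 : ℝ) * |a (n + 1)| ≤ (n + 1) * (C * q ^ (n + 1)) := by gcongr; exact hC _
    _ = C * ((n + 1) * q ^ (n + 1)) := by ring
    _ ≤ C * (B * r ^ (n + 1)) := by gcongr
    _ = _ := by ring

theorem summable_coeff {a : ℕ → ℝ} {q s : ℝ} (hq : 0 < q) (ha : ∃ C, ∀ n, |a n| ≤ C * q ^ n)
    (hs : |s| < q⁻¹) : Summable fun n => a n * s ^ n := by
  obtain ⟨C, hC⟩ := ha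
  have h1 : q * |s| < 1 := by
    have := mul_lt_mul_of_pos_left hs hq
    rwa [mul_inv_cancel₀ hq.ne'] at this
  refine Summable.of_norm_bounded
    ((summable_geometric_of_lt_one (by positivity) h1).mul_left C) fun n => ?_
  rw [norm_mul, norm_pow, Real.norm_eq_abs, Real.norm_eq_abs, mul_pow, ← mul_assoc]
  gcongr
  exact hC n

theorem hasDerivAt_tsum_coeff {a : ℕ → ℝ} {q s : ℝ} (hq : 0 < q)
    (ha : ∃ C, ∀ n, |a n| ≤ C * q ^ n) (hs : |s| < q⁻¹) :
    HasDerivAt (fun s => ∑' n, a n * s ^ n) (∑' n : ℕ, ((n + 1) * a (n + 1)) * s ^ n) s := by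
  obtain ⟨r, hsr, hrq⟩ := exists_between hs
  have hr0 : 0 < r := (abs_nonneg s).trans_lt hsr
  -- `p > q` leaves room for the factor `n + 1`, while `p r < 1` keeps the differentiated series
  -- summable uniformly on the ball of radius `r`.
  obtain ⟨p, hqp, hpr⟩ : ∃ p, q < p ∧ p < r⁻¹ := exists_between (by
    rwa [lt_inv_comm₀ hq hr0])
  obtain ⟨C, hC⟩ := exists_bound_deriv_coeff hq hqp ha
  have hp0 : 0 < p := hq.trans hqp
  have hpr1 : p * r < 1 := by
    have := mul_lt_mul_of_pos_right hpr hr0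
    rwa [inv_mul_cancel₀ hr0.ne'] at this
  have hsum : Summable fun n : ℕ => C * (p * r) ^ n :=
    (summable_geometric_of_lt_one (by positivity) hpr1).mul_left C
  have hu : Summable fun n : ℕ => if n = 0 then (0 : ℝ) else C * (p * r) ^ (n - 1) := by
    rw [← summable_nat_add_iff 1]
    simpa using hsum
  have h1 : ∀ (n : ℕ) (y : ℝ), HasDerivAt (fun s : ℝ => a n * s ^ n) (a n * (n * y ^ (n - 1))) y :=
    fun n y => (hasDerivAt_pow n y).const_mul (a n)
  have h2 := hasDerivAt_tsum_of_isPreconnected hu Metric.isOpen_ball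
    (convex_ball (0 : ℝ) r).isPreconnected (fun n y _ => h1 n y) (fun n y hy => by
      rw [mem_ball_zero_iff] at hy
      rcases n with _ | n
      · simp
      · simp only [Nat.succ_ne_zero, if_false, Nat.add_sub_cancel]
        rw [← mul_assoc, norm_mul, norm_pow, mul_pow, ← mul_assoc]
        have := hC n
        push_cast
        rw [Real.norm_eq_abs, mul_comm (a (n + 1))]
        have := (abs_nonneg _).trans this
        gcongr) (Metric.mem_ball_self hr0)
    (summable_coeff hq ha (by simpa using hq)) (y := s) (by simpa using hsr)
  refine h2.congr_deriv ?_
  rw [Summable.tsum_eq_zero_add]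
  · simp only [CharP.cast_eq_zero, zero_mul, mul_zero, zero_add, Nat.add_sub_cancel]
    refine tsum_congr fun n => ?_
    push_cast
    ring
  · rw [← summable_nat_add_iff 1]
    refine (summable_coeff hp0 ⟨C, hC⟩ (s := s) ?_).congr fun n => ?_
    · exact hsr.trans ((lt_inv_comm₀ hp0 hr0).1 hpr)
    · simp only [Nat.add_sub_cancel]
      push_cast
      ring

/-- Multiplication by `s` shifts coefficients, which turns a differential equation with polynomial
coefficients into an identity between sequences. -/
theorem hasSum_shift {b : ℕ → ℝ} {s x : ℝ} (h : HasSum (fun n => b n * s ^ n) x) :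
    HasSum (fun n => (Nat.casesOn n 0 b : ℝ) * s ^ n) (s * x) := by
  rw [← hasSum_nat_add_iff' 1]
  simp only [Finset.range_one, Finset.sum_singleton, Nat.rec_zero, zero_mul, sub_zero]
  refine (h.mul_left s).congr_fun ?_ |> fun h => h
  intro n
  ring

/-- Coefficients of the solution that is regular at `μ = -1`, in powers of `1 + μ`. -/
noncomputable def gciCoeff (κ c a₀ : ℝ) : ℕ → ℝ
  | 0 => a₀
  | 1 => ((2 - κ) * a₀ + c) / 4
  | n + 2 => (((n + 2) * (n + 3) - κ * (2 * n + 3)) * gciCoeff κ c a₀ (n + 1)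
      + κ * (n + 1) * gciCoeff κ c a₀ n) / (2 * (n + 2) * (n + 3))

/-- For large `n` the recursion is close to `a_{n+2} = a_{n+1}/2`, the other singular point being at
distance `2`, so any ratio above `1/2` works eventually. With ratio `2/3` the induction needs the
bracket to stay below `2 · (2/3)² = 8/9` of `(m+2)(m+3)`; `m ≥ 24|κ|` makes the terms in `κ` small
enough. -/
theorem gciCoeff_bound (κ c a₀ : ℝ) : ∃ C, ∀ n, |gciCoeff κ c a₀ n| ≤ C * (2 / 3) ^ n := by
  obtain ⟨N, hN⟩ := exists_nat_ge (24 * |κ|)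
  set a := gciCoeff κ c a₀ with ha
  -- Large enough to cover the finitely many coefficients before the induction takes over.
  set C := ∑ k ∈ Finset.range (N + 2), |a k| * (3 / 2) ^ k with hC
  have hC0 : 0 ≤ C := Finset.sum_nonneg fun k _ => by positivity
  have hsmall : ∀ k < N + 2, |a k| ≤ C * (2 / 3) ^ k := by
    intro k hk
    have : |a k| * (3 / 2) ^ k ≤ C :=
      Finset.single_le_sum (f := fun k => |a k| * (3 / 2 : ℝ) ^ k)
        (fun k _ => by positivity) (Finset.mem_range.2 hk)
    calc |a k| = (|a k| * (3 / 2) ^ k) * (2 / 3) ^ k := by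
          rw [mul_assoc, ← mul_pow]; norm_num
      _ ≤ _ := by gcongr
  refine ⟨C, fun n => ?_⟩
  induction n using Nat.strong_induction_on with
  | _ n ih =>
    by_cases hn : n < N + 2
    · exact hsmall n hn
    obtain ⟨m, rfl⟩ : ∃ m, n = m + 2 := ⟨n - 2, by omega⟩
    have hm : (N : ℝ) ≤ m := by exact_mod_cast (by omega : N ≤ m)
    have i1 := ih (m + 1) (by omega)
    have i0 := ih m (by omega)
    have hm0 : (0 : ℝ) ≤ m := Nat.cast_nonneg m
    have hrec : a (m + 2) = (((m + 2) * (m + 3) - κ * (2 * m + 3)) * a (m + 1)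
      + κ * (m + 1) * a m) / (2 * (m + 2) * (m + 3)) := by rw [ha, gciCoeff]
    have hk : |κ| * 24 ≤ m := by linarith
    rw [hrec, abs_div, abs_of_pos (by positivity : (0 : ℝ) < 2 * (m + 2) * (m + 3)),
      div_le_iff₀ (by positivity)]
    have t1 : |((m + 2) * (m + 3) - κ * (2 * m + 3))| ≤
        (m + 2) * (m + 3) + |κ| * (2 * m + 3) := by
      refine (abs_sub _ _).trans ?_
      rw [abs_mul κ, abs_of_nonneg (by positivity : (0 : ℝ) ≤ (m + 2) * (m + 3)),
        abs_of_nonneg (by positivity : (0 : ℝ) ≤ 2 * m + 3)]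
    calc |((m + 2) * (m + 3) - κ * (2 * m + 3)) * a (m + 1) + κ * (m + 1) * a m|
        ≤ |((m + 2) * (m + 3) - κ * (2 * m + 3))| * |a (m + 1)| + |κ| * (m + 1) * |a m| := by
          refine (abs_add_le _ _).trans ?_
          rw [abs_mul, abs_mul, abs_mul, abs_of_nonneg (by positivity : (0 : ℝ) ≤ (m : ℝ) + 1)]
      _ ≤ ((m + 2) * (m + 3) + |κ| * (2 * m + 3)) * (C * (2 / 3) ^ (m + 1))
          + |κ| * (m + 1) * (C * (2 / 3) ^ m) := by gcongr
      _ = C * (2 / 3) ^ m *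
          (2 / 3 * ((m + 2) * (m + 3) + |κ| * (2 * m + 3)) + |κ| * (m + 1)) := by
          rw [pow_succ]; ring
      _ ≤ C * (2 / 3) ^ m * (8 / 9 * (m + 2) * (m + 3)) := by
          gcongr
          nlinarith [mul_le_mul_of_nonneg_right hk (by positivity : (0 : ℝ) ≤ m + 2),
            abs_nonneg κ]
      _ = C * (2 / 3) ^ (m + 2) * (2 * (m + 2) * (m + 3)) := by
          rw [pow_add]; ring

/-- `h`, with first and second derivatives `h₁`, `h₂`, solves
`(1-μ²) h'' + (κ(1-μ²) - 4μ) h' - (2+κμ) h = c` at `μ`. -/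
structure SolvesAt (κ c : ℝ) (h h₁ h₂ : ℝ → ℝ) (μ : ℝ) : Prop where
  d1 : HasDerivAt h (h₁ μ) μ
  d2 : HasDerivAt h₁ (h₂ μ) μ
  cont : ContinuousAt h₂ μ
  eq : (1 - μ ^ 2) * h₂ μ + (κ * (1 - μ ^ 2) - 4 * μ) * h₁ μ - (2 + κ * μ) * h μ = c

theorem SolvesAt.add_smul {κ c : ℝ} {h h₁ h₂ k k₁ k₂ : ℝ → ℝ} {μ : ℝ}
    (H : SolvesAt κ c h h₁ h₂ μ) (K : SolvesAt κ 0 k k₁ k₂ μ) (α : ℝ) :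
    SolvesAt κ c (fun x => h x + α * k x) (fun x => h₁ x + α * k₁ x) (fun x => h₂ x + α * k₂ x) μ where
  d1 := H.d1.add (K.d1.const_mul α)
  d2 := H.d2.add (K.d2.const_mul α)
  cont := H.cont.add (continuousAt_const.mul K.cont)
  eq := by linear_combination H.eq + α * K.eq

/-- The reflection `μ ↦ -μ` exchanges the poles and the sign of `κ`, so a branch regular at `1`
comes from one regular at `-1`. -/
theorem SolvesAt.reflect {κ c : ℝ} {h h₁ h₂ : ℝ → ℝ} {μ : ℝ} (H : SolvesAt (-κ) c h h₁ h₂ (-μ)) :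
    SolvesAt κ c (fun x => h (-x)) (fun x => -h₁ (-x)) (fun x => h₂ (-x)) μ where
  d1 := (H.d1.comp μ (hasDerivAt_neg μ)).congr_deriv (by ring)
  d2 := ((H.d2.comp μ (hasDerivAt_neg μ)).neg).congr_deriv (by ring)
  cont := ContinuousAt.comp (f := fun x => -x) H.cont continuousAt_neg
  eq := by linear_combination H.eq

/-- At the regular singular point `μ = -1` the equation leaves the value `a₀` free and determines
the other coefficients of the bounded branch. The interval is the ball of radius `5/4` about `-1`:
it passes the matching point `0` and contains a neighbourhood of the pole. -/
theorem exists_left_solution (κ c a₀ : ℝ) : ∃ h h₁ h₂ : ℝ → ℝ, h (-1) = a₀ ∧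
    ∀ μ ∈ Ioo (-9 / 4 : ℝ) (1 / 4), SolvesAt κ c h h₁ h₂ μ := by
  set a := gciCoeff κ c a₀ with ha
  -- Each differentiation enlarges the ratio, `2/3 < 3/4 < 4/5`; the last one gives the radius
  -- `5/4`.
  have b0 : ∃ C, ∀ n, |a n| ≤ C * (2 / 3) ^ n := gciCoeff_bound κ c a₀
  set a1 : ℕ → ℝ := fun n => (n + 1) * a (n + 1) with ha1
  have b1 : ∃ C, ∀ n, |a1 n| ≤ C * (3 / 4) ^ n :=
    exists_bound_deriv_coeff (by norm_num) (by norm_num) b0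
  set a2 : ℕ → ℝ := fun n => (n + 1) * a1 (n + 1) with ha2
  have b2 : ∃ C, ∀ n, |a2 n| ≤ C * (4 / 5) ^ n :=
    exists_bound_deriv_coeff (by norm_num) (by norm_num) b1
  have hshift : ∀ {f f' : ℝ → ℝ} {μ : ℝ}, HasDerivAt f (f' (1 + μ)) (1 + μ) →
      HasDerivAt (fun μ => f (1 + μ)) (f' (1 + μ)) μ := fun {f f' μ} h => by
    simpa using h.comp_const_add 1 μ
  refine ⟨fun μ => ∑' n, a n * (1 + μ) ^ n, fun μ => ∑' n, a1 n * (1 + μ) ^ n,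
    fun μ => ∑' n, a2 n * (1 + μ) ^ n, ?_, fun μ hμ => ?_⟩
  · beta_reduce
    rw [tsum_eq_single 0 fun n hn => by simp [hn]]
    simp [ha, gciCoeff]
  have hs : |1 + μ| < 5 / 4 := abs_lt.2 ⟨by linarith [hμ.1], by linarith [hμ.2]⟩
  have s0 : |1 + μ| < (2 / 3 : ℝ)⁻¹ := hs.trans (by norm_num)
  have s1 : |1 + μ| < (3 / 4 : ℝ)⁻¹ := hs.trans (by norm_num)
  have s2 : |1 + μ| < (4 / 5 : ℝ)⁻¹ := hs.trans_le (by norm_num)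
  refine ⟨?_, ?_, ?_, ?_⟩
  · exact hshift (f := fun s => ∑' n, a n * s ^ n) (f' := fun s => ∑' n, a1 n * s ^ n)
      (hasDerivAt_tsum_coeff (by norm_num) b0 s0)
  · exact hshift (f := fun s => ∑' n, a1 n * s ^ n) (f' := fun s => ∑' n, a2 n * s ^ n)
      (hasDerivAt_tsum_coeff (by norm_num) b1 s1)
  · exact (hshift (f := fun s => ∑' n, a2 n * s ^ n)
      (f' := fun s => ∑' n : ℕ, ((n + 1) * a2 (n + 1)) * s ^ n)
      (hasDerivAt_tsum_coeff (by norm_num) b2 s2)).continuousAt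
  · set s := 1 + μ with hsdef
    have hμs : μ = s - 1 := by rw [hsdef]; ring
    have S0 := (summable_coeff (by norm_num) b0 s0).hasSum
    have S1 := (summable_coeff (by norm_num) b1 s1).hasSum
    have S2 := (summable_coeff (by norm_num) b2 s2).hasSum
    set X0 := ∑' n, a n * s ^ n
    set X1 := ∑' n, a1 n * s ^ n
    set X2 := ∑' n, a2 n * s ^ n
    -- The left side of the equation in powers of `s = 1 + μ`, where `1 - μ² = 2s - s²`.
    have T := (((((hasSum_shift S2).mul_left 2).sub (hasSum_shift (hasSum_shift S2))).add
      (((hasSum_shift S1).mul_left (2 * κ - 4)).sub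
        ((hasSum_shift (hasSum_shift S1)).mul_left κ))).add (S1.mul_left 4)).sub
      ((S0.mul_left (2 - κ)).add ((hasSum_shift S0).mul_left κ))
    have T' : HasSum (fun n : ℕ => if n = 0 then c else 0) c := hasSum_ite_eq 0 c
    have := T.unique (T'.congr_fun ?_)
    · rw [hμs]
      linear_combination this
    · intro n
      match n with
      | 0 =>
        simp [ha1, ha, gciCoeff]
        ring
      | 1 =>
        have e0 : a 0 = a₀ := by rw [ha, gciCoeff]
        have e1 : a 1 = ((2 - κ) * a₀ + c) / 4 := by rw [ha, gciCoeff]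
        have e2 : a (0 + 2) = (((0 + 2) * (0 + 3) - κ * (2 * 0 + 3)) * a (0 + 1)
            + κ * (0 + 1) * a 0) / (2 * (0 + 2) * (0 + 3)) := by
          have := gciCoeff.eq_3 κ c a₀ 0
          rwa [Nat.cast_zero, ← ha] at this
        norm_num at e2
        simp [ha1, ha2]
        norm_num
        rw [e2, e1, e0]
        ring
      | n + 2 =>
        have hrec : a (n + 3) = (((n + 3) * (n + 4) - κ * (2 * n + 5)) * a (n + 2)
            + κ * (n + 2) * a (n + 1)) / (2 * (n + 3) * (n + 4)) := by
          rw [ha, gciCoeff]; push_cast; ring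
        simp only [ha1, ha2]
        push_cast
        simp only [show n + 1 + 1 + 1 = n + 3 from rfl, show n + 1 + 1 = n + 2 from rfl, hrec]
        change _ = (0 : ℝ)
        field_simp
        ring

/-! ### Matching the two regular solutions -/

/-- The flux `p g g'` of `g = (1-μ²)^{1/2} h`, `p = e^{κμ}(1-μ²)`. -/
noncomputable def gciFlux (κ : ℝ) (h h₁ : ℝ → ℝ) (μ : ℝ) : ℝ :=
  Real.exp (κ * μ) * (1 - μ ^ 2) * ((1 - μ ^ 2) * (h μ * h₁ μ) - μ * h μ ^ 2)

/-- Energy identity: the equation for `g`, multiplied by `g`, says that the flux `p g g'` has as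
derivative a sum of squares plus the source term. The flux vanishes at the poles because of the
factor `1 - μ²`. -/
theorem SolvesAt.hasDerivAt_gciFlux {κ c : ℝ} {h h₁ h₂ : ℝ → ℝ} {μ : ℝ}
    (H : SolvesAt κ c h h₁ h₂ μ) :
    HasDerivAt (gciFlux κ h h₁) (Real.exp (κ * μ) *
      (((1 - μ ^ 2) * h₁ μ - μ * h μ) ^ 2 + h μ ^ 2 + c * ((1 - μ ^ 2) * h μ))) μ := by
  have e1 : HasDerivAt (fun μ => Real.exp (κ * μ)) (Real.exp (κ * μ) * κ) μ := by
    simpa using ((hasDerivAt_id μ).const_mul κ).exp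
  have e2 : HasDerivAt (fun μ : ℝ => 1 - μ ^ 2) (-(2 * μ)) μ := by
    simpa using (hasDerivAt_pow 2 μ).const_sub 1
  have := (e1.mul e2).mul ((e2.mul (H.d1.mul H.d2)).sub ((hasDerivAt_id μ).mul (H.d1.pow 2)))
  refine this.congr_deriv ?_
  simp
  linear_combination (Real.exp (κ * μ) * (1 - μ ^ 2) * h μ) * H.eq

theorem SolvesAt.continuousAt_energy {κ c : ℝ} {h h₁ h₂ : ℝ → ℝ} {μ : ℝ}
    (H : SolvesAt κ c h h₁ h₂ μ) :
    ContinuousAt (fun μ => Real.exp (κ * μ) *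
      (((1 - μ ^ 2) * h₁ μ - μ * h μ) ^ 2 + h μ ^ 2 + c * ((1 - μ ^ 2) * h μ))) μ := by
  have h0 := H.d1.continuousAt
  have h1 := H.d2.continuousAt
  fun_prop

/-- The energy identity is integrated from `-1`, where the flux vanishes, to `0`, where it equals `h
h'`. -/
theorem left_solution_mul_deriv_pos {κ : ℝ} {h h₁ h₂ : ℝ → ℝ} (h0 : h (-1) = 1)
    (H : ∀ μ ∈ Icc (-1 : ℝ) 0, SolvesAt κ 0 h h₁ h₂ μ) : 0 < h 0 * h₁ 0 := by
  have hI : ∀ μ ∈ uIcc (-1 : ℝ) 0, SolvesAt κ 0 h h₁ h₂ μ := by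
    rwa [uIcc_of_le (by norm_num)]
  have hc : ContinuousOn (fun μ => Real.exp (κ * μ) *
      (((1 - μ ^ 2) * h₁ μ - μ * h μ) ^ 2 + h μ ^ 2 + 0 * ((1 - μ ^ 2) * h μ))) (Icc (-1 : ℝ) 0) :=
    fun μ hμ => (H μ hμ).continuousAt_energy.continuousWithinAt
  have hc' := hc
  rw [← uIcc_of_le (by norm_num)] at hc'
  have hftc := intervalIntegral.integral_eq_sub_of_hasDerivAt
    (fun μ hμ => (hI μ hμ).hasDerivAt_gciFlux) hc'.intervalIntegrable
  have hpos := intervalIntegral.integral_pos (by norm_num) hc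
    (fun μ _ => by simp only [zero_mul, add_zero]; positivity) ⟨-1, by norm_num, by rw [h0]; positivity⟩
  rw [hftc] at hpos
  simpa [gciFlux] using hpos

theorem hasDerivAt_glue {f g : ℝ → ℝ} {a d : ℝ} (hf : HasDerivAt f d a) (hg : HasDerivAt g d a)
    (hfg : f a = g a) : HasDerivAt (fun x => if x ≤ a then f x else g x) d a := by
  have h1 : HasDerivWithinAt (fun x => if x ≤ a then f x else g x) d (Iic a) a :=
    hf.hasDerivWithinAt.congr (fun x hx => if_pos hx) (if_pos le_rfl)
  have h2 : HasDerivWithinAt (fun x => if x ≤ a then f x else g x) d (Ici a) a := by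
    refine hg.hasDerivWithinAt.congr (fun x hx => ?_) (by simpa using hfg)
    rcases eq_or_lt_of_le (show a ≤ x from hx) with rfl | hx
    · simpa using hfg
    · exact if_neg (not_le.2 hx)
  have := h1.union h2
  rwa [Iic_union_Ici, hasDerivWithinAt_univ] at this

theorem glue_eventuallyEq_left (f g : ℝ → ℝ) {a x : ℝ} (hx : x < a) :
    (fun x => if x ≤ a then f x else g x) =ᶠ[𝓝 x] f := by
  filter_upwards [gt_mem_nhds hx] with y hy using if_pos (le_of_lt hy)

theorem glue_eventuallyEq_right (f g : ℝ → ℝ) {a x : ℝ} (hx : a < x) :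
    (fun x => if x ≤ a then f x else g x) =ᶠ[𝓝 x] g := by
  filter_upwards [lt_mem_nhds hx] with y hy using if_neg (not_le.2 hy)

theorem SolvesAt.congr {κ c : ℝ} {h h₁ h₂ k k₁ k₂ : ℝ → ℝ} {μ : ℝ} (H : SolvesAt κ c h h₁ h₂ μ)
    (e : k =ᶠ[𝓝 μ] h) (e₁ : k₁ =ᶠ[𝓝 μ] h₁) (e₂ : k₂ =ᶠ[𝓝 μ] h₂) : SolvesAt κ c k k₁ k₂ μ where
  d1 := by rw [e₁.eq_of_nhds]; exact H.d1.congr_of_eventuallyEq e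
  d2 := by rw [e₂.eq_of_nhds]; exact H.d2.congr_of_eventuallyEq e₁
  cont := H.cont.congr e₂.symm
  eq := by rw [e.eq_of_nhds, e₁.eq_of_nhds, e₂.eq_of_nhds]; exact H.eq

/-- A particular solution plus a multiple of the regular homogeneous one is taken from each pole,
and `α`, `β` solve the linear system equating values and first derivatives at `0`. Second
derivatives then agree by the equation itself. -/
theorem exists_global_solution (κ : ℝ) : ∃ h h₁ h₂ : ℝ → ℝ,
    ∀ μ ∈ Ioo (-9 / 4 : ℝ) (9 / 4), SolvesAt κ 1 h h₁ h₂ μ := by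
  obtain ⟨p, p₁, p₂, hp0, hp⟩ := exists_left_solution κ 0 1
  obtain ⟨l, l₁, l₂, -, hl⟩ := exists_left_solution κ 1 0
  obtain ⟨q, q₁, q₂, hq0, hq⟩ := exists_left_solution (-κ) 0 1
  obtain ⟨r, r₁, r₂, -, hr⟩ := exists_left_solution (-κ) 1 0
  have hP := left_solution_mul_deriv_pos hp0 fun μ hμ => hp μ ⟨by linarith [hμ.1], by linarith [hμ.2]⟩
  have hQ := left_solution_mul_deriv_pos hq0 fun μ hμ => hq μ ⟨by linarith [hμ.1], by linarith [hμ.2]⟩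
  have hp' : p 0 ≠ 0 := fun h => by simp [h] at hP
  have hq' : q 0 ≠ 0 := fun h => by simp [h] at hQ
  -- Both homogeneous branches satisfy `p p' > 0` and `q q' > 0` at `0`; after reflection the second
  -- has the opposite logarithmic derivative, so the two cannot be proportional.
  have hW : p 0 * q₁ 0 + q 0 * p₁ 0 ≠ 0 := by
    intro hW
    have h1 : 0 < (q 0) ^ 2 * (p 0 * p₁ 0) := mul_pos (by positivity) hP
    have h2 : 0 < (p 0) ^ 2 * (q 0 * q₁ 0) := mul_pos (by positivity) hQ
    have h3 : (q 0) ^ 2 * (p 0 * p₁ 0) + (p 0) ^ 2 * (q 0 * q₁ 0) =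
      p 0 * q 0 * (p 0 * q₁ 0 + q 0 * p₁ 0) := by ring
    rw [hW, mul_zero] at h3
    linarith
  set W := p 0 * q₁ 0 + q 0 * p₁ 0 with hWdef
  set α := ((r 0 - l 0) * q₁ 0 - q 0 * (r₁ 0 + l₁ 0)) / W with hα
  set β := (p₁ 0 * (l 0 - r 0) - p 0 * (l₁ 0 + r₁ 0)) / W with hβ
  have L : ∀ μ ∈ Ioo (-9 / 4 : ℝ) (1 / 4), SolvesAt κ 1 (fun x => l x + α * p x)
      (fun x => l₁ x + α * p₁ x) (fun x => l₂ x + α * p₂ x) μ :=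
    fun μ hμ => (hl μ hμ).add_smul (hp μ hμ) α
  have R : ∀ μ ∈ Ioo (-1 / 4 : ℝ) (9 / 4), SolvesAt κ 1 (fun x => r (-x) + β * q (-x))
      (fun x => -(r₁ (-x) + β * q₁ (-x))) (fun x => r₂ (-x) + β * q₂ (-x)) μ := fun μ hμ => by
    have hm : -μ ∈ Ioo (-9 / 4 : ℝ) (1 / 4) := ⟨by linarith [hμ.2], by linarith [hμ.1]⟩
    exact ((hr _ hm).add_smul (hq _ hm) β).reflect
  have z1 : (0 : ℝ) ∈ Ioo (-9 / 4 : ℝ) (1 / 4) := by norm_num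
  have z2 : (0 : ℝ) ∈ Ioo (-1 / 4 : ℝ) (9 / 4) := by norm_num
  have hL0 := (L 0 z1).eq
  have hR0 := (R 0 z2).eq
  have m0 : l 0 + α * p 0 = r (-0) + β * q (-0) := by
    rw [neg_zero, hα, hβ]
    field_simp
    rw [hWdef]; ring
  have m1 : l₁ 0 + α * p₁ 0 = -(r₁ (-0) + β * q₁ (-0)) := by
    rw [neg_zero, hα, hβ]
    field_simp
    rw [hWdef]; ring
  have m2 : l₂ 0 + α * p₂ 0 = r₂ (-0) + β * q₂ (-0) := by
    rw [m0, m1] at hL0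
    linear_combination hL0 - hR0
  refine ⟨fun x => if x ≤ 0 then l x + α * p x else r (-x) + β * q (-x),
    fun x => if x ≤ 0 then l₁ x + α * p₁ x else -(r₁ (-x) + β * q₁ (-x)),
    fun x => if x ≤ 0 then l₂ x + α * p₂ x else r₂ (-x) + β * q₂ (-x), fun μ hμ => ?_⟩
  rcases lt_trichotomy μ 0 with h0 | rfl | h0
  · exact (L μ ⟨hμ.1, by linarith⟩).congr
      (glue_eventuallyEq_left (fun x => l x + α * p x) _ h0)
      (glue_eventuallyEq_left (fun x => l₁ x + α * p₁ x) _ h0)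
      (glue_eventuallyEq_left (fun x => l₂ x + α * p₂ x) _ h0)
  · have l0 := L 0 z1
    have r0 := R 0 z2
    refine ⟨?_, ?_, ?_, ?_⟩
    · rw [if_pos le_rfl]
      exact hasDerivAt_glue l0.d1 (by rw [m1]; exact r0.d1) m0
    · rw [if_pos le_rfl]
      exact hasDerivAt_glue l0.d2 (by rw [m2]; exact r0.d2) m1
    · have c1 : ContinuousWithinAt (fun x => if x ≤ 0 then l₂ x + α * p₂ x else r₂ (-x) + β * q₂ (-x))
          (Iic 0) 0 := l0.cont.continuousWithinAt.congr (fun x hx => if_pos hx) (if_pos le_rfl)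
      have c2 : ContinuousWithinAt (fun x => if x ≤ 0 then l₂ x + α * p₂ x else r₂ (-x) + β * q₂ (-x))
          (Ici 0) 0 := by
        refine r0.cont.continuousWithinAt.congr (fun x hx => ?_) (by rw [if_pos le_rfl, m2])
        rcases eq_or_lt_of_le (show 0 ≤ x from hx) with rfl | hx
        · rw [if_pos le_rfl, m2]
        · exact if_neg (not_le.2 hx)
      have := c1.union c2
      rwa [Iic_union_Ici, continuousWithinAt_univ] at this
    · simp only [le_refl, if_true]
      exact l0.eq
  · exact (R μ ⟨by linarith, hμ.2⟩).congr
      (glue_eventuallyEq_right _ (fun x => r (-x) + β * q (-x)) h0)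
      (glue_eventuallyEq_right _ (fun x => -(r₁ (-x) + β * q₁ (-x))) h0)
      (glue_eventuallyEq_right _ (fun x => r₂ (-x) + β * q₂ (-x)) h0)

theorem contDiffOn_two_of_hasDerivAt {f f₁ f₂ : ℝ → ℝ} {U : Set ℝ} (hU : IsOpen U)
    (h1 : ∀ x ∈ U, HasDerivAt f (f₁ x) x) (h2 : ∀ x ∈ U, HasDerivAt f₁ (f₂ x) x)
    (hc : ContinuousOn f₂ U) : ContDiffOn ℝ 2 f U := by
  have one : ∀ {g g₁ : ℝ → ℝ} {n : WithTop ℕ∞}, n ≠ ⊤ → (∀ x ∈ U, HasDerivAt g (g₁ x) x) → ContDiffOn ℝ n g₁ U →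
      ContDiffOn ℝ (n + 1) g U := fun {g g₁ n} hn hg hg1 => by
    rw [contDiffOn_succ_iff_deriv_of_isOpen hU]
    refine ⟨fun x hx => (hg x hx).differentiableAt.differentiableWithinAt, fun h => absurd h (by
      intro h; subst h; exact hn (by rfl)), ?_⟩
    exact hg1.congr fun x hx => (hg x hx).deriv
  have := one (n := 0) (by simp) h2 (contDiffOn_zero.2 hc)
  have := one (n := 0 + 1) (by simp) h1 this
  simpa using (this.of_le (by norm_num) : ContDiffOn ℝ 2 f U)

/-- The profile `h` of the generalised collision invariant is `C²` up to the poles. -/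
theorem exists_smooth_profile (κ : ℝ) : ∃ H : ℝ → ℝ, ContDiff ℝ 2 H ∧
    ∀ μ ∈ Icc (-1 : ℝ) 1, SolvesAt κ 1 H (deriv H) (deriv (deriv H)) μ := by
  obtain ⟨h, h₁, h₂, hs⟩ := exists_global_solution κ
  -- The cut-off is one on `|x| ≤ 3/2`, a neighbourhood of `[-1, 1]`, and its support `|x| ≤ 2`
  -- stays inside the interval where `h` solves the equation.
  let χ : ContDiffBump (0 : ℝ) := ⟨3 / 2, 2, by norm_num, by norm_num⟩
  have hcd : ContDiffOn ℝ 2 h (Ioo (-9 / 4 : ℝ) (9 / 4)) :=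
    contDiffOn_two_of_hasDerivAt isOpen_Ioo (fun x hx => (hs x hx).d1) (fun x hx => (hs x hx).d2)
      fun x hx => (hs x hx).cont.continuousWithinAt
  refine ⟨fun x => χ x * h x, ?_, fun μ hμ => ?_⟩
  · rw [contDiff_iff_contDiffAt]
    intro x
    by_cases hx : x ∈ Ioo (-9 / 4 : ℝ) (9 / 4)
    · exact χ.contDiff.contDiffAt.mul (hcd.contDiffAt (isOpen_Ioo.mem_nhds hx))
    · have h0 : x ∉ tsupport χ := by
        rw [χ.tsupport_eq, Metric.mem_closedBall, Real.dist_eq, sub_zero]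
        intro hle
        have hle : |x| ≤ 2 := hle
        rw [abs_le] at hle
        exact hx ⟨by linarith [hle.1], by linarith [hle.2]⟩
      have : (fun x => χ x * h x) =ᶠ[𝓝 x] fun _ => 0 := by
        filter_upwards [notMem_tsupport_iff_eventuallyEq.1 h0] with y hy
        simp [hy]
      exact contDiffAt_const.congr_of_eventuallyEq this
  · have hev : ∀ x ∈ Ioo (-3 / 2 : ℝ) (3 / 2), (fun x => χ x * h x) =ᶠ[𝓝 x] h := fun x hx => by
      filter_upwards [isOpen_Ioo.mem_nhds hx] with y hy
      rw [χ.one_of_mem_closedBall, one_mul]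
      rw [Metric.mem_closedBall, Real.dist_eq, sub_zero]
      exact abs_le.2 ⟨by change -(3 / 2 : ℝ) ≤ y; linarith [hy.1], hy.2.le⟩
    have hd1 : ∀ x ∈ Ioo (-3 / 2 : ℝ) (3 / 2), deriv (fun x => χ x * h x) x = h₁ x := fun x hx => by
      rw [(hev x hx).deriv_eq]
      exact (hs x ⟨by linarith [hx.1], by linarith [hx.2]⟩).d1.deriv
    have hev1 : ∀ x ∈ Ioo (-3 / 2 : ℝ) (3 / 2), deriv (fun x => χ x * h x) =ᶠ[𝓝 x] h₁ :=
      fun x hx => by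
        filter_upwards [isOpen_Ioo.mem_nhds hx] with y hy using hd1 y hy
    have hev2 : ∀ x ∈ Ioo (-3 / 2 : ℝ) (3 / 2), deriv (deriv (fun x => χ x * h x)) =ᶠ[𝓝 x] h₂ :=
      fun x hx => by
        filter_upwards [isOpen_Ioo.mem_nhds hx] with y hy
        rw [(hev1 y hy).deriv_eq]
        exact (hs y ⟨by linarith [hy.1], by linarith [hy.2]⟩).d2.deriv
    have hm : μ ∈ Ioo (-3 / 2 : ℝ) (3 / 2) := ⟨by linarith [hμ.1], by linarith [hμ.2]⟩
    exact (hs μ ⟨by linarith [hμ.1], by linarith [hμ.2]⟩).congr (hev μ hm) (hev1 μ hm) (hev2 μ hm)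

/-! ### Existence and uniqueness of the generalised collision invariant -/

theorem one_sub_sq_pos {μ : ℝ} (hμ : μ ∈ Ioo (-1 : ℝ) 1) : 0 < 1 - μ ^ 2 := by
  nlinarith [hμ.1, hμ.2]

theorem hasDerivAt_sqrt_one_sub_sq {μ : ℝ} (hμ : μ ∈ Ioo (-1 : ℝ) 1) :
    HasDerivAt (fun s : ℝ => Real.sqrt (1 - s ^ 2)) (-(μ / Real.sqrt (1 - μ ^ 2))) μ := by
  have e2 : HasDerivAt (fun μ : ℝ => 1 - μ ^ 2) (-(2 * μ)) μ := by
    simpa using (hasDerivAt_pow 2 μ).const_sub 1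
  refine (e2.sqrt (one_sub_sq_pos hμ).ne').congr_deriv ?_
  field_simp

theorem memLp_of_bounded_on_Ioo {u v : ℝ → ℝ} (hv : Continuous v)
    (huv : ∀ μ ∈ Ioo (-1 : ℝ) 1, u μ = v μ) : MemLp u 2 (volume.restrict (Ioo (-1 : ℝ) 1)) := by
  obtain ⟨C, hC⟩ := (isCompact_Icc (a := (-1 : ℝ)) (b := 1)).exists_bound_of_continuousOn
    hv.continuousOn
  have h1 : MemLp v 2 (volume.restrict (Ioo (-1 : ℝ) 1)) :=
    MemLp.of_bound hv.aestronglyMeasurable C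
      (ae_restrict_of_forall_mem measurableSet_Ioo fun x hx => hC x (Ioo_subset_Icc_self hx))
  exact h1.ae_eq (ae_restrict_of_forall_mem measurableSet_Ioo fun x hx => (huv x hx).symm)

/-- With `g = (1-μ²)^{1/2} h` the singular factors cancel: both weighted functions required to be
square integrable are restrictions of continuous functions on `[-1, 1]`. -/
theorem isGCIProfile_of_solvesAt {κ : ℝ} {H : ℝ → ℝ} (hH : ContDiff ℝ 2 H)
    (hs : ∀ μ ∈ Icc (-1 : ℝ) 1, SolvesAt κ 1 H (deriv H) (deriv (deriv H)) μ) :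
    IsGCIProfile κ fun μ => Real.sqrt (1 - μ ^ 2) * H μ := by
  have hH1 : Continuous (deriv H) := hH.continuous_deriv (by norm_num)
  have d1 : ∀ μ ∈ Ioo (-1 : ℝ) 1, HasDerivAt (fun μ => Real.sqrt (1 - μ ^ 2) * H μ)
      (-(μ / Real.sqrt (1 - μ ^ 2)) * H μ + Real.sqrt (1 - μ ^ 2) * deriv H μ) μ := fun μ hμ =>
    (hasDerivAt_sqrt_one_sub_sq hμ).mul (hs μ (Ioo_subset_Icc_self hμ)).d1
  have hflux : ∀ μ ∈ Ioo (-1 : ℝ) 1, Real.exp (κ * μ) * (1 - μ ^ 2) *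
      deriv (fun μ => Real.sqrt (1 - μ ^ 2) * H μ) μ =
      Real.exp (κ * μ) * Real.sqrt (1 - μ ^ 2) * ((1 - μ ^ 2) * deriv H μ - μ * H μ) := by
    intro μ hμ
    rw [(d1 μ hμ).deriv]
    have h0 := one_sub_sq_pos hμ
    have hsq := Real.sq_sqrt h0.le
    have hne : Real.sqrt (1 - μ ^ 2) ≠ 0 := (Real.sqrt_pos.2 h0).ne'
    field_simp
    rw [hsq]
    ring
  have d2 : ∀ μ ∈ Ioo (-1 : ℝ) 1, HasDerivAt (fun s => Real.exp (κ * s) * (1 - s ^ 2) *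
      deriv (fun μ => Real.sqrt (1 - μ ^ 2) * H μ) s)
      (Real.exp (κ * μ) * (Real.sqrt (1 - μ ^ 2) + H μ / Real.sqrt (1 - μ ^ 2))) μ := by
    intro μ hμ
    have hev : (fun s => Real.exp (κ * s) * (1 - s ^ 2) *
        deriv (fun μ => Real.sqrt (1 - μ ^ 2) * H μ) s) =ᶠ[𝓝 μ] fun μ =>
        Real.exp (κ * μ) * Real.sqrt (1 - μ ^ 2) * ((1 - μ ^ 2) * deriv H μ - μ * H μ) := by
      filter_upwards [isOpen_Ioo.mem_nhds hμ] with s hs using hflux s hs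
    refine HasDerivAt.congr_of_eventuallyEq ?_ hev
    have S := hs μ (Ioo_subset_Icc_self hμ)
    have e1 : HasDerivAt (fun μ => Real.exp (κ * μ)) (Real.exp (κ * μ) * κ) μ := by
      simpa using ((hasDerivAt_id μ).const_mul κ).exp
    have e2 : HasDerivAt (fun μ : ℝ => 1 - μ ^ 2) (-(2 * μ)) μ := by
      simpa using (hasDerivAt_pow 2 μ).const_sub 1
    have := (e1.mul (hasDerivAt_sqrt_one_sub_sq hμ)).mul
      ((e2.mul S.d2).sub ((hasDerivAt_id μ).mul S.d1))
    refine this.congr_deriv ?_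
    have h0 := one_sub_sq_pos hμ
    have hsq := Real.sq_sqrt h0.le
    have hne : Real.sqrt (1 - μ ^ 2) ≠ 0 := (Real.sqrt_pos.2 h0).ne'
    have hE := S.eq
    simp only [id, Pi.mul_apply, Pi.sub_apply]
    field_simp
    rw [hsq]
    linear_combination (1 - μ ^ 2) * hE
  refine ⟨fun μ hμ => (d1 μ hμ).differentiableAt, fun μ hμ => (d2 μ hμ).differentiableAt,
    fun μ hμ => ?_, ?_, ?_⟩
  · rw [(d2 μ hμ).deriv]
    have h0 := one_sub_sq_pos hμ
    have hsq := Real.sq_sqrt h0.le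
    have hne : Real.sqrt (1 - μ ^ 2) ≠ 0 := (Real.sqrt_pos.2 h0).ne'
    have hpow : (1 - μ ^ 2) ^ (3 / 2 : ℝ) = (1 - μ ^ 2) * Real.sqrt (1 - μ ^ 2) := by
      rw [Real.sqrt_eq_rpow, show (3 / 2 : ℝ) = 1 + 1 / 2 by norm_num, Real.rpow_add h0,
        Real.rpow_one]
    rw [hpow]
    field_simp
    rw [hsq]
    ring
  · refine memLp_of_bounded_on_Ioo hH.continuous fun μ hμ => ?_
    have hne : Real.sqrt (1 - μ ^ 2) ≠ 0 := (Real.sqrt_pos.2 (one_sub_sq_pos hμ)).ne'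
    field_simp
  · refine memLp_of_bounded_on_Ioo (v := fun μ => (1 - μ ^ 2) * deriv H μ - μ * H μ)
      (by have := hH.continuous; fun_prop) fun μ hμ => ?_
    have h0 := one_sub_sq_pos hμ
    have hsq := Real.sq_sqrt h0.le
    have hne : Real.sqrt (1 - μ ^ 2) ≠ 0 := (Real.sqrt_pos.2 h0).ne'
    rw [(d1 μ hμ).deriv]
    field_simp
    rw [hsq]
    ring

/-- A function in the weighted space cannot have nondecreasing modulus up to the endpoint. -/
theorem not_modulus_increasing {d d₁ : ℝ → ℝ} (hd : ∀ μ ∈ Ioo (-1 : ℝ) 1, HasDerivAt d (d₁ μ) μ)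
    (hL : MemLp (fun μ => (Real.sqrt (1 - μ ^ 2))⁻¹ * d μ) 2 (volume.restrict (Ioo (-1 : ℝ) 1)))
    {μ₀ : ℝ} (h0 : μ₀ ∈ Ioo (-1 : ℝ) 1) (hne : d μ₀ ≠ 0)
    (hinc : ∀ μ ∈ Ico μ₀ 1, 0 ≤ d μ * d₁ μ) : False := by
  have hsub : ∀ μ ∈ Ico μ₀ 1, μ ∈ Ioo (-1 : ℝ) 1 := fun μ hμ => ⟨h0.1.trans_le hμ.1, hμ.2⟩
  have hmono : MonotoneOn (fun μ => d μ ^ 2) (Ico μ₀ 1) := by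
    refine monotoneOn_of_deriv_nonneg (convex_Ico _ _) (fun μ hμ =>
      ((hd μ (hsub μ hμ)).pow 2).continuousAt.continuousWithinAt) (fun μ hμ =>
      ((hd μ (hsub μ (interior_subset hμ))).pow 2).differentiableAt.differentiableWithinAt)
      fun μ hμ => ?_
    have hμ' := interior_subset hμ
    have := ((hd μ (hsub μ hμ')).pow 2).deriv
    change 0 ≤ deriv (d ^ 2) μ
    rw [this]
    have := hinc μ hμ'
    simp
    nlinarith
  have hint := hL.integrable_sq
  have hδ : 0 < d μ₀ ^ 2 := by positivity
  -- A modulus bounded below near `1` and `1 - μ² ≤ 2(1 - μ)` would make `1/(1 - μ)` integrable up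
  -- to `1`, which fails logarithmically.
  have hint2 : IntegrableOn (fun μ : ℝ => (μ - 1)⁻¹) (Ioo μ₀ 1) := by
    have h1 : Integrable (fun μ => 2 / d μ₀ ^ 2 * ((Real.sqrt (1 - μ ^ 2))⁻¹ * d μ) ^ 2)
        (volume.restrict (Ioo μ₀ 1)) :=
      (IntegrableOn.mono_set hint (Ioo_subset_Ioo_left h0.1.le)).const_mul _
    refine h1.mono' (by fun_prop) (ae_restrict_of_forall_mem measurableSet_Ioo fun μ hμ => ?_)
    have hμ1 := hsub μ ⟨hμ.1.le, hμ.2⟩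
    have hd2 : d μ₀ ^ 2 ≤ d μ ^ 2 := hmono ⟨le_rfl, h0.2⟩ ⟨hμ.1.le, hμ.2⟩ hμ.1.le
    have hp := one_sub_sq_pos hμ1
    have h1m : 0 < 1 - μ := by linarith [hμ.2]
    rw [Real.norm_eq_abs, abs_inv, abs_sub_comm, abs_of_pos h1m, mul_pow, inv_pow,
      Real.sq_sqrt hp.le]
    rw [div_mul_eq_mul_div, le_div_iff₀ hδ, inv_mul_eq_div, inv_mul_eq_div, mul_div_assoc',
      div_le_div_iff₀ h1m hp]
    have : 1 - μ ^ 2 = (1 - μ) * (1 + μ) := by ring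
    rw [this]
    have h3 : d μ₀ ^ 2 * (1 + μ) ≤ 2 * d μ ^ 2 := by nlinarith [hμ1.1, hμ1.2]
    nlinarith
  have h2 : IntervalIntegrable (fun μ : ℝ => (μ - 1)⁻¹) volume μ₀ 1 := by
    rw [intervalIntegrable_iff_integrableOn_Ioo_of_le h0.2.le]
    exact hint2
  rw [intervalIntegrable_sub_inv_iff] at h2
  rcases h2 with h2 | h2
  · exact absurd h2 h0.2.ne
  · exact h2 right_mem_uIcc

theorem not_modulus_decreasing {d d₁ : ℝ → ℝ} (hd : ∀ μ ∈ Ioo (-1 : ℝ) 1, HasDerivAt d (d₁ μ) μ)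
    (hL : MemLp (fun μ => (Real.sqrt (1 - μ ^ 2))⁻¹ * d μ) 2 (volume.restrict (Ioo (-1 : ℝ) 1)))
    {μ₀ : ℝ} (h0 : μ₀ ∈ Ioo (-1 : ℝ) 1) (hne : d μ₀ ≠ 0)
    (hdec : ∀ μ ∈ Ioc (-1) μ₀, d μ * d₁ μ ≤ 0) : False := by
  have hmp : MeasurePreserving (fun x : ℝ => -x) (volume.restrict (Ioo (-1 : ℝ) 1))
      (volume.restrict (Ioo (-1 : ℝ) 1)) := by
    have := (Measure.measurePreserving_neg (volume : Measure ℝ)).restrict_preimage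
      (s := Ioo (-1 : ℝ) 1) measurableSet_Ioo
    simpa using this
  refine not_modulus_increasing (d := fun μ => d (-μ)) (d₁ := fun μ => -d₁ (-μ)) (μ₀ := -μ₀)
    (fun μ hμ => ?_) ?_ ⟨by linarith [h0.2], by linarith [h0.1]⟩ (by simpa using hne) fun μ hμ => ?_
  · exact ((hd (-μ) ⟨by linarith [hμ.2], by linarith [hμ.1]⟩).comp μ (hasDerivAt_neg μ)).congr_deriv
      (by ring)
  · have := hL.comp_measurePreserving hmp
    simpa [Function.comp_def] using this
  · have := hdec (-μ) ⟨by linarith [hμ.2], by linarith [hμ.1]⟩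
    linarith

/-- For the difference `d` of two solutions the flux `F = p d d'` is nondecreasing, its derivative
being a sum of squares. If `F` were positive somewhere, `|d|` would increase up to the pole `1`; if
negative, `|d|` would grow towards the pole `-1`. Both contradict the weighted `L²` condition, so
`F` and then its derivative vanish. -/
theorem IsGCIProfile.eqOn {κ : ℝ} {g k : ℝ → ℝ} (hg : IsGCIProfile κ g) (hk : IsGCIProfile κ k) :
    EqOn g k (Ioo (-1 : ℝ) 1) := by
  set d := fun μ => g μ - k μ with hd
  set d₁ := fun μ => deriv g μ - deriv k μ with hd₁
  set F := fun μ => (Real.exp (κ * μ) * (1 - μ ^ 2) * deriv g μ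
    - Real.exp (κ * μ) * (1 - μ ^ 2) * deriv k μ) * d μ with hF
  have hdd : ∀ μ ∈ Ioo (-1 : ℝ) 1, HasDerivAt d (d₁ μ) μ := fun μ hμ =>
    (hg.differentiable μ hμ).hasDerivAt.sub (hk.differentiable μ hμ).hasDerivAt
  have hFd : ∀ μ ∈ Ioo (-1 : ℝ) 1, HasDerivAt F
      (Real.exp (κ * μ) * (d μ ^ 2 / (1 - μ ^ 2) + (1 - μ ^ 2) * d₁ μ ^ 2)) μ := by
    intro μ hμ
    have := (((hg.differentiable_flux μ hμ).hasDerivAt.sub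
      (hk.differentiable_flux μ hμ).hasDerivAt)).mul (hdd μ hμ)
    refine this.congr_deriv ?_
    have e1 := hg.equation μ hμ
    have e2 := hk.equation μ hμ
    have hp := (one_sub_sq_pos hμ).ne'
    simp only [hd, hd₁, Pi.sub_apply] at *
    field_simp
    linear_combination (k μ - g μ) * e1 - (k μ - g μ) * e2
  have hF' : ∀ μ, F μ = Real.exp (κ * μ) * (1 - μ ^ 2) * (d μ * d₁ μ) := fun μ => by
    simp only [hF, hd₁]; ring
  have hmono : MonotoneOn F (Ioo (-1 : ℝ) 1) := by
    refine monotoneOn_of_deriv_nonneg (convex_Ioo _ _)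
      (fun μ hμ => (hFd μ hμ).continuousAt.continuousWithinAt)
      (fun μ hμ => (hFd μ (interior_subset hμ)).differentiableAt.differentiableWithinAt)
      fun μ hμ => ?_
    have hμ' := interior_subset hμ
    rw [(hFd μ hμ').deriv]
    have := one_sub_sq_pos hμ'
    positivity
  have hL : MemLp (fun μ => (Real.sqrt (1 - μ ^ 2))⁻¹ * d μ) 2 (volume.restrict (Ioo (-1 : ℝ) 1)) := by
    have := hg.memLp.sub hk.memLp
    exact this.ae_eq (.of_forall fun μ => by simp [hd, mul_sub])
  have hzero : ∀ μ ∈ Ioo (-1 : ℝ) 1, F μ = 0 := by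
    intro μ₀ h0
    have hp0 := one_sub_sq_pos h0
    by_contra hne
    have hd0 : d μ₀ ≠ 0 := fun h => hne (by rw [hF', h]; ring)
    rcases lt_or_gt_of_ne hne with hlt | hgt
    · refine not_modulus_decreasing hdd hL h0 hd0 fun μ hμ => ?_
      have hμ' : μ ∈ Ioo (-1 : ℝ) 1 := ⟨hμ.1, hμ.2.trans_lt h0.2⟩
      have := (hmono hμ' h0 hμ.2).trans_lt hlt
      rw [hF'] at this
      have hp := one_sub_sq_pos hμ'
      by_contra hcon
      push Not at hcon
      have : 0 < Real.exp (κ * μ) * (1 - μ ^ 2) * (d μ * d₁ μ) := by positivity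
      linarith
    · refine not_modulus_increasing hdd hL h0 hd0 fun μ hμ => ?_
      have hμ' : μ ∈ Ioo (-1 : ℝ) 1 := ⟨h0.1.trans_le hμ.1, hμ.2⟩
      have := hgt.trans_le (hmono h0 hμ' hμ.1)
      rw [hF'] at this
      have hp := one_sub_sq_pos hμ'
      exact (pos_of_mul_pos_right this (by positivity)).le
  intro μ hμ
  have h1 : deriv F μ = 0 := by
    have : F =ᶠ[𝓝 μ] fun _ => 0 := by
      filter_upwards [isOpen_Ioo.mem_nhds hμ] with s hs using hzero s hs
    rw [this.deriv_eq, deriv_const]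
  rw [(hFd μ hμ).deriv] at h1
  have hp := one_sub_sq_pos hμ
  have h2 := (mul_eq_zero.1 h1).resolve_left (Real.exp_pos _).ne'
  have h3 : 0 ≤ d μ ^ 2 / (1 - μ ^ 2) := by positivity
  have h4 : 0 ≤ (1 - μ ^ 2) * d₁ μ ^ 2 := by positivity
  have h5 : d μ ^ 2 / (1 - μ ^ 2) = 0 := by linarith
  have h6 : d μ = 0 := by simpa [hp.ne'] using h5
  simpa [hd, sub_eq_zero] using h6

/-! ### The macroscopic constants -/

/-- The von Mises density as a function of `μ = Ω·ω`. -/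
noncomputable def vmProfile (κ x : ℝ) : ℝ :=
  Real.exp (κ * x) / ∫ ω' : S2, Real.exp (κ * inner ℝ (pole : E3) (ω' : E3)) ∂sigma

theorem integral_exp_inner (κ : ℝ) (Ω : S2) :
    ∫ ω' : S2, Real.exp (κ * inner ℝ (Ω : E3) (ω' : E3)) ∂sigma =
      (1 / 2) * ∫ x in (-1 : ℝ)..1, Real.exp (κ * x) :=
  integral_zonal (φ := fun x => Real.exp (κ * x)) (by fun_prop) Ω

theorem vonMises_eq (κ : ℝ) (Ω ω : S2) :
    vonMises κ Ω ω = vmProfile κ (inner ℝ (Ω : E3) (ω : E3)) := by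
  rw [vonMises, vmProfile, integral_exp_inner, integral_exp_inner]

theorem vonMisesAngle_eq (κ θ : ℝ) : vonMisesAngle κ θ = vmProfile κ (Real.cos θ) := rfl

theorem integral_exp_pos (κ : ℝ) : 0 < ∫ x in (-1 : ℝ)..1, Real.exp (κ * x) :=
  intervalIntegral.intervalIntegral_pos_of_pos (Continuous.intervalIntegrable (by fun_prop) _ _)
    (fun _ => Real.exp_pos _) (by norm_num)

theorem vmProfile_pos (κ x : ℝ) : 0 < vmProfile κ x := by
  rw [vmProfile, integral_exp_inner]
  have := integral_exp_pos κ
  positivity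

theorem contDiff_vmProfile (κ : ℝ) {n : WithTop ℕ∞} : ContDiff ℝ n (vmProfile κ) := by
  unfold vmProfile
  fun_prop

@[fun_prop]
theorem continuous_vmProfile (κ : ℝ) : Continuous (vmProfile κ) :=
  (contDiff_vmProfile κ (n := 0)).continuous

theorem hasDerivAt_vmProfile (κ x : ℝ) : HasDerivAt (vmProfile κ) (κ * vmProfile κ x) x := by
  have := (((hasDerivAt_id x).const_mul κ).exp).div_const
    (∫ ω' : S2, Real.exp (κ * inner ℝ (pole : E3) (ω' : E3)) ∂sigma)
  refine this.congr_deriv ?_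
  simp [vmProfile]
  ring

theorem integral_vmProfile (κ : ℝ) : ∫ x in (-1 : ℝ)..1, vmProfile κ x = 2 := by
  have := (integral_exp_pos κ).ne'
  simp only [vmProfile, integral_exp_inner]
  rw [intervalIntegral.integral_div]
  field_simp

theorem integral_vonMises (κ : ℝ) (Ω : S2) : ∫ ω, vonMises κ Ω ω ∂sigma = 1 := by
  simp_rw [vonMises_eq]
  rw [integral_zonal (continuous_vmProfile κ), integral_vmProfile]
  norm_num

theorem integral_cos_sin {φ : ℝ → ℝ} (hφ : Continuous φ) :
    ∫ θ in (0 : ℝ)..Real.pi, φ (Real.cos θ) * Real.sin θ = ∫ x in (-1 : ℝ)..1, φ x := by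
  have := intervalIntegral.integral_comp_mul_deriv (a := 0) (b := Real.pi) (f := Real.cos)
    (f' := fun θ => -Real.sin θ) (g := φ) (fun x _ => Real.hasDerivAt_cos x)
    (by fun_prop) hφ
  simp only [Function.comp_apply, mul_neg, intervalIntegral.integral_neg, Real.cos_zero,
    Real.cos_pi] at this
  rw [intervalIntegral.integral_symm 1 (-1), ← this, neg_neg]

theorem avg_eq (g l : ℝ → ℝ) : avg g l =
    (∫ θ in (0 : ℝ)..Real.pi, g θ * l θ) / ∫ θ in (0 : ℝ)..Real.pi, l θ := by
  simp only [avg, mul_div_assoc', intervalIntegral.integral_div]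

theorem avg_weightM {φ : ℝ → ℝ} (hφ : Continuous φ) (κ : ℝ) :
    avg (fun θ => φ (Real.cos θ)) (weightM κ) =
      (1 / 2) * ∫ x in (-1 : ℝ)..1, φ x * vmProfile κ x := by
  rw [avg_eq]
  have e1 : ∀ θ, weightM κ θ = vmProfile κ (Real.cos θ) * Real.sin θ := fun θ => by
    rw [weightM, vonMisesAngle_eq, mul_comm]
  have e2 : ∀ θ, φ (Real.cos θ) * weightM κ θ =
      (fun x => φ x * vmProfile κ x) (Real.cos θ) * Real.sin θ := fun θ => by rw [e1]; ring
  rw [intervalIntegral.integral_congr fun θ _ => e2 θ,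
    integral_cos_sin (φ := fun x => φ x * vmProfile κ x) (by fun_prop)]
  simp_rw [e1]
  rw [integral_cos_sin (continuous_vmProfile κ), integral_vmProfile]
  ring

theorem c1_eq (κ : ℝ) : c1 κ = (1 / 2) * ∫ x in (-1 : ℝ)..1, x * vmProfile κ x :=
  avg_weightM (φ := fun x => x) continuous_id κ

theorem c4_eq (κ : ℝ) :
    c4 κ = 1 - 3 / 4 * ∫ x in (-1 : ℝ)..1, (1 - x ^ 2) * vmProfile κ x := by
  have := avg_weightM (φ := fun x => 1 - x ^ 2) (by fun_prop) κ
  simp_rw [← Real.sin_sq] at this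
  rw [c4, this]
  ring

/-- `C₀ = ∫ M (1-μ²)/2 dω`. -/
noncomputable def vmVariance (κ : ℝ) : ℝ := ∫ x in (-1 : ℝ)..1, vmProfile κ x * (1 - x ^ 2) / 4

theorem vmVariance_pos (κ : ℝ) : 0 < vmVariance κ := by
  refine intervalIntegral.intervalIntegral_pos_of_pos_on
    (Continuous.intervalIntegrable (by fun_prop) _ _) (fun x hx => ?_) (by norm_num)
  have := one_sub_sq_pos hx
  have := vmProfile_pos κ x
  positivity

theorem c4_eq_variance (κ : ℝ) : c4 κ = 1 - 3 * vmVariance κ := by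
  rw [c4_eq, vmVariance, intervalIntegral.integral_div]
  simp_rw [mul_comm (vmProfile κ _)]
  ring

/-- Integrate `(M (1 - x²))' = κ M (1 - x²) - 2 x M`; the boundary terms vanish. -/
theorem c1_eq_variance (κ : ℝ) : c1 κ = κ * vmVariance κ := by
  have e2 : ∀ x : ℝ, HasDerivAt (fun μ : ℝ => 1 - μ ^ 2) (-(2 * x)) x := fun x => by
    simpa using (hasDerivAt_pow 2 x).const_sub 1
  have h := intervalIntegral.integral_eq_sub_of_hasDerivAt (a := -1) (b := 1)
    (fun x _ => (hasDerivAt_vmProfile κ x).mul (e2 x))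
    (Continuous.intervalIntegrable (by fun_prop) _ _)
  have h' : ∫ x in (-1 : ℝ)..1, (4 * κ * (vmProfile κ x * (1 - x ^ 2) / 4) - 2 * (x * vmProfile κ x)) = 0 := by
    simp only [Pi.mul_apply] at h
    norm_num at h
    rw [← h]
    refine intervalIntegral.integral_congr fun x _ => ?_
    ring
  rw [intervalIntegral.integral_sub (Continuous.intervalIntegrable (by fun_prop) _ _)
    (Continuous.intervalIntegrable (by fun_prop) _ _), intervalIntegral.integral_const_mul,
    intervalIntegral.integral_const_mul] at h'
  rw [c1_eq, vmVariance]
  linarith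

theorem c1_pos {κ : ℝ} (hκ : 0 < κ) : 0 < c1 κ := by
  rw [c1_eq_variance]
  exact mul_pos hκ (vmVariance_pos κ)

/-- A smooth profile of the generalised collision invariant. -/
structure IsSmoothProfile (κ : ℝ) (H : ℝ → ℝ) : Prop where
  contDiff : ContDiff ℝ 2 H
  solves : ∀ μ ∈ Icc (-1 : ℝ) 1, SolvesAt κ 1 H (deriv H) (deriv (deriv H)) μ
  eq_gciH : ∀ μ ∈ Ioo (-1 : ℝ) 1, gciH κ μ = H μ

/-- `gciG` is only given by choice. Uniqueness identifies it on `(-1, 1)` with the constructed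
solution, so that the constants may be computed from a profile smooth up to the poles. -/
theorem exists_isSmoothProfile (κ : ℝ) : ∃ H, IsSmoothProfile κ H := by
  obtain ⟨H, hH, hs⟩ := exists_smooth_profile κ
  refine ⟨H, hH, hs, fun μ hμ => ?_⟩
  have hp := isGCIProfile_of_solvesAt hH hs
  have hg : IsGCIProfile κ (gciG κ) := Classical.epsilon_spec (p := IsGCIProfile κ) ⟨_, hp⟩
  rw [gciH, hg.eqOn hp hμ]
  have hne : Real.sqrt (1 - μ ^ 2) ≠ 0 := (Real.sqrt_pos.2 (one_sub_sq_pos hμ)).ne'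
  field_simp

/-! ### Moments of the generalised collision invariant. -/

section
variable {κ : ℝ} {H : ℝ → ℝ}

@[fun_prop]
theorem IsSmoothProfile.continuous (h : IsSmoothProfile κ H) : Continuous H := h.contDiff.continuous

@[fun_prop]
theorem IsSmoothProfile.continuous_deriv (h : IsSmoothProfile κ H) : Continuous (deriv H) :=
  h.contDiff.continuous_deriv (by norm_num)

/-- The moments `B_k = ∫ M h μ^k (1-μ²)/2 dω`. -/
noncomputable def gciMoment (κ : ℝ) (H : ℝ → ℝ) (k : ℕ) : ℝ :=
  ∫ x in (-1 : ℝ)..1, vmProfile κ x * H x * x ^ k * (1 - x ^ 2) / 4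

/-- The flux vanishes at both poles, so the integrated energy identity says that the source term, a
positive multiple of `B₀`, equals minus the energy. This makes `B₀` a legitimate denominator in `c₂`
and `c₃`. -/
theorem IsSmoothProfile.gciMoment_zero_neg (h : IsSmoothProfile κ H) : gciMoment κ H 0 < 0 := by
  have hH := h.continuous
  have hH1 := h.continuous_deriv
  have hU : uIcc (-1 : ℝ) 1 = Icc (-1) 1 := uIcc_of_le (by norm_num)
  have h0 := intervalIntegral.integral_eq_sub_of_hasDerivAt (a := -1) (b := 1)
    (fun x hx => (h.solves x (hU ▸ hx)).hasDerivAt_gciFlux)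
    (Continuous.intervalIntegrable (by fun_prop) _ _)
  have h1 : gciFlux κ H (deriv H) 1 - gciFlux κ H (deriv H) (-1) = 0 := by simp [gciFlux]
  rw [h1] at h0
  have hE : 0 < ∫ x in (-1 : ℝ)..1,
      Real.exp (κ * x) * (((1 - x ^ 2) * deriv H x - x * H x) ^ 2 + H x ^ 2) := by
    -- An identically vanishing profile would contradict the right-hand side `1` of the equation.
    obtain ⟨c, hc, hc0⟩ : ∃ c ∈ Icc (-1 : ℝ) 1, H c ≠ 0 := by
      by_contra hcon
      push Not at hcon
      have hz : (0 : ℝ) ∈ Icc (-1 : ℝ) 1 := by norm_num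
      have hev : H =ᶠ[𝓝 0] fun _ => 0 := by
        filter_upwards [Icc_mem_nhds (by norm_num : (-1 : ℝ) < 0) one_pos] with x hx using hcon x hx
      have hev1 : deriv H =ᶠ[𝓝 0] fun _ => 0 := by
        simpa using hev.deriv
      have := (h.solves 0 hz).eq
      rw [hev1.deriv_eq, hev1.eq_of_nhds, hcon 0 hz] at this
      simp at this
    refine intervalIntegral.integral_pos (by norm_num) (by fun_prop) (fun x _ => by positivity)
      ⟨c, hc, by positivity⟩
  have h2 : ∀ x, Real.exp (κ * x) * (((1 - x ^ 2) * deriv H x - x * H x) ^ 2 + H x ^ 2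
      + 1 * ((1 - x ^ 2) * H x)) = Real.exp (κ * x) * (((1 - x ^ 2) * deriv H x - x * H x) ^ 2
      + H x ^ 2) + Real.exp (κ * x) * ((1 - x ^ 2) * H x) := fun x => by ring
  simp_rw [h2] at h0
  rw [intervalIntegral.integral_add (Continuous.intervalIntegrable (by fun_prop) _ _)
    (Continuous.intervalIntegrable (by fun_prop) _ _)] at h0
  have h3 : gciMoment κ H 0 = (∫ x in (-1 : ℝ)..1, Real.exp (κ * x) * ((1 - x ^ 2) * H x)) *
      (4 * (1 / 2 * ∫ x in (-1 : ℝ)..1, Real.exp (κ * x)))⁻¹ := by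
    rw [gciMoment, ← intervalIntegral.integral_mul_const]
    refine intervalIntegral.integral_congr fun x _ => ?_
    simp only [vmProfile, integral_exp_inner]
    have := (integral_exp_pos κ).ne'
    field_simp
  rw [h3]
  have := integral_exp_pos κ
  exact mul_neg_of_neg_of_pos (by linarith) (by positivity)

/-- In self-adjoint form the equation reads `(M (1-x²)² H')' = M (1-x²) ((2 + κx) H + 1)`, and the
boundary terms vanish. Through it `c₁`, which multiplies `Δ(ρΩ)` in the limit, is expressed by the
moments defining `c₂`; this is the origin of `c₂ + 2/κ` in `γ`. -/
theorem IsSmoothProfile.variance_eq (h : IsSmoothProfile κ H) :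
    vmVariance κ = -(2 * gciMoment κ H 0 + κ * gciMoment κ H 1) := by
  have hH := h.continuous
  have hH1 := h.continuous_deriv
  have hU : uIcc (-1 : ℝ) 1 = Icc (-1) 1 := uIcc_of_le (by norm_num)
  have e2 : ∀ x : ℝ, HasDerivAt (fun μ : ℝ => 1 - μ ^ 2) (-(2 * x)) x := fun x => by
    simpa using (hasDerivAt_pow 2 x).const_sub 1
  have key : ∀ x ∈ uIcc (-1 : ℝ) 1, HasDerivAt
      (fun x => vmProfile κ x * (1 - x ^ 2) ^ 2 * deriv H x)
      (vmProfile κ x * (1 - x ^ 2) * ((2 + κ * x) * H x + 1)) x := by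
    intro x hx
    have S := h.solves x (hU ▸ hx)
    refine (((hasDerivAt_vmProfile κ x).mul ((e2 x).pow 2)).mul S.d2).congr_deriv ?_
    simp
    linear_combination (vmProfile κ x * (1 - x ^ 2)) * S.eq
  have h0 := intervalIntegral.integral_eq_sub_of_hasDerivAt key
    (Continuous.intervalIntegrable (by fun_prop) _ _)
  norm_num at h0
  have h2 : ∀ x, vmProfile κ x * (1 - x ^ 2) * ((2 + κ * x) * H x + 1) =
      8 * (vmProfile κ x * H x * x ^ 0 * (1 - x ^ 2) / 4)
      + 4 * κ * (vmProfile κ x * H x * x ^ 1 * (1 - x ^ 2) / 4)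
      + 4 * (vmProfile κ x * (1 - x ^ 2) / 4) := fun x => by ring
  simp_rw [h2] at h0
  rw [intervalIntegral.integral_add (Continuous.intervalIntegrable (by fun_prop) _ _)
    (Continuous.intervalIntegrable (by fun_prop) _ _), intervalIntegral.integral_add
    (Continuous.intervalIntegrable (by fun_prop) _ _)
    (Continuous.intervalIntegrable (by fun_prop) _ _), intervalIntegral.integral_const_mul,
    intervalIntegral.integral_const_mul, intervalIntegral.integral_const_mul] at h0
  rw [vmVariance, gciMoment, gciMoment]
  linarith

theorem IsSmoothProfile.avg_weightH (h : IsSmoothProfile κ H) (k : ℕ) :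
    avg (fun θ => Real.cos θ ^ k) (weightH κ) = gciMoment κ H k / gciMoment κ H 0 := by
  have hH := h.continuous
  have e1 : ∀ k : ℕ, ∀ θ ∈ uIcc 0 Real.pi, Real.cos θ ^ k * weightH κ θ =
      (fun x => 4 * (vmProfile κ x * H x * x ^ k * (1 - x ^ 2) / 4)) (Real.cos θ) * Real.sin θ := by
    intro k θ hθ
    rw [uIcc_of_le Real.pi_pos.le] at hθ
    simp only [weightH, vonMisesAngle_eq, ← Real.sin_sq]
    -- At the poles `gciH` is not controlled, but the weight carries `sin³ θ`.
    by_cases hs : Real.sin θ = 0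
    · simp [hs]
    · have : Real.cos θ ∈ Ioo (-1 : ℝ) 1 := by
        have hpos : 0 < Real.sin θ ^ 2 := by positivity
        rw [Real.sin_sq] at hpos
        exact abs_lt.1 ((sq_lt_one_iff_abs_lt_one _).1 (by linarith))
      rw [h.eq_gciH _ this]
      ring
  have e2 : ∀ k : ℕ, ∫ θ in (0 : ℝ)..Real.pi, Real.cos θ ^ k * weightH κ θ = 4 * gciMoment κ H k := by
    intro k
    rw [intervalIntegral.integral_congr (e1 k), integral_cos_sin
      (φ := fun x => 4 * (vmProfile κ x * H x * x ^ k * (1 - x ^ 2) / 4)) (by fun_prop),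
      intervalIntegral.integral_const_mul, gciMoment]
  have e3 := e2 0
  simp only [pow_zero, one_mul] at e3
  rw [avg_eq, e2, e3]
  field_simp

theorem IsSmoothProfile.c2_eq (h : IsSmoothProfile κ H) :
    c2 κ = gciMoment κ H 1 / gciMoment κ H 0 := by
  rw [← h.avg_weightH 1]
  simp [c2]

theorem IsSmoothProfile.c3_eq (h : IsSmoothProfile κ H) :
    c3 κ = 2 * (gciMoment κ H 2 / gciMoment κ H 0) := by
  rw [← h.avg_weightH 2, c3]

end

/-! ### Integrals over the sphere depending on parameters -/

section Parametric

variable {X : Type*} [NormedAddCommGroup X] [NormedSpace ℝ X] [ProperSpace X]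
  {W : Type*} [NormedAddCommGroup W] [NormedSpace ℝ W] {U : Set X}

theorem continuousOn_sphere_integral {X : Type*} [NormedAddCommGroup X] [ProperSpace X]
    {U : Set X} (hU : IsOpen U) {G : X → S2 → W}
    (hG : ContinuousOn (Function.uncurry G) (U ×ˢ univ)) :
    ContinuousOn (fun q => ∫ ω, G q ω ∂sigma) U := by
  rw [continuousOn_iff_continuous_domRestrict]
  have : LocallyCompactSpace U := hU.locallyCompactSpace
  have h1 : Continuous (Function.uncurry fun (q : U) (ω : S2) => G q ω) :=
    hG.comp_continuous (f := fun z : U × S2 => ((z.1 : X), z.2)) (by fun_prop)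
      fun z => ⟨z.1.2, mem_univ _⟩
  have := continuous_parametric_integral_of_continuous (μ := sigma) h1 isCompact_univ
  simp only [setIntegral_univ] at this
  exact this

theorem continuous_sphere_slice {X Y : Type*} [TopologicalSpace X] [TopologicalSpace Y]
    {U : Set X} {F : X → S2 → Y}
    (hF : ContinuousOn (Function.uncurry F) (U ×ˢ univ)) {q : X} (hq : q ∈ U) :
    Continuous (F q) :=
  hF.comp_continuous (f := fun ω : S2 => (q, ω)) (by fun_prop) fun _ => ⟨hq, mem_univ _⟩

/-- A closed ball times the sphere is compact, so a constant dominates the derivative. -/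
theorem hasFDerivAt_sphere_integral [CompleteSpace W] (hU : IsOpen U) {G : X → S2 → W}
    {G' : X → S2 → X →L[ℝ] W} (hG : ContinuousOn (Function.uncurry G) (U ×ˢ univ))
    (hG' : ContinuousOn (Function.uncurry G') (U ×ˢ univ))
    (hd : ∀ q ∈ U, ∀ ω, HasFDerivAt (fun q => G q ω) (G' q ω) q) {q : X} (hq : q ∈ U) :
    HasFDerivAt (fun q => ∫ ω, G q ω ∂sigma) (∫ ω, G' q ω ∂sigma) q := by
  obtain ⟨r, hr, hrU⟩ := Metric.nhds_basis_closedBall.mem_iff.1 (hU.mem_nhds hq)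
  have hK : IsCompact (Metric.closedBall q r ×ˢ (univ : Set S2)) :=
    (isCompact_closedBall q r).prod isCompact_univ
  obtain ⟨C, hC⟩ := hK.exists_bound_of_continuousOn (hG'.mono (prod_mono_left hrU))
  refine hasFDerivAt_integral_of_dominated_of_fderiv_le (s := Metric.closedBall q r)
    (bound := fun _ => C) (Metric.closedBall_mem_nhds q hr) ?_ (continuous_integrable (continuous_sphere_slice hG hq))
    (continuous_sphere_slice hG' hq).aestronglyMeasurable ?_ (integrable_const C) ?_
  · filter_upwards [hU.mem_nhds hq] with x hx using (continuous_sphere_slice hG hx).aestronglyMeasurable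
  · exact .of_forall fun ω x hx => hC (x, ω) ⟨hx, mem_univ _⟩
  · exact .of_forall fun ω x hx => hd x (hrU hx) ω

end Parametric

/-! ### Convergence of derivatives -/

section Convergence

variable {X G : Type*} [NormedAddCommGroup X] [NormedSpace ℝ X] [NormedAddCommGroup G]
  [NormedSpace ℝ G] {U : Set X} {gε : ℝ → X → G} {g : X → G} {k : ℕ}

theorem tendstoLocallyUniformlyOn_of_dist_le {ι α β β' : Type*} [TopologicalSpace α]
    [PseudoMetricSpace β] [PseudoMetricSpace β'] {F : ι → α → β} {f : α → β} {F' : ι → α → β'}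
    {f' : α → β'} {l : Filter ι} {s : Set α} (h : TendstoLocallyUniformlyOn F f l s)
    (hle : ∀ n x, dist (f' x) (F' n x) ≤ dist (f x) (F n x)) :
    TendstoLocallyUniformlyOn F' f' l s := by
  rw [Metric.tendstoLocallyUniformlyOn_iff] at h ⊢
  intro ε hε x hx
  obtain ⟨t, ht, h'⟩ := h ε hε x hx
  exact ⟨t, ht, h'.mono fun n hn y hy => (hle n y).trans_lt (hn y hy)⟩

theorem TendstoCk.tendsto (h : TendstoCk k U gε g) :
    TendstoLocallyUniformlyOn gε g (𝓝[>] (0 : ℝ)) U := by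
  refine tendstoLocallyUniformlyOn_of_dist_le (h 0 (Nat.zero_le _)) fun n x => ?_
  rw [dist_eq_norm, dist_eq_norm]
  have := (iteratedFDeriv ℝ 0 g x - iteratedFDeriv ℝ 0 (gε n) x).le_opNorm fun _ => 0
  simpa using this

theorem TendstoCk.tendsto_fderiv (h : TendstoCk k U gε g) (hk : 1 ≤ k) :
    TendstoLocallyUniformlyOn (fun ε => fderiv ℝ (gε ε)) (fderiv ℝ g) (𝓝[>] (0 : ℝ)) U := by
  refine tendstoLocallyUniformlyOn_of_dist_le (h 1 hk) fun n x => ?_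
  rw [dist_eq_norm, dist_eq_norm]
  refine ContinuousLinearMap.opNorm_le_bound _ (norm_nonneg _) fun w => ?_
  have := (iteratedFDeriv ℝ 1 g x - iteratedFDeriv ℝ 1 (gε n) x).le_opNorm fun _ => w
  simpa [iteratedFDeriv_one_apply] using this

theorem TendstoCk.tendsto_fderiv_fderiv (h : TendstoCk k U gε g) (hk : 2 ≤ k) :
    TendstoLocallyUniformlyOn (fun ε => fderiv ℝ (fderiv ℝ (gε ε))) (fderiv ℝ (fderiv ℝ g))
      (𝓝[>] (0 : ℝ)) U := by
  refine tendstoLocallyUniformlyOn_of_dist_le (β' := X →L[ℝ] X →L[ℝ] G) (h 2 hk) fun n x => ?_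
  rw [dist_eq_norm (fderiv ℝ (fderiv ℝ g) x), dist_eq_norm]
  refine ContinuousLinearMap.opNorm_le_bound _ (norm_nonneg _) fun w => ?_
  refine ContinuousLinearMap.opNorm_le_bound _ (by positivity) fun w' => ?_
  have := (iteratedFDeriv ℝ 2 g x - iteratedFDeriv ℝ 2 (gε n) x).le_opNorm ![w, w']
  simpa [iteratedFDeriv_two_apply, Fin.prod_univ_two, mul_assoc] using this

end Convergence

/-! ### Derivatives of a distribution in time and space -/

/-- Space-time. -/
abbrev ST : Type := ℝ × E3

/-- The point `(t, x, ω)`. -/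
def pt (q : ST) (ω : S2) : ℝ × E3 × E3 := (q.1, q.2, (ω : E3))

/-- The inclusion of space-time directions. -/
noncomputable def stIncl : ST →L[ℝ] ℝ × E3 × E3 :=
  (ContinuousLinearMap.fst ℝ ℝ E3).prod ((ContinuousLinearMap.snd ℝ ℝ E3).prod 0)

/-- Restriction of linear forms to space-time directions. -/
noncomputable def stRestr : (ℝ × E3 × E3 →L[ℝ] ℝ) →L[ℝ] (ST →L[ℝ] ℝ) :=
  (ContinuousLinearMap.compL ℝ ST (ℝ × E3 × E3) ℝ).flip stIncl

/-- First derivative in `(t, x)`. -/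
noncomputable def stD (f : ℝ → E3 → S2 → ℝ) (q : ST) (ω : S2) : ST →L[ℝ] ℝ :=
  stRestr (fderiv ℝ (ext f) (pt q ω))

/-- Second derivative in `(t, x)`. -/
noncomputable def stDD (f : ℝ → E3 → S2 → ℝ) (q : ST) (ω : S2) : ST →L[ℝ] ST →L[ℝ] ℝ :=
  stRestr ∘L (fderiv ℝ (fderiv ℝ (ext f)) (pt q ω)) ∘L stIncl

theorem isOpen_dom {I : Set ℝ} (hI : IsOpen I) : IsOpen (dom I) := hI.prod isOpen_univ

theorem isOpen_domF {I : Set ℝ} (hI : IsOpen I) : IsOpen (domF I) :=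
  hI.prod (isOpen_univ.prod isOpen_compl_singleton)

theorem pt_mem {I : Set ℝ} {q : ST} (hq : q ∈ dom I) (ω : S2) : pt q ω ∈ domF I :=
  ⟨hq.1, mem_univ _, S2.ne_zero ω⟩

theorem mem_dom {I : Set ℝ} {t : ℝ} (ht : t ∈ I) (x : E3) : (t, x) ∈ dom I := ⟨ht, mem_univ _⟩

theorem continuous_pt : Continuous (Function.uncurry pt) := by
  unfold pt Function.uncurry
  fun_prop

theorem ext_pt (f : ℝ → E3 → S2 → ℝ) (q : ST) (ω : S2) : ext f (pt q ω) = f q.1 q.2 ω := by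
  simp [ext, pt, dir_coe]

theorem hasFDerivAt_pt (q : ST) (ω : S2) : HasFDerivAt (fun q => pt q ω) stIncl q := by
  have h1 : HasFDerivAt (fun q : ST => q.1) (ContinuousLinearMap.fst ℝ ℝ E3) q := hasFDerivAt_fst
  have h2 : HasFDerivAt (fun q : ST => q.2) (ContinuousLinearMap.snd ℝ ℝ E3) q := hasFDerivAt_snd
  exact h1.prodMk (h2.prodMk (hasFDerivAt_const _ _))

section Field

variable {I : Set ℝ} {f : ℝ → E3 → S2 → ℝ}

theorem hasFDerivAt_field (hI : IsOpen I) (hf : ContDiffOn ℝ 2 (ext f) (domF I)) {q : ST}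
    (hq : q ∈ dom I) (ω : S2) : HasFDerivAt (fun q : ST => f q.1 q.2 ω) (stD f q ω) q := by
  have h1 : HasFDerivAt (ext f) (fderiv ℝ (ext f) (pt q ω)) (pt q ω) :=
    ((hf.differentiableOn (by norm_num)).differentiableAt
      ((isOpen_domF hI).mem_nhds (pt_mem hq ω))).hasFDerivAt
  have h2 := h1.comp q (hasFDerivAt_pt q ω)
  refine (h2.congr_of_eventuallyEq (.of_forall fun q => ?_)).congr_fderiv rfl
  exact (ext_pt f q ω).symm

theorem hasFDerivAt_stD (hI : IsOpen I) (hf : ContDiffOn ℝ 2 (ext f) (domF I)) {q : ST}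
    (hq : q ∈ dom I) (ω : S2) : HasFDerivAt (fun q : ST => stD f q ω) (stDD f q ω) q := by
  have h0 : ContDiffOn ℝ 1 (fderiv ℝ (ext f)) (domF I) :=
    hf.fderiv_of_isOpen (isOpen_domF hI) (by norm_num)
  have h1 : HasFDerivAt (fderiv ℝ (ext f)) (fderiv ℝ (fderiv ℝ (ext f)) (pt q ω)) (pt q ω) :=
    ((h0.differentiableOn (by norm_num)).differentiableAt
      ((isOpen_domF hI).mem_nhds (pt_mem hq ω))).hasFDerivAt
  exact stRestr.hasFDerivAt.comp q (h1.comp q (hasFDerivAt_pt q ω))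

theorem continuousOn_comp_pt {Y : Type*} [TopologicalSpace Y] {F : ℝ × E3 × E3 → Y}
    (hF : ContinuousOn F (domF I)) :
    ContinuousOn (fun z : ST × S2 => F (pt z.1 z.2)) (dom I ×ˢ univ) :=
  hF.comp continuous_pt.continuousOn fun z hz => pt_mem hz.1 z.2

theorem continuousOn_field (hf : ContDiffOn ℝ 2 (ext f) (domF I)) :
    ContinuousOn (Function.uncurry fun (q : ST) ω => f q.1 q.2 ω) (dom I ×ˢ univ) :=
  (continuousOn_comp_pt hf.continuousOn).congr fun z _ => (ext_pt f z.1 z.2).symm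

theorem continuousOn_stD (hI : IsOpen I) (hf : ContDiffOn ℝ 2 (ext f) (domF I)) :
    ContinuousOn (Function.uncurry (stD f)) (dom I ×ˢ univ) :=
  stRestr.continuous.comp_continuousOn
    (continuousOn_comp_pt (hf.continuousOn_fderiv_of_isOpen (isOpen_domF hI) (by norm_num)))

theorem continuousOn_stDD (hI : IsOpen I) (hf : ContDiffOn ℝ 2 (ext f) (domF I)) :
    ContinuousOn (Function.uncurry (stDD f)) (dom I ×ˢ univ) := by
  have h0 : ContDiffOn ℝ 1 (fderiv ℝ (ext f)) (domF I) :=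
    hf.fderiv_of_isOpen (isOpen_domF hI) (by norm_num)
  have h1 := continuousOn_comp_pt (h0.continuousOn_fderiv_of_isOpen (isOpen_domF hI) (by norm_num))
  exact continuousOn_const.clm_comp (h1.clm_comp continuousOn_const)

theorem continuous_slice {Y : Type*} [TopologicalSpace Y] {F : ST → S2 → Y}
    (hF : ContinuousOn (Function.uncurry F) (dom I ×ˢ univ)) {q : ST} (hq : q ∈ dom I) :
    Continuous (F q) :=
  hF.comp_continuous (f := fun ω : S2 => (q, ω)) (by fun_prop) fun _ => ⟨hq, mem_univ _⟩

/-- Uniform convergence on compact sets of space-time, uniformly in the orientation. -/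
def UnifConv {Y : Type*} [NormedAddCommGroup Y] (I : Set ℝ) (Fε : ℝ → ST → S2 → Y)
    (F : ST → S2 → Y) : Prop :=
  ∀ K ⊆ dom I, IsCompact K → ∀ δ > 0, ∀ᶠ ε in 𝓝[>] (0 : ℝ), ∀ q ∈ K, ∀ ω, ‖Fε ε q ω - F q ω‖ ≤ δ

theorem unifConv_of_tendsto {Y : Type*} [NormedAddCommGroup Y] (hI : IsOpen I)
    {Fε : ℝ → ℝ × E3 × E3 → Y} {F : ℝ × E3 × E3 → Y}
    (h : TendstoLocallyUniformlyOn Fε F (𝓝[>] (0 : ℝ)) (domF I)) :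
    UnifConv I (fun ε q ω => Fε ε (pt q ω)) (fun q ω => F (pt q ω)) := by
  intro K hK hKc δ hδ
  rw [tendstoLocallyUniformlyOn_iff_forall_isCompact (isOpen_domF hI)] at h
  have h1 := h (Function.uncurry pt '' (K ×ˢ univ)) (by
    rintro _ ⟨z, hz, rfl⟩
    exact pt_mem (hK hz.1) z.2) ((hKc.prod isCompact_univ).image continuous_pt)
  rw [Metric.tendstoUniformlyOn_iff] at h1
  filter_upwards [h1 δ hδ] with ε hε q hq ω
  have := hε (pt q ω) ⟨(q, ω), ⟨hq, mem_univ _⟩, rfl⟩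
  rw [dist_comm, dist_eq_norm] at this
  exact this.le

theorem UnifConv.clm {Y Z : Type*} [NormedAddCommGroup Y] [NormedSpace ℝ Y] [NormedAddCommGroup Z]
    [NormedSpace ℝ Z] {Fε : ℝ → ST → S2 → Y} {F : ST → S2 → Y} (h : UnifConv I Fε F)
    (A : Y →L[ℝ] Z) : UnifConv I (fun ε q ω => A (Fε ε q ω)) (fun q ω => A (F q ω)) := by
  intro K hK hKc δ hδ
  have hA : 0 < ‖A‖ + 1 := by positivity
  filter_upwards [h K hK hKc (δ / (‖A‖ + 1)) (by positivity)] with ε hε q hq ω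
  rw [← map_sub]
  calc ‖A (Fε ε q ω - F q ω)‖ ≤ ‖A‖ * ‖Fε ε q ω - F q ω‖ := A.le_opNorm _
    _ ≤ (‖A‖ + 1) * (δ / (‖A‖ + 1)) := by gcongr; · linarith
                                          · exact hε q hq ω
    _ = δ := by field_simp

theorem UnifConv.comp_comp {X₁ X₂ Y₁ Y₂ : Type*} [NormedAddCommGroup X₁] [NormedSpace ℝ X₁]
    [NormedAddCommGroup X₂] [NormedSpace ℝ X₂] [NormedAddCommGroup Y₁] [NormedSpace ℝ Y₁]
    [NormedAddCommGroup Y₂] [NormedSpace ℝ Y₂] {Fε : ℝ → ST → S2 → (X₁ →L[ℝ] Y₁)}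
    {F : ST → S2 → (X₁ →L[ℝ] Y₁)} (h : UnifConv I Fε F) (A : Y₁ →L[ℝ] Y₂) (B : X₂ →L[ℝ] X₁) :
    UnifConv I (fun ε q ω => A ∘L Fε ε q ω ∘L B) (fun q ω => A ∘L F q ω ∘L B) :=
  UnifConv.clm (Y := X₂ →L[ℝ] Y₁) (Z := X₂ →L[ℝ] Y₂)
    (UnifConv.clm (Y := X₁ →L[ℝ] Y₁) (Z := X₂ →L[ℝ] Y₁) h
      ((ContinuousLinearMap.compL ℝ X₂ X₁ Y₁).flip B))
    (ContinuousLinearMap.compL ℝ X₂ Y₁ Y₂ A)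

variable {fε : ℝ → ℝ → E3 → S2 → ℝ}

theorem unifConv_field (hI : IsOpen I)
    (h : TendstoCk 2 (domF I) (fun ε => ext (fε ε)) (ext f)) :
    UnifConv I (fun ε q ω => fε ε q.1 q.2 ω) (fun q ω => f q.1 q.2 ω) := by
  have := unifConv_of_tendsto hI h.tendsto
  simpa only [ext_pt] using this

theorem unifConv_stD (hI : IsOpen I)
    (h : TendstoCk 2 (domF I) (fun ε => ext (fε ε)) (ext f)) :
    UnifConv I (fun ε => stD (fε ε)) (stD f) :=
  (unifConv_of_tendsto hI (h.tendsto_fderiv (by norm_num))).clm stRestr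

theorem unifConv_stDD (hI : IsOpen I)
    (h : TendstoCk 2 (domF I) (fun ε => ext (fε ε)) (ext f)) :
    UnifConv I (fun ε => stDD (fε ε)) (stDD f) := by
  exact (unifConv_of_tendsto hI (h.tendsto_fderiv_fderiv (by norm_num))).comp_comp stRestr stIncl

/-! ### Moments -/

/-- The moment `∫ φ(ω) f(t, x, ω) dω`. -/
noncomputable def moment (φ : S2 → ℝ) (f : ℝ → E3 → S2 → ℝ) (q : ST) : ℝ :=
  ∫ ω, φ ω * f q.1 q.2 ω ∂sigma

theorem continuousOn_weight {Y : Type*} [NormedAddCommGroup Y] [NormedSpace ℝ Y] {φ : S2 → ℝ}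
    (hφ : Continuous φ) {F : ST → S2 → Y}
    (hF : ContinuousOn (Function.uncurry F) (dom I ×ˢ univ)) :
    ContinuousOn (Function.uncurry fun q ω => φ ω • F q ω) (dom I ×ˢ univ) :=
  (hφ.comp continuous_snd).continuousOn.smul hF

theorem hasFDerivAt_moment (hI : IsOpen I) (hf : ContDiffOn ℝ 2 (ext f) (domF I)) {φ : S2 → ℝ}
    (hφ : Continuous φ) {q : ST} (hq : q ∈ dom I) :
    HasFDerivAt (moment φ f) (∫ ω, φ ω • stD f q ω ∂sigma) q :=
  hasFDerivAt_sphere_integral (isOpen_dom hI)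
    (continuousOn_weight hφ (continuousOn_field hf))
    (continuousOn_weight hφ (continuousOn_stD hI hf))
    (fun _ hq ω => (hasFDerivAt_field hI hf hq ω).const_mul (φ ω)) hq

theorem fderiv_moment (hI : IsOpen I) (hf : ContDiffOn ℝ 2 (ext f) (domF I)) {φ : S2 → ℝ}
    (hφ : Continuous φ) {q : ST} (hq : q ∈ dom I) :
    fderiv ℝ (moment φ f) q = ∫ ω, φ ω • stD f q ω ∂sigma :=
  (hasFDerivAt_moment hI hf hφ hq).fderiv

theorem hasFDerivAt_fderiv_moment (hI : IsOpen I) (hf : ContDiffOn ℝ 2 (ext f) (domF I))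
    {φ : S2 → ℝ} (hφ : Continuous φ) {q : ST} (hq : q ∈ dom I) :
    HasFDerivAt (fderiv ℝ (moment φ f)) (∫ ω, φ ω • stDD f q ω ∂sigma) q := by
  refine (hasFDerivAt_sphere_integral (isOpen_dom hI)
    (continuousOn_weight hφ (continuousOn_stD hI hf))
    (continuousOn_weight hφ (continuousOn_stDD hI hf))
    (fun q hq ω => (hasFDerivAt_stD hI hf hq ω).const_smul (φ ω)) hq).congr_of_eventuallyEq ?_
  filter_upwards [(isOpen_dom hI).mem_nhds hq] with x hx using fderiv_moment hI hf hφ hx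

theorem contDiffOn_moment (hI : IsOpen I) (hf : ContDiffOn ℝ 2 (ext f) (domF I)) {φ : S2 → ℝ}
    (hφ : Continuous φ) : ContDiffOn ℝ 2 (moment φ f) (dom I) := by
  have hU := isOpen_dom hI
  have h1 : ContDiffOn ℝ (0 + 1) (fderiv ℝ (moment φ f)) (dom I) := by
    rw [contDiffOn_succ_iff_fderiv_of_isOpen hU]
    refine ⟨fun q hq =>
      (hasFDerivAt_fderiv_moment hI hf hφ hq).differentiableAt.differentiableWithinAt, by simp, ?_⟩
    rw [contDiffOn_zero]
    refine (continuousOn_sphere_integral hU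
      (continuousOn_weight hφ (continuousOn_stDD hI hf))).congr fun q hq => ?_
    exact (hasFDerivAt_fderiv_moment hI hf hφ hq).fderiv
  have h2 : ContDiffOn ℝ ((0 + 1) + 1) (moment φ f) (dom I) := by
    rw [contDiffOn_succ_iff_fderiv_of_isOpen hU]
    exact ⟨fun q hq => (hasFDerivAt_moment hI hf hφ hq).differentiableAt.differentiableWithinAt,
      by simp, h1⟩
  exact h2.of_le (by norm_num)

/-! ### Convergence of moments and of their derivatives. -/

theorem UnifConv.integral {Y : Type*} [NormedAddCommGroup Y] [NormedSpace ℝ Y]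
    {Fε : ℝ → ST → S2 → Y} {F : ST → S2 → Y} (hI : IsOpen I)
    (h : UnifConv I Fε F) (hFε : ∀ᶠ ε in 𝓝[>] (0 : ℝ), ∀ q ∈ dom I, Continuous (Fε ε q))
    (hF : ∀ q ∈ dom I, Continuous (F q)) {φ : S2 → ℝ} (hφ : Continuous φ) :
    TendstoLocallyUniformlyOn (fun ε q => ∫ ω, φ ω • Fε ε q ω ∂sigma)
      (fun q => ∫ ω, φ ω • F q ω ∂sigma) (𝓝[>] (0 : ℝ)) (dom I) := by
  rw [tendstoLocallyUniformlyOn_iff_forall_isCompact (isOpen_dom hI)]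
  intro K hK hKc
  rw [Metric.tendstoUniformlyOn_iff]
  intro δ hδ
  obtain ⟨C, hC⟩ := isCompact_univ.exists_bound_of_continuousOn hφ.continuousOn
  have hC0 : 0 ≤ C := (norm_nonneg _).trans (hC pole (mem_univ _))
  filter_upwards [h K hK hKc (δ / (2 * (C + 1))) (by positivity), hFε] with ε hε hc q hq
  have c1 : Continuous fun ω => φ ω • F q ω := hφ.smul (hF q (hK hq))
  have c2 : Continuous fun ω => φ ω • Fε ε q ω := hφ.smul (hc q (hK hq))
  rw [dist_comm, dist_eq_norm, ← sphere_integral_sub c2 c1]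
  have := norm_integral_le_of_norm_le_const (μ := sigma)
    (f := fun ω => φ ω • Fε ε q ω - φ ω • F q ω) (C := δ / 2) (.of_forall fun ω => by
      rw [← smul_sub, norm_smul]
      calc ‖φ ω‖ * ‖Fε ε q ω - F q ω‖ ≤ (C + 1) * (δ / (2 * (C + 1))) := by
            gcongr
            · linarith [hC ω (mem_univ _)]
            · exact hε q hq ω
        _ = δ / 2 := by field_simp)
  simp only [probReal_univ, mul_one] at this
  linarith

/-- The family is a solution, hence smooth, only for small `ε`; formulas for derivatives of its
moments are therefore available only eventually. -/
theorem tendstoLocallyUniformlyOn_congr_eventually {X Y : Type*} [TopologicalSpace X] [UniformSpace Y]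
    {U : Set X} {l : Filter ℝ} {F G : ℝ → X → Y} {f g : X → Y}
    (h : TendstoLocallyUniformlyOn F f l U) (hFG : ∀ᶠ ε in l, EqOn (F ε) (G ε) U)
    (hfg : EqOn f g U) : TendstoLocallyUniformlyOn G g l U := by
  refine TendstoLocallyUniformlyOn.congr_right ?_ hfg
  intro u hu x hx
  obtain ⟨t, ht, h'⟩ := h u hu x hx
  refine ⟨t ∩ U, inter_mem ht self_mem_nhdsWithin, ?_⟩
  filter_upwards [h', hFG] with ε h1 h2 y hy
  rw [← h2 hy.2]
  exact h1 y hy.1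

theorem tendsto_moment (hI : IsOpen I)
    (hfε : TendstoCk 2 (domF I) (fun ε => ext (fε ε)) (ext f))
    (hsm : ∀ᶠ ε in 𝓝[>] (0 : ℝ), ContDiffOn ℝ 2 (ext (fε ε)) (domF I))
    (hf : ContDiffOn ℝ 2 (ext f) (domF I)) {φ : S2 → ℝ} (hφ : Continuous φ) :
    TendstoLocallyUniformlyOn (fun ε => moment φ (fε ε)) (moment φ f) (𝓝[>] (0 : ℝ)) (dom I) :=
  (unifConv_field hI hfε).integral hI
    (hsm.mono fun _ h _ hq => continuous_slice (continuousOn_field h) hq)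
    (fun _ hq => continuous_slice (continuousOn_field hf) hq) hφ

theorem tendsto_fderiv_moment (hI : IsOpen I)
    (hfε : TendstoCk 2 (domF I) (fun ε => ext (fε ε)) (ext f))
    (hsm : ∀ᶠ ε in 𝓝[>] (0 : ℝ), ContDiffOn ℝ 2 (ext (fε ε)) (domF I))
    (hf : ContDiffOn ℝ 2 (ext f) (domF I)) {φ : S2 → ℝ} (hφ : Continuous φ) :
    TendstoLocallyUniformlyOn (fun ε => fderiv ℝ (moment φ (fε ε))) (fderiv ℝ (moment φ f))
      (𝓝[>] (0 : ℝ)) (dom I) :=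
  tendstoLocallyUniformlyOn_congr_eventually ((unifConv_stD hI hfε).integral hI
    (hsm.mono fun _ h _ hq => continuous_slice (continuousOn_stD hI h) hq)
    (fun _ hq => continuous_slice (continuousOn_stD hI hf) hq) hφ)
    (hsm.mono fun _ h _ hq => (fderiv_moment hI h hφ hq).symm)
    fun _ hq => (fderiv_moment hI hf hφ hq).symm

theorem tendsto_fderiv_fderiv_moment (hI : IsOpen I)
    (hfε : TendstoCk 2 (domF I) (fun ε => ext (fε ε)) (ext f))
    (hsm : ∀ᶠ ε in 𝓝[>] (0 : ℝ), ContDiffOn ℝ 2 (ext (fε ε)) (domF I))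
    (hf : ContDiffOn ℝ 2 (ext f) (domF I)) {φ : S2 → ℝ} (hφ : Continuous φ) :
    TendstoLocallyUniformlyOn (fun ε => fderiv ℝ (fderiv ℝ (moment φ (fε ε))))
      (fderiv ℝ (fderiv ℝ (moment φ f))) (𝓝[>] (0 : ℝ)) (dom I) :=
  tendstoLocallyUniformlyOn_congr_eventually ((unifConv_stDD hI hfε).integral hI
    (hsm.mono fun _ h _ hq => continuous_slice (continuousOn_stDD hI h) hq)
    (fun _ hq => continuous_slice (continuousOn_stDD hI hf) hq) hφ)
    (hsm.mono fun _ h _ hq => (hasFDerivAt_fderiv_moment hI h hφ hq).fderiv.symm)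
    fun _ hq => (hasFDerivAt_fderiv_moment hI hf hφ hq).fderiv.symm

end Field

/-! ### Slices in time and space -/

section Slices

variable {G : Type*} [NormedAddCommGroup G] [NormedSpace ℝ G] {F : ST → G} {L : ST →L[ℝ] G}
  {t : ℝ} {x : E3}

theorem hasDerivAt_time_slice (h : HasFDerivAt F L (t, x)) :
    HasDerivAt (fun s => F (s, x)) (L (1, 0)) t :=
  h.comp_hasDerivAt t ((hasDerivAt_id t).prodMk (hasDerivAt_const t x))

theorem hasFDerivAt_space_slice (h : HasFDerivAt F L (t, x)) :
    HasFDerivAt (fun y => F (t, y)) (L ∘L ContinuousLinearMap.inr ℝ ℝ E3) x := by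
  have h1 : HasFDerivAt (fun y : E3 => ((t, y) : ST)) (ContinuousLinearMap.inr ℝ ℝ E3) x :=
    (hasFDerivAt_const t x).prodMk (hasFDerivAt_id x)
  exact h.comp x h1

theorem fderiv_space_slice (h : HasFDerivAt F L (t, x)) (w : E3) :
    fderiv ℝ (fun y => F (t, y)) x w = L (0, w) := by
  rw [(hasFDerivAt_space_slice h).fderiv]
  rfl

theorem map_time_space (L : ST →L[ℝ] G) (w : E3) : L (1, w) = L (1, 0) + L (0, w) := by
  rw [← map_add]
  simp

end Slices

/-- The action of a matrix as a continuous linear map. -/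
noncomputable def actL (B : Matrix (Fin 3) (Fin 3) ℝ) : E3 →L[ℝ] E3 :=
  LinearMap.toContinuousLinearMap (Matrix.toEuclideanLin B)

theorem actL_apply (B : Matrix (Fin 3) (Fin 3) ℝ) (w : E3) : actL B w = act B w := rfl

section Weak

variable {I : Set ℝ} {f : ℝ → E3 → S2 → ℝ}

theorem sphSmooth_slice (hf : ContDiffOn ℝ 2 (ext f) (domF I)) {q : ST} (hq : q ∈ dom I) :
    SphSmooth 2 (f q.1 q.2) := by
  have h1 : ContDiffOn ℝ 2 (fun y : E3 => ext f (q.1, q.2, y)) {0}ᶜ := by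
    refine hf.comp (f := fun y : E3 => ((q.1, q.2, y) : ℝ × E3 × E3)) ?_ fun y hy => ?_
    · exact (contDiff_const.prodMk (contDiff_const.prodMk contDiff_id)).contDiffOn
    · exact ⟨hq.1, mem_univ _, hy⟩
  exact h1

theorem continuous_stD_apply (hI : IsOpen I) (hf : ContDiffOn ℝ 2 (ext f) (domF I)) {q : ST}
    (hq : q ∈ dom I) {w : S2 → ST} (hw : Continuous w) : Continuous fun ω => stD f q ω (w ω) :=
  (continuous_slice (continuousOn_stD hI hf) hq).clm_apply hw

theorem continuous_sphLap {φ : S2 → ℝ} (h : SphSmooth 2 φ) : Continuous (sphLap φ) := by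
  rw [funext fun ω => sphLap_eq_sphDiv h ω]
  exact h.sphGrad.continuous_sphDiv

/-- The kinetic equation tested with a smooth function of the orientation. -/
theorem IsScaledSolution.weak {P : Params} {ε : ℝ} {v : ℝ → E3 → E3} {p : ℝ → E3 → ℝ}
    (hI : IsOpen I) (h : IsScaledSolution P ε I f v p) {q : ST} (hq : q ∈ dom I) {ψ : S2 → ℝ}
    (hψ : SphSmooth 2 ψ) :
    ε * ∫ ω, ψ ω * stD f q ω (1, v q.1 q.2 + P.a • (ω : E3)) ∂sigma
      - ∫ ω, f q.1 q.2 ω * inner ℝ (sphGrad ψ ω)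
        (P.nu • nonlocalOrientation P ε (f q.1) q.2
          + ε • act (P.lam • symV (v q.1) q.2 + antiV (v q.1) q.2) (ω : E3)) ∂sigma
      = P.D * ∫ ω, f q.1 q.2 ω * sphLap ψ ω ∂sigma := by
  obtain ⟨t, x⟩ := q
  set B := P.lam • symV (v t) x + antiV (v t) x with hB
  set c := P.nu • nonlocalOrientation P ε (f t) x with hc
  have hf := h.smooth_f
  have hφ : SphSmooth 2 (f t x) := sphSmooth_slice hf hq
  have hE : SphSmooth 1 fun ω : S2 => c + ε • act B (ω : E3) :=
    (sphSmooth_const c).add ((sphSmooth_const ε).smul (SphSmooth.clm (actL B) sphSmooth_coe))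
  have hF : SphSmooth 1 fun ω : S2 => f t x ω • proj ω (c + ε • act B (ω : E3)) :=
    (hφ.of_le (by norm_num)).smul hE.proj
  have hv : DifferentiableAt ℝ (v t) x :=
    (hasFDerivAt_space_slice (((h.smooth_v.differentiableOn (by norm_num)).differentiableAt
      ((isOpen_dom hI).mem_nhds hq)).hasFDerivAt)).differentiableAt
  have key : ∀ ω, ψ ω * (ε * stD f (t, x) ω (1, v t x + P.a • (ω : E3)))
      + ψ ω * sphDiv (fun ω : S2 => f t x ω • proj ω (c + ε • act B (ω : E3))) ω
      = P.D * (ψ ω * sphLap (f t x) ω) := by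
    intro ω
    have hd := hasFDerivAt_field hI hf hq ω
    have hk := h.kinetic t hq.1 x ω
    rw [(hasDerivAt_time_slice hd).deriv, divg_smul (hasFDerivAt_space_slice hd).differentiableAt
      (hv.add_const _), fderiv_space_slice hd] at hk
    -- Since `v + aω` is divergence free in `x`, the transport term is the directional derivative of
    -- `f` along `(1, v + aω)`.
    have h0 : divg (fun y => v t y + P.a • (ω : E3)) x = 0 := by
      rw [divg, fderiv_add_const]
      exact h.incompressible t hq.1 x
    rw [h0, mul_zero, zero_add, ← map_time_space] at hk
    linear_combination ψ ω * hk
  have hψc := hψ.continuous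
  have c1 : Continuous fun ω => ψ ω * (ε * stD f (t, x) ω (1, v t x + P.a • (ω : E3))) :=
    hψc.mul (continuous_const.mul (continuous_stD_apply hI hf hq (by fun_prop)))
  have c2 : Continuous fun ω =>
      ψ ω * sphDiv (fun ω : S2 => f t x ω • proj ω (c + ε • act B (ω : E3))) ω :=
    hψc.mul hF.continuous_sphDiv
  have h1 := integral_congr_ae (μ := sigma) (.of_forall key)
  rw [sphere_integral_add c1 c2, integral_const_mul, integral_mul_sphLap_comm hψ hφ,
    integral_mul_sphDiv (hψ.of_le (by norm_num)) hF
      (fun ω => by rw [real_inner_smul_right, proj_inner_self, mul_zero])] at h1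
  simp only [mul_left_comm _ ε, integral_const_mul] at h1
  rw [← h1, sub_eq_add_neg]
  refine congrArg _ (congrArg _ (integral_congr_ae (.of_forall fun ω => ?_)))
  simp only [real_inner_smul_right, inner_proj_of_tangent (sphGrad_tangent ψ ω)]

end Weak

/-! ### Averages against a concentrating radial kernel -/

/-- The divergence of `P_{ω^⊥} Aω` is `tr A - 3 ω·Aω` and integrates to zero. -/
theorem integral_quadratic (A : E3 →L[ℝ] E3 →L[ℝ] ℝ) :
    ∫ ω : S2, A ω ω ∂sigma = (∑ i, A (e i) (e i)) / 3 := by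
  set A' : E3 →L[ℝ] E3 :=
    (InnerProductSpace.toDual ℝ E3).symm.toContinuousLinearEquiv.toContinuousLinearMap ∘L A with hA'
  have hA : ∀ u w : E3, inner ℝ (A' u) w = A u w := fun u w => by simp [hA']
  have hsm : SphSmooth 1 fun ω : S2 => proj ω (A' ω) := (SphSmooth.clm A' sphSmooth_coe).proj
  have h := integral_sphDiv (F := fun ω : S2 => proj ω (A' ω)) hsm fun ω => proj_inner_self ω _
  simp only [sphDiv_proj_clm] at h
  have hc : Continuous fun ω : S2 => 3 * A ω ω := by fun_prop
  have e1 : ∀ ω : S2, ∑ i, A' (e i) i - 3 * inner ℝ (ω : E3) (A' ω) =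
      ∑ i, A (e i) (e i) - 3 * A ω ω := fun ω => by
    rw [real_inner_comm, hA]
    congr 1
    exact Finset.sum_congr rfl fun i _ => by rw [← inner_e, hA]
  simp only [e1] at h
  rw [sphere_integral_sub continuous_const hc, integral_const_mul] at h
  simp only [integral_const, probReal_univ, one_smul] at h
  linarith

theorem integral_radial_quadratic (K : ℝ → ℝ) (A : E3 →L[ℝ] E3 →L[ℝ] ℝ) :
    ∫ z : E3, K ‖z‖ * A z z = (∫ z : E3, K ‖z‖ * ‖z‖ ^ 2) * ((∑ i, A (e i) (e i)) / 3) := by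
  obtain ⟨c, -, hc⟩ := exists_integral_eq_sigma
  have e1 : ∀ z : E3, K ‖z‖ * A z z =
      (fun r => K r * r ^ 2) ‖z‖ * (fun ω : S2 => A ω ω) (dir z) := by
    intro z
    by_cases hz : z = 0
    · simp [hz]
    · have : ‖z‖ ≠ 0 := norm_ne_zero_iff.2 hz
      simp only [coe_dir hz, map_smul, smul_apply, smul_eq_mul]
      field_simp
  have e2 : ∀ z : E3, K ‖z‖ * ‖z‖ ^ 2 =
      (fun r => K r * r ^ 2) ‖z‖ * (fun _ : S2 => (1 : ℝ)) (dir z) := by simp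
  rw [integral_congr_ae (.of_forall e1), integral_congr_ae (.of_forall e2),
    integral_radial_mul_dir (fun r => K r * r ^ 2) (fun ω : S2 => A ω ω),
    integral_radial_mul_dir (fun r => K r * r ^ 2) (fun _ => 1), hc, hc, integral_quadratic]
  simp
  ring

/-- Second order Taylor estimate along a segment. -/
theorem taylor_two {g : E3 → ℝ} {g' : E3 → E3 →L[ℝ] ℝ} {g'' : E3 → E3 →L[ℝ] E3 →L[ℝ] ℝ}
    (hd : ∀ y, HasFDerivAt g (g' y) y) (hd2 : ∀ y, HasFDerivAt g' (g'' y) y)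
    {x : E3} {η δ : ℝ} {A : E3 →L[ℝ] E3 →L[ℝ] ℝ}
    (hA : ∀ y ∈ Metric.ball x η, ‖g'' y - A‖ ≤ δ) {h : E3} (hh : ‖h‖ < η) :
    |g (x + h) - g x - g' x h - A h h / 2| ≤ δ * ‖h‖ ^ 2 := by
  have hδ : 0 ≤ δ := le_trans (norm_nonneg (g'' x - A))
    (hA x (Metric.mem_ball_self ((norm_nonneg h).trans_lt hh)))
  have hline : ∀ s : ℝ, HasDerivAt (fun s : ℝ => x + s • h) h s := fun s => by
    simpa using ((hasDerivAt_id s).smul_const h).const_add x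
  -- The mean value inequality is used once for the derivative along the segment and once for the
  -- function; this loses a factor `1/2` in the constant, which is harmless.
  have h1 : ∀ s : ℝ, HasDerivAt (fun s => g' (x + s • h) h - g' x h - s * A h h)
      (g'' (x + s • h) h h - A h h) s := by
    intro s
    have a1 : HasDerivAt (fun s : ℝ => g' (x + s • h)) (g'' (x + s • h) h) s :=
      (hd2 (x + s • h)).comp_hasDerivAt s (hline s)
    have a2 : HasDerivAt (fun s : ℝ => g' (x + s • h) h) (g'' (x + s • h) h h) s :=
      (ContinuousLinearMap.apply ℝ ℝ h).hasFDerivAt.comp_hasDerivAt s a1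
    refine ((a2.sub_const (g' x h)).sub ((hasDerivAt_id s).mul_const (A h h))).congr_deriv ?_
    rw [one_mul]
  have h2 : ∀ s : ℝ, HasDerivAt (fun s => g (x + s • h) - s * g' x h - s ^ 2 / 2 * A h h)
      (g' (x + s • h) h - g' x h - s * A h h) s := by
    intro s
    have a1 : HasDerivAt (fun s : ℝ => g (x + s • h)) (g' (x + s • h) h) s :=
      (hd (x + s • h)).comp_hasDerivAt s (hline s)
    refine ((a1.sub ((hasDerivAt_id s).mul_const (g' x h))).sub
      (((hasDerivAt_pow 2 s).div_const 2).mul_const (A h h))).congr_deriv ?_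
    simp
  have hball : ∀ s ∈ Icc (0 : ℝ) 1, x + s • h ∈ Metric.ball x η := by
    intro s hs
    rw [mem_ball_iff_norm, add_sub_cancel_left, norm_smul, Real.norm_eq_abs, abs_of_nonneg hs.1]
    nlinarith [norm_nonneg h, hs.2]
  have b1 : ∀ s ∈ Icc (0 : ℝ) 1, ‖g'' (x + s • h) h h - A h h‖ ≤ δ * ‖h‖ ^ 2 := by
    intro s hs
    calc ‖g'' (x + s • h) h h - A h h‖ = ‖(g'' (x + s • h) - A) h h‖ := by simp
      _ ≤ ‖g'' (x + s • h) - A‖ * ‖h‖ * ‖h‖ := (g'' (x + s • h) - A).le_opNorm₂ _ _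
      _ ≤ δ * ‖h‖ * ‖h‖ := by gcongr; exact hA _ (hball s hs)
      _ = δ * ‖h‖ ^ 2 := by ring
  have b2 : ∀ s ∈ Icc (0 : ℝ) 1, ‖g' (x + s • h) h - g' x h - s * A h h‖ ≤ δ * ‖h‖ ^ 2 := by
    intro s hs
    have := (convex_Icc (0 : ℝ) 1).norm_image_sub_le_of_norm_hasDerivWithin_le
      (fun s _ => (h1 s).hasDerivWithinAt) b1 (left_mem_Icc.2 zero_le_one) hs
    simp only [zero_smul, add_zero, sub_self, zero_mul, sub_zero, Real.norm_eq_abs s,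
      abs_of_nonneg hs.1] at this
    refine this.trans (mul_le_of_le_one_right (by positivity) hs.2)
  have := (convex_Icc (0 : ℝ) 1).norm_image_sub_le_of_norm_hasDerivWithin_le
      (fun s _ => (h2 s).hasDerivWithinAt) b2 (left_mem_Icc.2 zero_le_one)
      (right_mem_Icc.2 zero_le_one)
  simp only [one_smul, zero_smul, add_zero, sub_zero, norm_one, mul_one, one_mul, one_pow, zero_mul,
    ne_eq, OfNat.ofNat_ne_zero, not_false_eq_true, zero_pow, zero_div] at this
  rw [Real.norm_eq_abs] at this
  convert this using 2
  ring

theorem integral_scaled_kernel (k : ℝ → ℝ) (g : E3 → ℝ) (x : E3) {r : ℝ} (hr : 0 < r) :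
    (r ^ 3)⁻¹ * ∫ y : E3, k (‖x - y‖ / r) * g y = ∫ z : E3, k ‖z‖ * g (x - r • z) := by
  have h1 := integral_sub_left_eq_self (fun y : E3 => k (‖x - y‖ / r) * g y) volume x
  simp only [sub_sub_cancel] at h1
  have h2 := Measure.integral_comp_smul (volume : Measure E3)
    (fun y : E3 => k (‖y‖ / r) * g (x - y)) r
  have hdim : Module.finrank ℝ E3 = 3 := by simp
  rw [hdim, abs_of_pos (by positivity), smul_eq_mul, h1] at h2
  rw [← h2]
  refine integral_congr_ae (.of_forall fun z => ?_)
  simp only [norm_smul, Real.norm_eq_abs, abs_of_pos hr]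
  rw [mul_div_cancel_left₀ _ hr.ne']

theorem integral_radial_linear (K : ℝ → ℝ) (L : E3 →L[ℝ] ℝ) : ∫ z : E3, K ‖z‖ * L z = 0 := by
  have h := integral_neg_eq_self (fun z : E3 => K ‖z‖ * L z) volume
  simp only [norm_neg, map_neg, mul_neg, integral_neg] at h
  linarith

theorem integrable_radial_linear {K : ℝ → ℝ} (hK0 : Integrable fun z : E3 => K ‖z‖)
    (hK2 : Integrable fun z : E3 => K ‖z‖ * ‖z‖ ^ 2) (L : E3 →L[ℝ] ℝ) :
    Integrable fun z : E3 => K ‖z‖ * L z := by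
  refine ((hK0.norm.add hK2.norm).const_mul ‖L‖).mono'
    (hK0.aestronglyMeasurable.mul L.continuous.aestronglyMeasurable) (.of_forall fun z => ?_)
  have h1 := L.le_opNorm z
  have h2 : ‖z‖ ≤ 1 + ‖z‖ ^ 2 := by nlinarith [sq_nonneg (‖z‖ - 1), norm_nonneg z]
  calc ‖K ‖z‖ * L z‖ = ‖K ‖z‖‖ * ‖L z‖ := norm_mul _ _
    _ ≤ ‖K ‖z‖‖ * (‖L‖ * (1 + ‖z‖ ^ 2)) := by gcongr; exact h1.trans (by gcongr)
    _ = _ := by simp; ring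

theorem integrable_kernel_mul_bounded {K : ℝ → ℝ} (hK0 : Integrable fun z : E3 => K ‖z‖) {g : E3 → ℝ}
    (hg : Continuous g) {C : ℝ} (hC : ∀ y, |g y| ≤ C) : Integrable fun z : E3 => K ‖z‖ * g z :=
  hK0.mul_bdd hg.aestronglyMeasurable (.of_forall hC)

/-- After rescaling, the zeroth order term is subtracted, the first order term vanishes by oddness,
and the second order term converges by dominated convergence to the average of `A z z / 2`, hence
the factor `1/6` by isotropy. Control of the Hessian near `x`, uniform in `ε`, is needed because the
averaged functions themselves vary. -/
theorem tendsto_radial_average {l : Filter ℝ} [l.IsCountablyGenerated] {K : ℝ → ℝ}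
    (hK0 : Integrable fun z : E3 => K ‖z‖) (hK2 : Integrable fun z : E3 => K ‖z‖ * ‖z‖ ^ 2)
    {r : ℝ → ℝ} (hr : ∀ᶠ ε in l, 0 < r ε) (hr0 : Tendsto r l (𝓝 0))
    {g : ℝ → E3 → ℝ} {g' : ℝ → E3 → E3 →L[ℝ] ℝ} {g'' : ℝ → E3 → E3 →L[ℝ] E3 →L[ℝ] ℝ}
    (hd : ∀ᶠ ε in l, ∀ y, HasFDerivAt (g ε) (g' ε y) y)
    (hd2 : ∀ᶠ ε in l, ∀ y, HasFDerivAt (g' ε) (g'' ε y) y)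
    {x : E3} {A : E3 →L[ℝ] E3 →L[ℝ] ℝ}
    (hA : ∀ δ > 0, ∃ η > 0, ∀ᶠ ε in l, ∀ y ∈ Metric.ball x η, ‖g'' ε y - A‖ ≤ δ)
    {C : ℝ} (hC : ∀ᶠ ε in l, ∀ y, |g ε y| ≤ C) (hC' : ∀ᶠ ε in l, ‖g' ε x‖ ≤ C) :
    Tendsto (fun ε => (r ε ^ 2)⁻¹ * ((r ε ^ 3)⁻¹ * (∫ y : E3, K (‖x - y‖ / r ε) * g ε y)
      - (∫ z : E3, K ‖z‖) * g ε x)) l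
      (𝓝 ((∫ z : E3, K ‖z‖ * ‖z‖ ^ 2) / 6 * ∑ i, A (e i) (e i))) := by
  have hlim : (∫ z : E3, K ‖z‖ * ‖z‖ ^ 2) / 6 * ∑ i, A (e i) (e i) =
      ∫ z : E3, K ‖z‖ * (A z z / 2) := by
    have := integral_radial_quadratic K A
    simp only [← mul_div_assoc, integral_div, this]
    ring
  rw [hlim]
  -- The linear Taylor term is inserted at no cost: it is odd, so its integral against the radial
  -- kernel is zero.
  have heq : (fun ε => ∫ z : E3, K ‖z‖ *
        ((r ε ^ 2)⁻¹ * (g ε (x - r ε • z) - g ε x + g' ε x (r ε • z)))) =ᶠ[l]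
      fun ε => (r ε ^ 2)⁻¹ * ((r ε ^ 3)⁻¹ * (∫ y : E3, K (‖x - y‖ / r ε) * g ε y)
      - (∫ z : E3, K ‖z‖) * g ε x) := by
    filter_upwards [hr, hd, hC] with ε h1 h2 h3
    have hcg : Continuous (g ε) := continuous_iff_continuousAt.2 fun y => (h2 y).continuousAt
    rw [integral_scaled_kernel K (g ε) x h1]
    have i1 : Integrable fun z : E3 => K ‖z‖ * g ε (x - r ε • z) :=
      integrable_kernel_mul_bounded hK0 (by fun_prop) fun z => h3 _
    have i2 : Integrable fun z : E3 => K ‖z‖ * g ε x := hK0.mul_const _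
    have i12 : Integrable fun z : E3 => K ‖z‖ * g ε (x - r ε • z) - K ‖z‖ * g ε x := i1.sub i2
    have i3 := integrable_radial_linear hK0 hK2 (g' ε x)
    have e1 : ∀ z : E3, K ‖z‖ * ((r ε ^ 2)⁻¹ * (g ε (x - r ε • z) - g ε x + g' ε x (r ε • z))) =
        (r ε ^ 2)⁻¹ * (K ‖z‖ * g ε (x - r ε • z) - K ‖z‖ * g ε x + r ε * (K ‖z‖ * g' ε x z)) := by
      intro z
      simp only [map_smul, smul_eq_mul]
      ring
    simp only [e1]
    rw [integral_const_mul, integral_add i12 (i3.const_mul _), integral_sub i1 i2,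
      integral_const_mul, integral_radial_linear, integral_mul_const]
    ring
  refine Tendsto.congr' heq ?_
  obtain ⟨η, hη, hη'⟩ := hA 1 one_pos
  -- `‖A‖ + 1` bounds the quotient where `r‖z‖ < η`, by Taylor. Elsewhere `r‖z‖/η ≥ 1`, so the
  -- constant bound `2|C|` and the linear bound `|C| r‖z‖` are both dominated by quadratic ones.
  refine tendsto_integral_filter_of_dominated_convergence
    (fun z => (‖A‖ + 1 + 2 * |C| / η ^ 2 + |C| / η) * ‖K ‖z‖ * ‖z‖ ^ 2‖) ?_ ?_
    (hK2.norm.const_mul _) ?_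
  · filter_upwards [hd] with ε h2
    have hcg : Continuous (g ε) := continuous_iff_continuousAt.2 fun y => (h2 y).continuousAt
    refine hK0.aestronglyMeasurable.mul (Continuous.aestronglyMeasurable ?_)
    fun_prop
  · filter_upwards [hr, hd, hd2, hC, hC', hη'] with ε h1 h2 h3 h4 h5 h6
    refine .of_forall fun z => ?_
    rw [norm_mul, norm_mul (K ‖z‖) (‖z‖ ^ 2), norm_pow, norm_norm, mul_left_comm]
    gcongr
    rw [norm_mul, norm_inv, norm_pow, Real.norm_eq_abs, abs_of_pos h1, inv_mul_le_iff₀ (by positivity)]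
    have hrz : ‖-(r ε • z)‖ = r ε * ‖z‖ := by
      rw [norm_neg, norm_smul, Real.norm_eq_abs, abs_of_pos h1]
    have hp1 : 0 ≤ 2 * |C| / η ^ 2 := by positivity
    have hp2 : 0 ≤ |C| / η := by positivity
    have hAn := norm_nonneg A
    by_cases hz : ‖-(r ε • z)‖ < η
    · have t := taylor_two h2 h3 h6 hz
      have a1 : |A (-(r ε • z)) (-(r ε • z))| ≤ ‖A‖ * (r ε * ‖z‖) * (r ε * ‖z‖) := by
        rw [← hrz]; exact A.le_opNorm₂ _ _
      rw [hrz, ← sub_eq_add_neg] at t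
      have hX : g ε (x - r ε • z) - g ε x + g' ε x (r ε • z) =
          (g ε (x - r ε • z) - g ε x - g' ε x (-(r ε • z)) - A (-(r ε • z)) (-(r ε • z)) / 2)
            + A (-(r ε • z)) (-(r ε • z)) / 2 := by simp
      rw [hX, Real.norm_eq_abs]
      refine (abs_add_le _ _).trans ?_
      rw [abs_div, abs_two]
      have hs : 0 ≤ (r ε * ‖z‖) ^ 2 := by positivity
      nlinarith [mul_nonneg hp1 hs, mul_nonneg hp2 hs, mul_nonneg hAn hs]
    · rw [hrz, not_lt] at hz
      have hCn : C ≤ |C| := le_abs_self C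
      have b1 : |g' ε x (r ε • z)| ≤ |C| * (r ε * ‖z‖) := by
        have := (g' ε x).le_opNorm (-(r ε • z))
        rw [hrz, map_neg, norm_neg] at this
        exact this.trans (by gcongr; exact h5.trans hCn)
      have b2 : ‖g ε (x - r ε • z) - g ε x + g' ε x (r ε • z)‖ ≤ 2 * |C| + |C| * (r ε * ‖z‖) := by
        have := (abs_add_le (g ε (x - r ε • z) - g ε x) (g' ε x (r ε • z)))
        have h' := abs_sub (g ε (x - r ε • z)) (g ε x)
        rw [Real.norm_eq_abs]
        linarith [h4 (x - r ε • z), h4 x]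
      refine b2.trans ?_
      have hs : 1 ≤ r ε * ‖z‖ / η := (one_le_div hη).2 hz
      have hs2 : 1 ≤ (r ε * ‖z‖ / η) ^ 2 := one_le_pow₀ hs
      have e1 : r ε ^ 2 * ((‖A‖ + 1 + 2 * |C| / η ^ 2 + |C| / η) * ‖z‖ ^ 2) =
        (‖A‖ + 1) * (r ε * ‖z‖) ^ 2 + 2 * |C| * (r ε * ‖z‖ / η) ^ 2
          + |C| * (r ε * ‖z‖) * (r ε * ‖z‖ / η) := by
        field_simp
      rw [e1]
      have q1 : 0 ≤ (‖A‖ + 1) * (r ε * ‖z‖) ^ 2 := by positivity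
      have q2 : 2 * |C| ≤ 2 * |C| * (r ε * ‖z‖ / η) ^ 2 := le_mul_of_one_le_right (by positivity) hs2
      have q3 : |C| * (r ε * ‖z‖) ≤ |C| * (r ε * ‖z‖) * (r ε * ‖z‖ / η) :=
        le_mul_of_one_le_right (by positivity) hs
      linarith
  · refine .of_forall fun z => Tendsto.const_mul _ ?_
    rw [Metric.tendsto_nhds]
    intro δ hδ
    have hz1 : 0 < ‖z‖ ^ 2 + 1 := by positivity
    -- For fixed `z` the increment `r z` eventually enters the ball where the Hessian is close to
    -- `A`; the tolerance is scaled so that the Taylor error stays below `δ r²`.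
    obtain ⟨η', hη'0, hη''⟩ := hA (δ / (‖z‖ ^ 2 + 1)) (by positivity)
    have hsm : ∀ᶠ ε in l, ‖-(r ε • z)‖ < η' := by
      have : Tendsto (fun ε => ‖-(r ε • z)‖) l (𝓝 ‖-((0 : ℝ) • z)‖) := ((hr0.smul_const z).neg).norm
      rw [zero_smul, neg_zero, norm_zero] at this
      exact this.eventually (gt_mem_nhds hη'0)
    filter_upwards [hr, hd, hd2, hη'', hsm] with ε h1 h2 h3 h6 hz
    have t := taylor_two h2 h3 h6 hz
    have hrz : ‖-(r ε • z)‖ = r ε * ‖z‖ := by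
      rw [norm_neg, norm_smul, Real.norm_eq_abs, abs_of_pos h1]
    rw [hrz, ← sub_eq_add_neg] at t
    have hX : (r ε ^ 2)⁻¹ * (g ε (x - r ε • z) - g ε x + g' ε x (r ε • z)) - A z z / 2 =
        (r ε ^ 2)⁻¹ * (g ε (x - r ε • z) - g ε x - g' ε x (-(r ε • z))
          - A (-(r ε • z)) (-(r ε • z)) / 2) := by
      simp only [map_neg, map_smul, neg_apply, smul_apply,
        smul_eq_mul]
      field_simp
      ring
    rw [Real.dist_eq, hX, abs_mul, abs_inv, abs_of_pos (by positivity : 0 < r ε ^ 2),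
      inv_mul_lt_iff₀ (by positivity)]
    refine t.trans_lt ?_
    have : δ / (‖z‖ ^ 2 + 1) * (r ε * ‖z‖) ^ 2 = r ε ^ 2 * (δ * (‖z‖ ^ 2 / (‖z‖ ^ 2 + 1))) := by
      field_simp
    rw [this]
    gcongr
    exact mul_lt_of_lt_one_right hδ ((div_lt_one hz1).2 (by linarith))

/-! ### The nonlocal flux at small range -/

theorem eventually_dist_lt_of_tendstoLocallyUniformlyOn {X Y : Type*} [PseudoMetricSpace X]
    [PseudoMetricSpace Y] {U : Set X} {l : Filter ℝ} {F : ℝ → X → Y} {f : X → Y}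
    (h : TendstoLocallyUniformlyOn F f l U) (hU : IsOpen U) {q : X} (hq : q ∈ U)
    (hc : ContinuousAt f q) {δ : ℝ} (hδ : 0 < δ) :
    ∃ η > 0, ∀ᶠ ε in l, ∀ y ∈ Metric.ball q η, dist (F ε y) (f q) < δ := by
  rw [Metric.tendstoLocallyUniformlyOn_iff] at h
  obtain ⟨t, ht, h'⟩ := h (δ / 2) (by positivity) q hq
  rw [hU.nhdsWithin_eq hq] at ht
  have hc' := hc.eventually (Metric.ball_mem_nhds (f q) (half_pos hδ))
  obtain ⟨η, hη, hball⟩ := Metric.mem_nhds_iff.1 (inter_mem ht hc')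
  refine ⟨η, hη, h'.mono fun ε h1 y hy => ?_⟩
  have h2 := hball hy
  have h3 := h1 y h2.1
  have h4 : dist (f y) (f q) < δ / 2 := h2.2
  calc dist (F ε y) (f q) ≤ dist (F ε y) (f y) + dist (f y) (f q) := dist_triangle _ _ _
    _ < δ := by rw [dist_comm] at h3; linarith

theorem eventually_norm_clm_sub_le {X Y Z : Type*} [PseudoMetricSpace X] [NormedAddCommGroup Y]
    [NormedSpace ℝ Y] [NormedAddCommGroup Z] [NormedSpace ℝ Z] {U : Set X} {l : Filter ℝ}
    {F : ℝ → X → Y} {f : X → Y} (h : TendstoLocallyUniformlyOn F f l U) (hU : IsOpen U) {q : X}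
    (hq : q ∈ U) (hc : ContinuousAt f q) (A : Y →L[ℝ] Z) {δ : ℝ} (hδ : 0 < δ) :
    ∃ η > 0, ∀ᶠ ε in l, ∀ y ∈ Metric.ball q η, ‖A (F ε y) - A (f q)‖ ≤ δ := by
  obtain ⟨η, hη, h⟩ := eventually_dist_lt_of_tendstoLocallyUniformlyOn
    (A.uniformContinuous.comp_tendstoLocallyUniformlyOn h) hU hq
    (A.continuous.continuousAt.comp hc) hδ
  refine ⟨η, hη, h.mono fun ε h1 y hy => ?_⟩
  have := h1 y hy
  rw [dist_eq_norm] at this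
  exact this.le

/-- Restriction of linear forms on space-time to space directions. -/
noncomputable def spRestr₁ {G : Type*} [NormedAddCommGroup G] [NormedSpace ℝ G] :
    (ST →L[ℝ] G) →L[ℝ] (E3 →L[ℝ] G) :=
  (ContinuousLinearMap.compL ℝ E3 ST G).flip (ContinuousLinearMap.inr ℝ ℝ E3)

theorem spRestr₁_apply {G : Type*} [NormedAddCommGroup G] [NormedSpace ℝ G] (L : ST →L[ℝ] G)
    (w : E3) : spRestr₁ L w = L (0, w) := rfl

/-- Restriction of bilinear forms on space-time to space directions. -/
noncomputable def spRestr₂ {G : Type*} [NormedAddCommGroup G] [NormedSpace ℝ G] :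
    (ST →L[ℝ] ST →L[ℝ] G) →L[ℝ] (E3 →L[ℝ] E3 →L[ℝ] G) :=
  ContinuousLinearMap.comp
    (ContinuousLinearMap.compL ℝ E3 (ST →L[ℝ] G) (E3 →L[ℝ] G) spRestr₁)
    (spRestr₁ (G := ST →L[ℝ] G))

theorem hasFDerivAt_fderiv_space_slice {G : Type*} [NormedAddCommGroup G] [NormedSpace ℝ G]
    {F : ST → G} {T : ST →L[ℝ] ST →L[ℝ] G} {t : ℝ} {x : E3}
    (h : HasFDerivAt (fderiv ℝ F) T (t, x)) :
    HasFDerivAt (fun y => spRestr₁ (fderiv ℝ F (t, y))) (spRestr₂ T) x :=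
  (spRestr₁ (G := G)).hasFDerivAt.comp x (hasFDerivAt_space_slice h)

theorem lapl_space_slice {G : Type*} [NormedAddCommGroup G] [NormedSpace ℝ G] {F : ST → G}
    {I : Set ℝ} (hI : IsOpen I) (hF : ContDiffOn ℝ 2 F (dom I)) {t : ℝ} (ht : t ∈ I) (x : E3) :
    lapl (fun y => F (t, y)) x = ∑ i, fderiv ℝ (fderiv ℝ F) (t, x) (0, e i) (0, e i) := by
  have h1 : fderiv ℝ (fun y => F (t, y)) = fun y => spRestr₁ (fderiv ℝ F (t, y)) := by
    funext y
    exact (hasFDerivAt_space_slice (((hF.differentiableOn (by norm_num)).differentiableAt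
      ((isOpen_dom hI).mem_nhds (mem_dom ht y))).hasFDerivAt)).fderiv
  have h0 : ContDiffOn ℝ 1 (fderiv ℝ F) (dom I) := hF.fderiv_of_isOpen (isOpen_dom hI) (by norm_num)
  have h2 : HasFDerivAt (fderiv ℝ F) (fderiv ℝ (fderiv ℝ F) (t, x)) (t, x) :=
    ((h0.differentiableOn (by norm_num)).differentiableAt
      ((isOpen_dom hI).mem_nhds (mem_dom ht x))).hasFDerivAt
  rw [lapl_eq_sum, h1, (hasFDerivAt_fderiv_space_slice h2).fderiv]
  rfl

theorem flux_apply {F : S2 → ℝ} (hF : Continuous F) (i : Fin 3) :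
    flux F i = ∫ ω : S2, (ω : E3) i * F ω ∂sigma := by
  have hi : Integrable (fun ω : S2 => F ω • (ω : E3)) sigma :=
    continuous_integrable (hF.smul continuous_subtype_val)
  have := (EuclideanSpace.proj (𝕜 := ℝ) i).integral_comp_comm hi
  rw [flux]
  change EuclideanSpace.proj (𝕜 := ℝ) i _ = _
  rw [← this]
  refine integral_congr_ae (.of_forall fun ω => ?_)
  simp [mul_comm]

theorem continuous_coord (i : Fin 3) : Continuous fun ω : S2 => (ω : E3) i :=
  (EuclideanSpace.proj (𝕜 := ℝ) i).continuous.comp continuous_subtype_val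

theorem abs_coord_le_one (ω : S2) (i : Fin 3) : |(ω : E3) i| ≤ 1 := by
  have := PiLp.norm_apply_le (ω : E3) i
  rwa [S2.norm_eq, Real.norm_eq_abs] at this

theorem density_eq_moment (f : ℝ → E3 → S2 → ℝ) (q : ST) :
    density (f q.1 q.2) = moment (fun _ => 1) f q := by
  simp [density, moment]

section

variable {I : Set ℝ} {f : ℝ → E3 → S2 → ℝ}

theorem flux_eq_moment (hf : ContDiffOn ℝ 2 (ext f) (domF I)) {q : ST} (hq : q ∈ dom I)
    (i : Fin 3) : flux (f q.1 q.2) i = moment (fun ω => (ω : E3) i) f q :=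
  flux_apply (continuous_slice (continuousOn_field hf) hq) i

theorem abs_moment_coord_le {t : ℝ} {y : E3} {C : ℝ} (h0 : ∀ ω, 0 ≤ f t y ω)
    (hC : ∀ ω, f t y ω ≤ C) (i : Fin 3) : |moment (fun ω => (ω : E3) i) f (t, y)| ≤ C := by
  have := norm_integral_le_of_norm_le_const (μ := sigma) (C := C)
    (f := fun ω : S2 => (ω : E3) i * f t y ω) (.of_forall fun ω => by
      rw [norm_mul, Real.norm_eq_abs, Real.norm_eq_abs, abs_of_nonneg (h0 ω)]
      have := mul_le_mul_of_nonneg_right (abs_coord_le_one ω i) (h0 ω)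
      linarith [hC ω])
  simpa [moment] using this

/-- The integrable kernel and the global bound on `f` make the vector-valued integrand integrable,
which allows coordinates to be taken under the integral. -/
theorem nonlocalFlux_apply {P : Params} (hR : 0 < P.R) (hK0 : Integrable fun z : E3 => P.K ‖z‖)
    {ε : ℝ} (hε : 0 < ε) (hI : IsOpen I) (hf : ContDiffOn ℝ 2 (ext f) (domF I)) {t : ℝ} (ht : t ∈ I)
    {C : ℝ} (h0 : ∀ y ω, 0 ≤ f t y ω) (hC : ∀ y ω, f t y ω ≤ C) (x : E3) (i : Fin 3) :
    nonlocalFlux P ε (f t) x i = ∫ y : E3, P.K (‖x - y‖ / (Real.sqrt ε * P.R)) *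
      moment (fun ω => (ω : E3) i) f (t, y) := by
  set r := Real.sqrt ε * P.R with hr
  have hr0 : 0 < r := mul_pos (Real.sqrt_pos.2 hε) hR
  have e1 : ∀ y, ∫ ω : S2, (P.K (‖x - y‖ / r) * f t y ω) • (ω : E3) ∂sigma =
      P.K (‖x - y‖ / r) • flux (f t y) := fun y => by
    simp only [mul_smul, integral_smul, flux]
  have hKi : Integrable fun y : E3 => P.K (‖x - y‖ / r) := by
    have h1 : Integrable fun y : E3 => P.K ‖r⁻¹ • y‖ := hK0.comp_smul (inv_ne_zero hr0.ne')
    have h2 := h1.comp_sub_left x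
    refine h2.congr (.of_forall fun y => ?_)
    simp only [norm_smul, norm_inv, Real.norm_eq_abs, abs_of_pos hr0, div_eq_inv_mul]
  have hcont : ∀ j : Fin 3, Continuous fun y => flux (f t y) j := fun j => by
    have : Continuous fun y : E3 => moment (fun ω : S2 => (ω : E3) j) f (t, y) :=
      (contDiffOn_moment hI hf (continuous_coord j)).continuousOn.comp_continuous
        (by fun_prop) fun y => mem_dom ht y
    refine this.congr fun y => (flux_eq_moment hf (mem_dom ht y) j).symm
  have hcf : Continuous fun y => flux (f t y) := by
    have : Continuous fun y => WithLp.toLp 2 fun j => flux (f t y) j :=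
      (PiLp.continuous_toLp 2 _).comp (continuous_pi hcont)
    exact this
  have hb : ∀ y, ‖flux (f t y)‖ ≤ C := fun y => by
    have := norm_integral_le_of_norm_le_const (μ := sigma) (C := C)
      (f := fun ω : S2 => f t y ω • (ω : E3)) (.of_forall fun ω => by
        rw [norm_smul, S2.norm_eq, mul_one, Real.norm_eq_abs, abs_of_nonneg (h0 y ω)]
        exact hC y ω)
    simpa [flux] using this
  have hint : Integrable fun y => P.K (‖x - y‖ / r) • flux (f t y) :=
    hKi.smul_bdd C hcf.aestronglyMeasurable (.of_forall hb)
  have h3 := (EuclideanSpace.proj (𝕜 := ℝ) i).integral_comp_comm hint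
  rw [nonlocalFlux, integral_congr_ae (.of_forall e1)]
  change EuclideanSpace.proj (𝕜 := ℝ) i _ = _
  rw [← h3]
  refine integral_congr_ae (.of_forall fun y => ?_)
  simp only [map_smul, smul_eq_mul]
  congr 1
  exact flux_eq_moment hf (mem_dom ht y) i

theorem eventually_norm_sub_hessian_moment_le (hI : IsOpen I) {fε : ℝ → ℝ → E3 → S2 → ℝ}
    (hfε : TendstoCk 2 (domF I) (fun ε => ext (fε ε)) (ext f))
    (hsm : ∀ᶠ ε in 𝓝[>] (0 : ℝ), ContDiffOn ℝ 2 (ext (fε ε)) (domF I))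
    (hf : ContDiffOn ℝ 2 (ext f) (domF I)) {φ : S2 → ℝ} (hφ : Continuous φ) {t : ℝ} (ht : t ∈ I)
    (x : E3) : ∀ δ > 0, ∃ η > 0, ∀ᶠ ε in 𝓝[>] (0 : ℝ), ∀ y ∈ Metric.ball x η,
      ‖spRestr₂ (fderiv ℝ (fderiv ℝ (moment φ (fε ε))) (t, y))
        - spRestr₂ (fderiv ℝ (fderiv ℝ (moment φ f)) (t, x))‖ ≤ δ := by
  intro δ hδ
  have hq := mem_dom ht x
  have hc : ContinuousAt (fderiv ℝ (fderiv ℝ (moment φ f))) (t, x) :=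
    ((contDiffOn_moment hI hf hφ).fderiv_of_isOpen (m := 1) (isOpen_dom hI)
      (by norm_num)).continuousOn_fderiv_of_isOpen (isOpen_dom hI)
      (by norm_num) |>.continuousAt ((isOpen_dom hI).mem_nhds hq)
  obtain ⟨η, hη, h⟩ := eventually_norm_clm_sub_le (Y := ST →L[ℝ] ST →L[ℝ] ℝ)
    (Z := E3 →L[ℝ] E3 →L[ℝ] ℝ) (tendsto_fderiv_fderiv_moment hI hfε hsm hf hφ) (isOpen_dom hI) hq hc spRestr₂ hδ
  exact ⟨η, hη, h.mono fun ε h1 y hy =>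
    h1 (t, y) (by rw [Metric.mem_ball, Prod.dist_eq]; simpa [hη] using hy)⟩

set_option maxHeartbeats 400000 in
/-- Second order expansion of the nonlocal flux as the interaction range tends to zero. -/
theorem tendsto_nonlocalFlux {P : Params} (hR : 0 < P.R)
    (hK0 : Integrable fun z : E3 => P.K ‖z‖) (hK2 : Integrable fun z : E3 => P.K ‖z‖ * ‖z‖ ^ 2)
    (hKpos : 0 < ∫ z : E3, P.K ‖z‖) (hI : IsOpen I) {fε : ℝ → ℝ → E3 → S2 → ℝ}
    (hfε : TendstoCk 2 (domF I) (fun ε => ext (fε ε)) (ext f))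
    (hsm : ∀ᶠ ε in 𝓝[>] (0 : ℝ), ContDiffOn ℝ 2 (ext (fε ε)) (domF I))
    (hf : ContDiffOn ℝ 2 (ext f) (domF I)) {t : ℝ} (ht : t ∈ I)
    (h0 : ∀ᶠ ε in 𝓝[>] (0 : ℝ), ∀ y ω, 0 ≤ fε ε t y ω) {C : ℝ}
    (hC : ∀ᶠ ε in 𝓝[>] (0 : ℝ), ∀ y ω, fε ε t y ω ≤ C) (x : E3) (i : Fin 3) :
    Tendsto (fun ε => ε⁻¹ * (((Real.sqrt ε * P.R) ^ 3 * ∫ z : E3, P.K ‖z‖)⁻¹ *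
        nonlocalFlux P ε (fε ε t) x i - moment (fun ω => (ω : E3) i) (fε ε) (t, x)))
      (𝓝[>] (0 : ℝ)) (𝓝 (P.k0 * lapl (fun y => moment (fun ω => (ω : E3) i) f (t, y)) x)) := by
  set m0 := ∫ z : E3, P.K ‖z‖ with hm0
  set φ : S2 → ℝ := fun ω => (ω : E3) i with hφdef
  have hφ : Continuous φ := continuous_coord i
  have hq := mem_dom ht x
  have hpos : ∀ᶠ ε in 𝓝[>] (0 : ℝ), 0 < ε := self_mem_nhdsWithin
  have hD := (spRestr₁ (G := ℝ)).continuous.continuousAt.tendsto.comp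
    ((tendsto_fderiv_moment hI hfε hsm hf hφ).tendsto_at hq)
  have hDb : ∀ᶠ ε in 𝓝[>] (0 : ℝ), ‖spRestr₁ (fderiv ℝ (moment φ (fε ε)) (t, x))‖ ≤
      max C (‖spRestr₁ (fderiv ℝ (moment φ f) (t, x))‖ + 1) :=
    (hD.norm.eventually (gt_mem_nhds (lt_add_one _))).mono fun ε h => h.le.trans (le_max_right _ _)
  have hr0 : Tendsto (fun ε => Real.sqrt ε * P.R) (𝓝[>] (0 : ℝ)) (𝓝 0) := by
    have : Tendsto (fun ε => Real.sqrt ε * P.R) (𝓝 (0 : ℝ)) (𝓝 (Real.sqrt 0 * P.R)) :=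
      (Real.continuous_sqrt.mul continuous_const).tendsto 0
    rw [Real.sqrt_zero, zero_mul] at this
    exact this.mono_left nhdsWithin_le_nhds
  have main := tendsto_radial_average (l := 𝓝[>] (0 : ℝ)) hK0 hK2
    (r := fun ε => Real.sqrt ε * P.R)
    (hpos.mono fun ε h => mul_pos (Real.sqrt_pos.2 h) hR) hr0
    (g := fun ε y => moment φ (fε ε) (t, y))
    (g' := fun ε y => spRestr₁ (fderiv ℝ (moment φ (fε ε)) (t, y)))
    (g'' := fun ε y => spRestr₂ (fderiv ℝ (fderiv ℝ (moment φ (fε ε))) (t, y)))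
    (hsm.mono fun ε h y => hasFDerivAt_space_slice
      (hasFDerivAt_moment hI h hφ (mem_dom ht y)).differentiableAt.hasFDerivAt)
    (hsm.mono fun ε h y => hasFDerivAt_fderiv_space_slice
      (hasFDerivAt_fderiv_moment hI h hφ (mem_dom ht y)).differentiableAt.hasFDerivAt)
    (x := x) (A := spRestr₂ (fderiv ℝ (fderiv ℝ (moment φ f)) (t, x)))
    (eventually_norm_sub_hessian_moment_le hI hfε hsm hf hφ ht x)
    (C := max C (‖spRestr₁ (fderiv ℝ (moment φ f) (t, x))‖ + 1))
    ((h0.and hC).mono fun ε h y =>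
      (abs_moment_coord_le (h.1 y) (h.2 y) i).trans (le_max_left _ _)) hDb
  have hlap : lapl (fun y => moment φ f (t, y)) x =
      ∑ j, spRestr₂ (fderiv ℝ (fderiv ℝ (moment φ f)) (t, x)) (e j) (e j) :=
    lapl_space_slice hI (contDiffOn_moment hI hf hφ) ht x
  rw [hlap]
  -- The interaction radius is `r = √ε R`, so `r² = ε R²`: dividing by `ε` instead of `r²`
  -- contributes the factor `R²` of `k₀`.
  have hk : P.k0 * ∑ j, spRestr₂ (fderiv ℝ (fderiv ℝ (moment φ f)) (t, x)) (e j) (e j) =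
      P.R ^ 2 * m0⁻¹ * ((∫ z : E3, P.K ‖z‖ * ‖z‖ ^ 2) / 6 *
        ∑ j, spRestr₂ (fderiv ℝ (fderiv ℝ (moment φ f)) (t, x)) (e j) (e j)) := by
    rw [Params.k0, ← hm0]
    ring
  rw [hk]
  refine (main.const_mul (P.R ^ 2 * m0⁻¹)).congr' ?_
  filter_upwards [hpos, hsm, h0, hC] with ε h1 h2 h3 h4
  rw [nonlocalFlux_apply hR hK0 h1 hI h2 ht h3 h4 x i]
  have hs : Real.sqrt ε ^ 2 = ε := Real.sq_sqrt h1.le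
  have hs0 := (Real.sqrt_pos.2 h1).ne'
  rw [mul_pow _ _ 2, hs, ← hm0]
  change _ = ε⁻¹ * ((((Real.sqrt ε * P.R) ^ 3 * m0)⁻¹ *
    ∫ y : E3, P.K (‖x - y‖ / (Real.sqrt ε * P.R)) * moment φ (fε ε) (t, y)) -
    moment φ (fε ε) (t, x))
  field_simp

end

/-! ### Continuous convergence on the sphere -/

/-- Continuous convergence of functions on the sphere. -/
def CConv {Y : Type*} [TopologicalSpace Y] (l : Filter ℝ) (F : ℝ → S2 → Y) (F0 : S2 → Y) : Prop :=
  ∀ ω, Tendsto (Function.uncurry F) (l ×ˢ 𝓝 ω) (𝓝 (F0 ω))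

section CConv

variable {Y Z : Type*} {l : Filter ℝ}

theorem CConv.of_tendsto [TopologicalSpace Y] {u : ℝ → Y} {u0 : Y} (h : Tendsto u l (𝓝 u0)) :
    CConv l (fun ε _ => u ε) (fun _ => u0) := fun _ => h.comp tendsto_fst

theorem CConv.of_continuous [TopologicalSpace Y] {F : S2 → Y} (h : Continuous F) :
    CConv l (fun _ => F) F := fun ω => (h.tendsto ω).comp tendsto_snd

theorem CConv.map [TopologicalSpace Y] [TopologicalSpace Z] {F : ℝ → S2 → Y} {F0 : S2 → Y}
    (h : CConv l F F0) {k : Y → Z} (hk : Continuous k) :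
    CConv l (fun ε ω => k (F ε ω)) (fun ω => k (F0 ω)) := fun ω => (hk.tendsto _).comp (h ω)

theorem CConv.prodMk [TopologicalSpace Y] [TopologicalSpace Z] {F : ℝ → S2 → Y} {F0 : S2 → Y}
    {G : ℝ → S2 → Z} {G0 : S2 → Z} (h : CConv l F F0) (hG : CConv l G G0) :
    CConv l (fun ε ω => (F ε ω, G ε ω)) (fun ω => (F0 ω, G0 ω)) := fun ω => (h ω).prodMk_nhds (hG ω)

theorem CConv.add [TopologicalSpace Y] [Add Y] [ContinuousAdd Y] {F G : ℝ → S2 → Y} {F0 G0 : S2 → Y}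
    (h : CConv l F F0) (hG : CConv l G G0) :
    CConv l (fun ε ω => F ε ω + G ε ω) (fun ω => F0 ω + G0 ω) := fun ω => (h ω).add (hG ω)

theorem CConv.mul {F G : ℝ → S2 → ℝ} {F0 G0 : S2 → ℝ} (h : CConv l F F0) (hG : CConv l G G0) :
    CConv l (fun ε ω => F ε ω * G ε ω) (fun ω => F0 ω * G0 ω) := fun ω => (h ω).mul (hG ω)

theorem CConv.smul [NormedAddCommGroup Y] [NormedSpace ℝ Y] {F : ℝ → S2 → ℝ} {F0 : S2 → ℝ}
    {G : ℝ → S2 → Y} {G0 : S2 → Y} (h : CConv l F F0) (hG : CConv l G G0) :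
    CConv l (fun ε ω => F ε ω • G ε ω) (fun ω => F0 ω • G0 ω) := fun ω => (h ω).smul (hG ω)

theorem CConv.inner {F G : ℝ → S2 → E3} {F0 G0 : S2 → E3} (h : CConv l F F0) (hG : CConv l G G0) :
    CConv l (fun ε ω => inner ℝ (F ε ω) (G ε ω)) (fun ω => inner ℝ (F0 ω) (G0 ω)) :=
  fun ω => (h ω).inner (hG ω)

theorem CConv.clm_apply [NormedAddCommGroup Y] [NormedSpace ℝ Y] [NormedAddCommGroup Z]
    [NormedSpace ℝ Z] {L : ℝ → S2 → Y →L[ℝ] Z} {L0 : S2 → Y →L[ℝ] Z} {F : ℝ → S2 → Y} {F0 : S2 → Y}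
    (hL : CConv l L L0) (h : CConv l F F0) :
    CConv l (fun ε ω => L ε ω (F ε ω)) (fun ω => L0 ω (F0 ω)) := fun ω =>
  (isBoundedBilinearMap_apply.continuous.tendsto (L0 ω, F0 ω)).comp ((hL ω).prodMk_nhds (h ω))

/-- On the compact sphere, continuous convergence to a continuous limit is uniform. -/
theorem CConv.integral [NormedAddCommGroup Y] [NormedSpace ℝ Y] {F : ℝ → S2 → Y} {F0 : S2 → Y}
    (h : CConv l F F0) (hF : ∀ᶠ ε in l, Continuous (F ε)) (hF0 : Continuous F0) :
    Tendsto (fun ε => ∫ ω, F ε ω ∂sigma) l (𝓝 (∫ ω, F0 ω ∂sigma)) := by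
  have hu : TendstoUniformly F F0 l := by
    rw [← tendstoLocallyUniformly_iff_tendstoUniformly_of_compactSpace,
      tendstoLocallyUniformly_iff_forall_tendsto]
    intro ω
    have h1 : Tendsto (fun p : ℝ × S2 => F0 p.2) (l ×ˢ 𝓝 ω) (𝓝 (F0 ω)) :=
      (hF0.tendsto ω).comp tendsto_snd
    exact (h1.prodMk_nhds (h ω)).mono_right (nhds_le_uniformity _)
  rw [Metric.tendstoUniformly_iff] at hu
  rw [Metric.tendsto_nhds]
  intro δ hδ
  filter_upwards [hu (δ / 2) (by positivity), hF] with ε h1 h2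
  rw [dist_eq_norm, ← sphere_integral_sub h2 hF0]
  have := norm_integral_le_of_norm_le_const (μ := sigma) (C := δ / 2)
    (f := fun ω => F ε ω - F0 ω) (.of_forall fun ω => by
      rw [← dist_eq_norm, dist_comm]
      exact (h1 ω).le)
  simp only [probReal_univ, mul_one] at this
  linarith

theorem UnifConv.cconv [NormedAddCommGroup Y] {I : Set ℝ} {Fε : ℝ → ST → S2 → Y} {F : ST → S2 → Y}
    (h : UnifConv I Fε F) (hl : l ≤ 𝓝[>] (0 : ℝ)) {q : ST} (hq : q ∈ dom I)
    (hF : Continuous (F q)) : CConv l (fun ε => Fε ε q) (F q) := by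
  intro ω
  rw [Metric.tendsto_nhds]
  intro δ hδ
  have h1 := hl (h {q} (singleton_subset_iff.2 hq) isCompact_singleton (δ / 2) (by positivity))
  have h2 := hF.continuousAt.eventually (Metric.ball_mem_nhds (F q ω) (half_pos hδ))
  filter_upwards [Filter.Eventually.prod_mk h1 h2] with z hz
  have h3 := hz.1 q rfl z.2
  have h4 : dist (F q z.2) (F q ω) < δ / 2 := hz.2
  rw [← dist_eq_norm] at h3
  calc dist (Fε z.1 q z.2) (F q ω) ≤ dist (Fε z.1 q z.2) (F q z.2) + dist (F q z.2) (F q ω) :=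
        dist_triangle _ _ _
    _ < δ := by linarith

end CConv

/-! ### Characterisation of von Mises equilibria -/

theorem sphSmooth_vonMises (κ : ℝ) (Ω : S2) {n : WithTop ℕ∞} : SphSmooth n (vonMises κ Ω) := by
  rw [funext (vonMises_eq κ Ω)]
  exact SphSmooth.comp (contDiff_vmProfile κ) (sphSmooth_inner_left _)

theorem vonMises_pos (κ : ℝ) (Ω ω : S2) : 0 < vonMises κ Ω ω := by
  rw [vonMises_eq]
  exact vmProfile_pos _ _

theorem sphGrad_vonMises (κ : ℝ) (Ω ω : S2) :
    sphGrad (vonMises κ Ω) ω = (κ * vonMises κ Ω ω) • proj ω (Ω : E3) := by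
  have h := sphGrad_comp ((contDiff_vmProfile κ (n := 1)).differentiable one_ne_zero)
    (sphSmooth_inner_left (n := 1) (Ω : E3)) ω
  rw [sphGrad_inner, (hasDerivAt_vmProfile κ _).deriv, ← vonMises_eq] at h
  rw [← h, funext (vonMises_eq κ Ω)]

/-- Dirichlet form of the Fokker-Planck operator. -/
theorem integral_mul_vonMises_generator (κ : ℝ) (Ω : S2) {ψ χ : S2 → ℝ} (hψ : SphSmooth 1 ψ)
    (hχ : SphSmooth 2 χ) :
    ∫ ω, ψ ω * vonMises κ Ω ω * (sphLap χ ω + κ * inner ℝ (Ω : E3) (sphGrad χ ω)) ∂sigma =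
      -∫ ω, vonMises κ Ω ω * inner ℝ (sphGrad ψ ω) (sphGrad χ ω) ∂sigma := by
  have hM := sphSmooth_vonMises κ Ω (n := 1)
  have h := integral_mul_sphLap (hψ.mul hM) hχ
  have e1 : ∀ ω, inner ℝ (sphGrad (fun ω => ψ ω * vonMises κ Ω ω) ω) (sphGrad χ ω) =
      ψ ω * vonMises κ Ω ω * (κ * inner ℝ (Ω : E3) (sphGrad χ ω))
        + vonMises κ Ω ω * inner ℝ (sphGrad ψ ω) (sphGrad χ ω) := by
    intro ω
    rw [sphGrad_mul hψ hM, sphGrad_vonMises, inner_add_left, real_inner_smul_left,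
      real_inner_smul_left, real_inner_smul_left, real_inner_comm,
      inner_proj_of_tangent (sphGrad_tangent χ ω), real_inner_comm]
    ring
  simp only [e1] at h
  have cχ := hχ.sphGrad.continuous
  have cM := hM.continuous
  have cψ := hψ.continuous
  have c1 : Continuous fun ω => ψ ω * vonMises κ Ω ω * (κ * inner ℝ (Ω : E3) (sphGrad χ ω)) :=
    (cψ.mul cM).mul (continuous_const.mul (continuous_const.inner cχ))
  have c2 : Continuous fun ω => ψ ω * vonMises κ Ω ω * sphLap χ ω :=
    (cψ.mul cM).mul (continuous_sphLap hχ)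
  have c3 : Continuous fun ω => vonMises κ Ω ω * inner ℝ (sphGrad ψ ω) (sphGrad χ ω) := by
    have : Continuous fun ω => inner ℝ (sphGrad (fun ω => ψ ω * vonMises κ Ω ω) ω) (sphGrad χ ω)
        - ψ ω * vonMises κ Ω ω * (κ * inner ℝ (Ω : E3) (sphGrad χ ω)) := by
      have hd : Continuous (sphDiv fun ω => (ψ ω * vonMises κ Ω ω) • sphGrad χ ω) :=
        ((hψ.mul hM).smul hχ.sphGrad).continuous_sphDiv
      have h4 := hd.sub ((cψ.mul cM).mul hχ.sphGrad.continuous_sphDiv)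
      refine (h4.congr fun ω => ?_).sub c1
      rw [Pi.sub_apply, sphDiv_smul (hψ.mul hM) hχ.sphGrad]
      simp
    refine this.congr fun ω => ?_
    rw [e1]
    ring
  rw [sphere_integral_add c1 c3] at h
  simp only [mul_add]
  rw [sphere_integral_add c2 c1, h]
  ring

/-- A smooth weak solution of the homogeneous Fokker-Planck equation is a von Mises density. -/
theorem eq_vonMises_of_weak {κ : ℝ} {Ω : S2} {F : S2 → ℝ} (hF : SphSmooth 2 F)
    (h : ∀ ψ, SphSmooth 2 ψ →
      ∫ ω, F ω * (sphLap ψ ω + κ * inner ℝ (Ω : E3) (sphGrad ψ ω)) ∂sigma = 0) (ω : S2) :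
    F ω = density F * vonMises κ Ω ω := by
  have hM := sphSmooth_vonMises κ Ω (n := 2)
  have hM0 := fun ω => (vonMises_pos κ Ω ω).ne'
  -- The density relative to the equilibrium; as a test function it turns the weak equation into its
  -- own Dirichlet form.
  set ψ : S2 → ℝ := fun ω => F ω * (vonMises κ Ω ω)⁻¹ with hψdef
  have hψ : SphSmooth 2 ψ := hF.mul (ContDiffOn.inv hM fun y _ => hM0 _)
  have hFψ : ∀ ω, F ω = ψ ω * vonMises κ Ω ω := fun ω => by
    rw [hψdef]
    field_simp [hM0 ω]
  have h1 := h ψ hψ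
  simp only [hFψ] at h1
  rw [integral_mul_vonMises_generator κ Ω (hψ.of_le (by norm_num)) hψ, neg_eq_zero] at h1
  have cg := hψ.sphGrad.continuous
  have cM := hM.continuous
  have c0 : Continuous fun ω => vonMises κ Ω ω * inner ℝ (sphGrad ψ ω) (sphGrad ψ ω) :=
    cM.mul (cg.inner cg)
  rw [integral_eq_zero_iff_of_nonneg (fun ω => mul_nonneg (vonMises_pos κ Ω ω).le
    real_inner_self_nonneg) (continuous_integrable c0)] at h1
  have h2 := (c0.ae_eq_iff_eq sigma continuous_const).1 h1
  have h3 : ∀ ω, sphGrad ψ ω = 0 := fun ω => by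
    have := congrFun h2 ω
    exact inner_self_eq_zero.1 ((mul_eq_zero.1 this).resolve_left (hM0 ω))
  have h4 := eq_of_sphGrad_eq_zero (hψ.of_le (by norm_num)) h3
  have h5 : ∀ ω', F ω' = ψ ω * vonMises κ Ω ω' := fun ω' => by rw [hFψ, h4 ω' ω]
  have h6 : density F = ψ ω := by
    rw [density, integral_congr_ae (.of_forall h5), integral_const_mul, integral_vonMises, mul_one]
  rw [h6, h5]

theorem eq_zero_of_density_eq_zero {F : S2 → ℝ} (hF : Continuous F) (h : ∀ ω, 0 ≤ F ω)
    (h0 : density F = 0) (ω : S2) : F ω = 0 := by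
  rw [density, integral_eq_zero_iff_of_nonneg h (continuous_integrable hF)] at h0
  exact congrFun ((hF.ae_eq_iff_eq sigma continuous_const).1 h0) ω

/-! ### Moments of von Mises densities -/

/-- Paired with `w`, only the component of `w` along `Ω` contributes; the perpendicular one is odd
under the half turn. -/
theorem flux_vonMises (κ : ℝ) (Ω : S2) : flux (vonMises κ Ω) = c1 κ • (Ω : E3) := by
  have hM := (sphSmooth_vonMises κ Ω (n := 0)).continuous
  refine ext_inner_left ℝ fun w => ?_
  have hi : Integrable (fun ω : S2 => vonMises κ Ω ω • (ω : E3)) sigma :=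
    continuous_integrable (hM.smul continuous_subtype_val)
  rw [flux, ← integral_inner hi]
  have hdec : ∀ u : E3, inner ℝ w u = inner ℝ w (Ω : E3) * inner ℝ (Ω : E3) u
      + inner ℝ (proj Ω w) u := fun u => by
    simp only [proj, inner_sub_left, real_inner_smul_left, real_inner_comm w]
    ring
  have e1 : ∀ ω : S2, inner ℝ w (vonMises κ Ω ω • (ω : E3)) =
      inner ℝ w (Ω : E3) * (fun x => x * vmProfile κ x) (inner ℝ (Ω : E3) (ω : E3))
        + vmProfile κ (inner ℝ (Ω : E3) (ω : E3)) * inner ℝ (proj Ω w) (ω : E3) := fun ω => by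
    rw [real_inner_smul_right, hdec, vonMises_eq]
    ring
  simp only [e1]
  rw [sphere_integral_add (by fun_prop) (by fun_prop), integral_const_mul,
    integral_zonal (φ := fun x => x * vmProfile κ x) (by fun_prop),
    integral_zonal_mul_inner _ (proj_inner_self Ω w), real_inner_smul_right, c1_eq]
  ring

theorem flux_smul (c : ℝ) (F : S2 → ℝ) : flux (fun ω => c * F ω) = c • flux F := by
  simp only [flux, mul_smul, integral_smul]

/-- Splitting both vectors along and across `Ω`, the cross terms are odd and the perpendicular block
is isotropic, so a single scalar `c₄` describes the deviation from isotropy. -/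
theorem integral_vonMises_mul_inner_mul_inner (κ : ℝ) (Ω : S2) (u w : E3) :
    ∫ ω : S2, vonMises κ Ω ω * inner ℝ w (ω : E3) * inner ℝ u (ω : E3) ∂sigma =
      c4 κ * (inner ℝ (Ω : E3) w * inner ℝ (Ω : E3) u - inner ℝ w u / 3) + inner ℝ w u / 3 := by
  have hdec : ∀ y : E3, inner ℝ w y = inner ℝ (Ω : E3) w * inner ℝ (Ω : E3) y
      + inner ℝ (proj Ω w) y := fun y => by
    simp only [proj, inner_sub_left, real_inner_smul_left]
    ring
  have hdec' : ∀ y : E3, inner ℝ u y = inner ℝ (Ω : E3) u * inner ℝ (Ω : E3) y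
      + inner ℝ (proj Ω u) y := fun y => by
    simp only [proj, inner_sub_left, real_inner_smul_left]
    ring
  have hw := proj_inner_self Ω w
  have hu := proj_inner_self Ω u
  have e1 : ∀ ω : S2, vonMises κ Ω ω * inner ℝ w (ω : E3) * inner ℝ u (ω : E3) =
      (inner ℝ (Ω : E3) w * inner ℝ (Ω : E3) u) *
        (fun x => vmProfile κ x * x ^ 2) (inner ℝ (Ω : E3) (ω : E3))
      + (inner ℝ (Ω : E3) w *
        ((fun x => vmProfile κ x * x) (inner ℝ (Ω : E3) (ω : E3)) * inner ℝ (proj Ω u) (ω : E3))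
      + (inner ℝ (Ω : E3) u *
        ((fun x => vmProfile κ x * x) (inner ℝ (Ω : E3) (ω : E3)) * inner ℝ (proj Ω w) (ω : E3))
      + vmProfile κ (inner ℝ (Ω : E3) (ω : E3)) * inner ℝ (proj Ω w) (ω : E3)
        * inner ℝ (proj Ω u) (ω : E3))) := fun ω => by
    rw [hdec, hdec', vonMises_eq]
    ring
  simp only [e1]
  rw [sphere_integral_add (by fun_prop) (by fun_prop), sphere_integral_add (by fun_prop) (by fun_prop),
    sphere_integral_add (by fun_prop) (by fun_prop), integral_const_mul, integral_const_mul,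
    integral_const_mul, integral_zonal (φ := fun x => vmProfile κ x * x ^ 2) (by fun_prop),
    integral_zonal_mul_inner (fun x => vmProfile κ x * x) hu,
    integral_zonal_mul_inner (fun x => vmProfile κ x * x) hw,
    integral_zonal_mul_inner_mul_inner (φ := vmProfile κ) (by fun_prop) hw, inner_proj_proj]
  have h2 : ∫ x in (-1 : ℝ)..1, vmProfile κ x * x ^ 2 = 2 - 4 * vmVariance κ := by
    have e2 : ∀ x, vmProfile κ x * x ^ 2 =
        vmProfile κ x - 4 * (vmProfile κ x * (1 - x ^ 2) / 4) := fun x => by ring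
    simp only [e2]
    rw [intervalIntegral.integral_sub (Continuous.intervalIntegrable (by fun_prop) _ _)
      (Continuous.intervalIntegrable (by fun_prop) _ _), intervalIntegral.integral_const_mul,
      integral_vmProfile, vmVariance]
  rw [h2, c4_eq_variance]
  change _ + (_ + (_ + _ * vmVariance κ)) = _
  ring

theorem qTensor_vonMises (κ : ℝ) (Ω : S2) : qTensor (vonMises κ Ω) =
    c4 κ • (tens (Ω : E3) (Ω : E3) - (1 / 3 : ℝ) • (1 : Matrix (Fin 3) (Fin 3) ℝ)) := by
  have hM := (sphSmooth_vonMises κ Ω (n := 0)).continuous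
  ext i j
  have h := integral_vonMises_mul_inner_mul_inner κ Ω (e j) (e i)
  have hij : inner ℝ (e i) (e j) = (1 : Matrix (Fin 3) (Fin 3) ℝ) i j := by
    rw [inner_e]
    simp [e, Matrix.one_apply, eq_comm]
  have he : ∀ (k : Fin 3) (y : E3), inner ℝ (e k) y = y k := fun k y => by
    rw [real_inner_comm, inner_e]
  rw [real_inner_comm, hij] at h
  simp only [he, inner_e] at h
  have e1 : ∀ ω : S2, (tens (ω : E3) (ω : E3) - (1 / 3 : ℝ) • (1 : Matrix (Fin 3) (Fin 3) ℝ)) i j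
      * vonMises κ Ω ω = vonMises κ Ω ω * (ω : E3) i * (ω : E3) j
        - (1 / 3 * (1 : Matrix (Fin 3) (Fin 3) ℝ) i j) * vonMises κ Ω ω := fun ω => by
    simp [tens]
    ring
  have ci := continuous_coord i
  have cj := continuous_coord j
  simp only [qTensor, Matrix.of_apply, e1]
  rw [sphere_integral_sub (by fun_prop) (by fun_prop), integral_const_mul, integral_vonMises, h]
  simp [tens]
  ring

theorem qTensor_smul (c : ℝ) (F : S2 → ℝ) : qTensor (fun ω => c * F ω) = c • qTensor F := by
  ext i j
  simp only [qTensor, Matrix.of_apply, Matrix.smul_apply, smul_eq_mul, mul_left_comm _ c,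
    integral_const_mul]

/-! ### The hydrodynamic limit -/

/-- The matrix `λ S(v) + A(v)`. -/
noncomputable def strain (lam : ℝ) (v : ℝ → E3 → E3) (q : ST) : Matrix (Fin 3) (Fin 3) ℝ :=
  lam • symV (v q.1) q.2 + antiV (v q.1) q.2

/-- Transport and rotation terms of the kinetic equation, tested with `ψ`. -/
noncomputable def transport (P : Params) (f : ℝ → E3 → S2 → ℝ) (v : ℝ → E3 → E3) (q : ST)
    (ψ : S2 → ℝ) : ℝ :=
  ∫ ω, ψ ω * stD f q ω (1, v q.1 q.2 + P.a • (ω : E3)) ∂sigma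
    - ∫ ω, f q.1 q.2 ω * inner ℝ (sphGrad ψ ω) (act (strain P.lam v q) (ω : E3)) ∂sigma

/-- A family of solutions of the rescaled kinetic system converging to `(f, v, p)`. -/
structure HydrodynamicLimit (P : Params) (I : Set ℝ) (fε : ℝ → ℝ → E3 → S2 → ℝ)
    (vε : ℝ → ℝ → E3 → E3) (pε : ℝ → ℝ → E3 → ℝ) (f : ℝ → E3 → S2 → ℝ) (v : ℝ → E3 → E3)
    (p : ℝ → E3 → ℝ) : Prop where
  nu_pos : 0 < P.nu
  D_pos : 0 < P.D
  R_pos : 0 < P.R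
  integrable_K : Integrable fun z : E3 => P.K ‖z‖
  integrable_K_sq : Integrable fun z : E3 => P.K ‖z‖ * ‖z‖ ^ 2
  K_pos : 0 < ∫ z : E3, P.K ‖z‖
  isOpen : IsOpen I
  sol : ∀ᶠ ε in 𝓝[>] (0 : ℝ), IsScaledSolution P ε I (fε ε) (vε ε) (pε ε)
  smooth_f : ContDiffOn ℝ 2 (ext f) (domF I)
  smooth_v : ContDiffOn ℝ 2 (unc v) (dom I)
  smooth_p : ContDiffOn ℝ 1 (unc p) (dom I)
  conv_f : TendstoCk 2 (domF I) (fun ε => ext (fε ε)) (ext f)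
  conv_v : TendstoCk 2 (dom I) (fun ε => unc (vε ε)) (unc v)
  conv_p : TendstoCk 1 (dom I) (fun ε => unc (pε ε)) (unc p)
  bdd : ∀ t ∈ I, ∃ C : ℝ, ∀ᶠ ε in 𝓝[>] (0 : ℝ), ∀ x ω, fε ε t x ω ≤ C

theorem continuous_act : Continuous fun z : Matrix (Fin 3) (Fin 3) ℝ × E3 => act z.1 z.2 := by
  unfold act
  exact (PiLp.continuous_toLp 2 _).comp
    (continuous_fst.matrix_mulVec ((PiLp.continuous_ofLp 2 _).comp continuous_snd))

theorem differentiableAt_of_contDiffOn_dom {G : Type*} [NormedAddCommGroup G] [NormedSpace ℝ G]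
    {I : Set ℝ} (hI : IsOpen I) {F : ST → G} {n : WithTop ℕ∞} (hF : ContDiffOn ℝ n F (dom I))
    (hn : n ≠ 0) {q : ST} (hq : q ∈ dom I) : DifferentiableAt ℝ F q :=
  (hF.differentiableOn hn).differentiableAt ((isOpen_dom hI).mem_nhds hq)

theorem gradV_eq {v : ℝ → E3 → E3} {q : ST} (hv : DifferentiableAt ℝ (unc v) q) (i j : Fin 3) :
    gradV (v q.1) q.2 i j = fderiv ℝ (unc v) q (0, e i) j := by
  have := fderiv_space_slice (t := q.1) (x := q.2) hv.hasFDerivAt (e i)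
  rw [gradV, Matrix.of_apply, ← this]
  rfl

section

variable {P : Params} {I : Set ℝ} {fε : ℝ → ℝ → E3 → S2 → ℝ} {vε : ℝ → ℝ → E3 → E3}
  {pε : ℝ → ℝ → E3 → ℝ} {f : ℝ → E3 → S2 → ℝ} {v : ℝ → E3 → E3} {p : ℝ → E3 → ℝ} {q : ST}

/-- Since `ν = κD`, alignment and diffusion combine into one Fokker-Planck generator acting on the
test function, while everything of order `ε` is collected in `transport`. -/
theorem IsScaledSolution.weak_transport {ε : ℝ} (hD : P.D ≠ 0)
    (hI : IsOpen I) (h : IsScaledSolution P ε I f v p) (hq : q ∈ dom I) {ψ : S2 → ℝ}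
    (hψ : SphSmooth 2 ψ) :
    ε * transport P f v q ψ = P.D * ∫ ω, f q.1 q.2 ω * (sphLap ψ ω
      + P.kappa * inner ℝ (nonlocalOrientation P ε (f q.1) q.2) (sphGrad ψ ω)) ∂sigma := by
  have hw := h.weak hI hq hψ
  set w := nonlocalOrientation P ε (f q.1) q.2 with hwdef
  have cf := (sphSmooth_slice h.smooth_f hq).continuous
  have cg := hψ.sphGrad.continuous
  have cL := continuous_sphLap hψ
  have cA : Continuous fun ω : S2 => act (strain P.lam v q) (ω : E3) :=
    (actL (strain P.lam v q)).continuous.comp continuous_subtype_val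
  have e1 : ∀ ω : S2, f q.1 q.2 ω * inner ℝ (sphGrad ψ ω)
        (P.nu • w + ε • act (P.lam • symV (v q.1) q.2 + antiV (v q.1) q.2) (ω : E3)) =
      P.nu * (f q.1 q.2 ω * inner ℝ w (sphGrad ψ ω))
        + ε * (f q.1 q.2 ω * inner ℝ (sphGrad ψ ω) (act (strain P.lam v q) (ω : E3))) := fun ω => by
    rw [inner_add_right, real_inner_smul_right, real_inner_smul_right, real_inner_comm w, strain]
    ring
  have c1 : Continuous fun ω : S2 => f q.1 q.2 ω * inner ℝ w (sphGrad ψ ω) :=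
    cf.mul (continuous_const.inner cg)
  have c2 : Continuous fun ω : S2 =>
      f q.1 q.2 ω * inner ℝ (sphGrad ψ ω) (act (strain P.lam v q) (ω : E3)) :=
    cf.mul (cg.inner cA)
  have c3 : Continuous fun ω : S2 => f q.1 q.2 ω * sphLap ψ ω := cf.mul cL
  simp only [e1] at hw
  rw [sphere_integral_add (c1.const_mul _) (c2.const_mul _), integral_const_mul,
    integral_const_mul] at hw
  have e2 : ∀ ω : S2, f q.1 q.2 ω * (sphLap ψ ω + P.kappa * inner ℝ w (sphGrad ψ ω)) =
      f q.1 q.2 ω * sphLap ψ ω + P.kappa * (f q.1 q.2 ω * inner ℝ w (sphGrad ψ ω)) := fun ω => by ring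
  simp only [e2]
  rw [sphere_integral_add c3 (c1.const_mul _), integral_const_mul, mul_add, ← hw, transport]
  have : P.D * (P.kappa * ∫ ω, f q.1 q.2 ω * inner ℝ w (sphGrad ψ ω) ∂sigma) =
      P.nu * ∫ ω, f q.1 q.2 ω * inner ℝ w (sphGrad ψ ω) ∂sigma := by
    rw [Params.kappa]
    field_simp
  rw [this]
  ring

/-! ### Local equilibrium in the limit. -/

namespace HydrodynamicLimit

theorem smooth_fε (H : HydrodynamicLimit P I fε vε pε f v p) :
    ∀ᶠ ε in 𝓝[>] (0 : ℝ), ContDiffOn ℝ 2 (ext (fε ε)) (domF I) := H.sol.mono fun _ h => h.smooth_f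

theorem kappa_pos (H : HydrodynamicLimit P I fε vε pε f v p) : 0 < P.kappa :=
  div_pos H.nu_pos H.D_pos

theorem continuous_f (H : HydrodynamicLimit P I fε vε pε f v p) (hq : q ∈ dom I) :
    Continuous (f q.1 q.2) := (sphSmooth_slice H.smooth_f hq).continuous

theorem cconv_f (H : HydrodynamicLimit P I fε vε pε f v p) {l : Filter ℝ} (hl : l ≤ 𝓝[>] (0 : ℝ))
    (hq : q ∈ dom I) : CConv l (fun ε => fε ε q.1 q.2) (f q.1 q.2) :=
  (unifConv_field H.isOpen H.conv_f).cconv hl hq (H.continuous_f hq)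

theorem nonneg (H : HydrodynamicLimit P I fε vε pε f v p) (hq : q ∈ dom I) (ω : S2) :
    0 ≤ f q.1 q.2 ω := by
  have h1 : Tendsto (fun ε => fε ε q.1 q.2 ω) (𝓝[>] (0 : ℝ)) (𝓝 (f q.1 q.2 ω)) :=
    (H.cconv_f le_rfl hq ω).comp (tendsto_id.prodMk tendsto_const_nhds)
  exact ge_of_tendsto h1 (H.sol.mono fun ε h => h.nonneg q.1 hq.1 q.2 ω)

theorem tendsto_v (H : HydrodynamicLimit P I fε vε pε f v p) (hq : q ∈ dom I) :
    Tendsto (fun ε => vε ε q.1 q.2) (𝓝[>] (0 : ℝ)) (𝓝 (v q.1 q.2)) :=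
  H.conv_v.tendsto.tendsto_at hq

theorem tendsto_gradV (H : HydrodynamicLimit P I fε vε pε f v p) (hq : q ∈ dom I) :
    Tendsto (fun ε => gradV (vε ε q.1) q.2) (𝓝[>] (0 : ℝ)) (𝓝 (gradV (v q.1) q.2)) := by
  refine tendsto_pi_nhds.2 fun i => tendsto_pi_nhds.2 fun j => ?_
  rw [gradV_eq (differentiableAt_of_contDiffOn_dom H.isOpen H.smooth_v (by norm_num) hq)]
  have h1 := (H.conv_v.tendsto_fderiv (by norm_num)).tendsto_at hq
  have h2 : Tendsto (fun ε => fderiv ℝ (unc (vε ε)) q (0, e i) j) (𝓝[>] (0 : ℝ))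
      (𝓝 (fderiv ℝ (unc v) q (0, e i) j)) :=
    ((EuclideanSpace.proj (𝕜 := ℝ) j).continuous.tendsto _).comp
      (((ContinuousLinearMap.apply ℝ E3 ((0, e i) : ST)).continuous.tendsto _).comp h1)
  refine h2.congr' (H.sol.mono fun ε h => ?_)
  exact (gradV_eq (differentiableAt_of_contDiffOn_dom H.isOpen h.smooth_v (by norm_num) hq) i j).symm

theorem tendsto_strain (H : HydrodynamicLimit P I fε vε pε f v p) (hq : q ∈ dom I) (lam : ℝ) :
    Tendsto (fun ε => strain lam (vε ε) q) (𝓝[>] (0 : ℝ)) (𝓝 (strain lam v q)) := by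
  have h := H.tendsto_gradV hq
  have hT := (continuous_id.matrix_transpose.tendsto _).comp h
  exact (((h.add hT).const_smul _).const_smul lam).add ((h.sub hT).const_smul _)

/-- The test function may depend on `ε`, as the collision invariant follows `ω̄^ε`, and the filter
may be finer, as limits of `ω̄^ε` are first taken along ultrafilters. -/
theorem tendsto_transport (H : HydrodynamicLimit P I fε vε pε f v p) {l : Filter ℝ}
    (hl : l ≤ 𝓝[>] (0 : ℝ)) (hq : q ∈ dom I) {ψε : ℝ → S2 → ℝ} {ψ : S2 → ℝ}
    (hψε : ∀ᶠ ε in l, SphSmooth 2 (ψε ε)) (hψ : SphSmooth 2 ψ) (h1 : CConv l ψε ψ)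
    (h2 : CConv l (fun ε => sphGrad (ψε ε)) (sphGrad ψ)) :
    Tendsto (fun ε => transport P (fε ε) (vε ε) q (ψε ε)) l (𝓝 (transport P f v q ψ)) := by
  have hD : CConv l (fun ε ω => stD (fε ε) q ω) (stD f q) :=
    (unifConv_stD H.isOpen H.conv_f).cconv hl hq
      (continuous_slice (continuousOn_stD H.isOpen H.smooth_f) hq)
  have hv : CConv l (fun ε (ω : S2) => ((1, vε ε q.1 q.2 + P.a • (ω : E3)) : ST))
      (fun ω : S2 => (1, v q.1 q.2 + P.a • (ω : E3))) :=
    (CConv.of_tendsto tendsto_const_nhds).prodMk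
      ((CConv.of_tendsto ((H.tendsto_v hq).mono_left hl)).add (CConv.of_continuous (by fun_prop)))
  have hA : CConv l (fun ε (ω : S2) => act (strain P.lam (vε ε) q) (ω : E3))
      (fun ω : S2 => act (strain P.lam v q) (ω : E3)) :=
    ((CConv.of_tendsto ((H.tendsto_strain hq P.lam).mono_left hl)).prodMk
      (CConv.of_continuous continuous_subtype_val)).map continuous_act
  refine ((h1.mul (hD.clm_apply hv)).integral ?_ ?_).sub
    (((H.cconv_f hl hq).mul (h2.inner hA)).integral ?_ ?_)
  · filter_upwards [hψε, hl H.smooth_fε] with ε a1 a2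
    exact a1.continuous.mul (continuous_stD_apply H.isOpen a2 hq (by fun_prop))
  · exact hψ.continuous.mul (continuous_stD_apply H.isOpen H.smooth_f hq (by fun_prop))
  · filter_upwards [hψε, hl H.smooth_fε] with ε a1 a2
    exact (sphSmooth_slice a2 hq).continuous.mul (a1.sphGrad.continuous.inner
      ((actL (strain P.lam (vε ε) q)).continuous.comp continuous_subtype_val))
  · exact (H.continuous_f hq).mul (hψ.sphGrad.continuous.inner
      ((actL (strain P.lam v q)).continuous.comp continuous_subtype_val))

theorem tendsto_density (H : HydrodynamicLimit P I fε vε pε f v p) (hq : q ∈ dom I) :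
    Tendsto (fun ε => density (fε ε q.1 q.2)) (𝓝[>] (0 : ℝ)) (𝓝 (density (f q.1 q.2))) :=
  (H.cconv_f le_rfl hq).integral
    (H.smooth_fε.mono fun _ h => (sphSmooth_slice h hq).continuous) (H.continuous_f hq)

theorem norm_nonlocalOrientation (H : HydrodynamicLimit P I fε vε pε f v p) (hq : q ∈ dom I)
    (hρ : density (f q.1 q.2) ≠ 0) :
    ∀ᶠ ε in 𝓝[>] (0 : ℝ), ‖nonlocalOrientation P ε (fε ε q.1) q.2‖ = 1 := by
  filter_upwards [(H.tendsto_density hq).eventually_ne hρ, H.sol] with ε h1 h2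
  have h3 := norm_ne_zero_iff.2 (h2.flux_ne q.1 hq.1 q.2 h1)
  rw [nonlocalOrientation, norm_smul, norm_inv, norm_norm, inv_mul_cancel₀ h3]

/-- The transport term stays convergent and carries the factor `ε`, so the collision term vanishes
in the limit for every smooth test function. -/
theorem eq_vonMises_of_tendsto (H : HydrodynamicLimit P I fε vε pε f v p) {l : Filter ℝ} [l.NeBot]
    (hl : l ≤ 𝓝[>] (0 : ℝ)) (hq : q ∈ dom I) {Ω : S2}
    (hΩ : Tendsto (fun ε => nonlocalOrientation P ε (fε ε q.1) q.2) l (𝓝 (Ω : E3))) (ω : S2) :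
    f q.1 q.2 ω = density (f q.1 q.2) * vonMises P.kappa Ω ω := by
  refine eq_vonMises_of_weak (sphSmooth_slice H.smooth_f hq) (fun ψ hψ => ?_) ω
  have cg := hψ.sphGrad.continuous
  have cL := continuous_sphLap hψ
  have hε : Tendsto (fun ε : ℝ => ε) l (𝓝 0) :=
    (tendsto_id.mono_left nhdsWithin_le_nhds).mono_left hl
  have h1 := hε.mul (H.tendsto_transport hl hq (.of_forall fun _ => hψ) hψ
    (CConv.of_continuous hψ.continuous) (CConv.of_continuous cg))
  have h2 : Tendsto (fun ε => P.D * ∫ ω, fε ε q.1 q.2 ω * (sphLap ψ ω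
      + P.kappa * inner ℝ (nonlocalOrientation P ε (fε ε q.1) q.2) (sphGrad ψ ω)) ∂sigma) l
      (𝓝 (P.D * ∫ ω, f q.1 q.2 ω * (sphLap ψ ω
        + P.kappa * inner ℝ (Ω : E3) (sphGrad ψ ω)) ∂sigma)) := by
    refine Tendsto.const_mul _ (CConv.integral ((H.cconv_f hl hq).mul
      ((CConv.of_continuous cL).add ((CConv.of_tendsto tendsto_const_nhds).mul
        ((CConv.of_tendsto hΩ).inner (CConv.of_continuous cg))))) ?_ ?_)
    · filter_upwards [hl H.smooth_fε] with ε a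
      exact (sphSmooth_slice a hq).continuous.mul
        (cL.add (continuous_const.mul (continuous_const.inner cg)))
    · exact (H.continuous_f hq).mul (cL.add (continuous_const.mul (continuous_const.inner cg)))
  have h3 := tendsto_nhds_unique (h2.congr' ((H.sol.filter_mono hl).mono fun ε h =>
    (h.weak_transport H.D_pos.ne' H.isOpen hq hψ).symm)) h1
  rw [zero_mul] at h3
  exact (mul_eq_zero.1 h3).resolve_left H.D_pos.ne'

/-- Compactness of the unit sphere; ultrafilters replace the extraction of subsequences. -/
theorem exists_tendsto_ultrafilter (H : HydrodynamicLimit P I fε vε pε f v p)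
    (hq : q ∈ dom I) (hρ : density (f q.1 q.2) ≠ 0) (u : Ultrafilter ℝ) (hu : ↑u ≤ 𝓝[>] (0 : ℝ)) :
    ∃ Ω : S2, Tendsto (fun ε => nonlocalOrientation P ε (fε ε q.1) q.2) u (𝓝 (Ω : E3)) := by
  have hmem : ↑(u.map fun ε => nonlocalOrientation P ε (fε ε q.1) q.2) ≤
      𝓟 (Metric.sphere (0 : E3) 1) := by
    rw [le_principal_iff]
    have h : ∀ᶠ ε in (u : Filter ℝ), ‖nonlocalOrientation P ε (fε ε q.1) q.2‖ = 1 :=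
      (H.norm_nonlocalOrientation hq hρ).filter_mono hu
    exact h.mono fun ε h => by simpa using h
  obtain ⟨Ω, hΩ, h⟩ := (isCompact_sphere (0 : E3) 1).ultrafilter_le_nhds _ hmem
  exact ⟨⟨Ω, hΩ⟩, h⟩

theorem exists_equilibrium (H : HydrodynamicLimit P I fε vε pε f v p) (hq : q ∈ dom I) :
    ∃ Ω : S2, ∀ ω, f q.1 q.2 ω = density (f q.1 q.2) * vonMises P.kappa Ω ω := by
  by_cases hρ : density (f q.1 q.2) = 0
  -- In vacuum the limit vanishes identically and any direction serves.
  · exact ⟨pole, fun ω => by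
      rw [hρ, zero_mul, eq_zero_of_density_eq_zero (H.continuous_f hq) (H.nonneg hq) hρ]⟩
  · obtain ⟨Ω, hΩ⟩ := H.exists_tendsto_ultrafilter hq hρ (Ultrafilter.of (𝓝[>] (0 : ℝ)))
      (Ultrafilter.of_le _)
    exact ⟨Ω, H.eq_vonMises_of_tendsto (Ultrafilter.of_le _) hq hΩ⟩

theorem flux_eq (hΩ : ∀ ω, f q.1 q.2 ω = density (f q.1 q.2) * vonMises P.kappa Ω ω) :
    flux (f q.1 q.2) = c1 P.kappa • (density (f q.1 q.2) • (Ω : E3)) := by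
  conv_lhs => rw [funext hΩ]
  rw [flux_smul, flux_vonMises, smul_comm]

/-- The nonlocal orientation converges to the macroscopic one outside vacuum. -/
theorem tendsto_nonlocalOrientation (H : HydrodynamicLimit P I fε vε pε f v p) (hq : q ∈ dom I)
    (hρ : density (f q.1 q.2) ≠ 0) {Ω : S2}
    (hΩ : ∀ ω, f q.1 q.2 ω = density (f q.1 q.2) * vonMises P.kappa Ω ω) :
    Tendsto (fun ε => nonlocalOrientation P ε (fε ε q.1) q.2) (𝓝[>] (0 : ℝ)) (𝓝 (Ω : E3)) := by
  -- Every limit point `Ω'` represents the same `f` as an equilibrium. Comparing fluxes, `c₁ρΩ =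
  -- c₁ρΩ'` with `c₁ρ ≠ 0`, so all limit points coincide with `Ω`.
  rw [tendsto_iff_ultrafilter]
  intro u hu
  obtain ⟨Ω', h⟩ := H.exists_tendsto_ultrafilter hq hρ u hu
  have h1 := flux_eq (H.eq_vonMises_of_tendsto hu hq h)
  rw [flux_eq hΩ] at h1
  have h2 := smul_right_injective _ hρ (smul_right_injective _ (c1_pos H.kappa_pos).ne' h1)
  rw [h2]
  exact h

end HydrodynamicLimit

end

/-! ### Joint convergence -/

section Joint

variable {X Y : Type*} [TopologicalSpace X] [UniformSpace Y] {F : ℝ → X → Y} {f : X → Y}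
  {l : Filter ℝ} {U : Set X}

/-- Joint limits make it possible to apply the nonlinear normalisation `j ↦ j/|j|` by mere
continuity. -/
theorem tendsto_uncurry_of_tendstoLocallyUniformlyOn (h : TendstoLocallyUniformlyOn F f l U)
    (hf : ContinuousOn f U) {x : X} (hx : x ∈ U) :
    Tendsto (Function.uncurry F) (l ×ˢ 𝓝[U] x) (𝓝 (f x)) := by
  rw [tendstoLocallyUniformlyOn_iff_forall_tendsto] at h
  exact Uniform.tendsto_nhds_right.2
    (((Uniform.tendsto_nhds_right.1 ((hf x hx).tendsto.comp tendsto_snd)).uniformity_trans (h x hx)))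

theorem tendstoLocallyUniformlyOn_of_tendsto_uncurry (hf : ContinuousOn f U)
    (h : ∀ x ∈ U, Tendsto (Function.uncurry F) (l ×ˢ 𝓝[U] x) (𝓝 (f x))) :
    TendstoLocallyUniformlyOn F f l U := by
  rw [tendstoLocallyUniformlyOn_iff_forall_tendsto]
  intro x hx
  exact (((hf x hx).tendsto.comp tendsto_snd).prodMk_nhds (h x hx)).mono_right
    (nhds_le_uniformity _)

end Joint

/-- The field of fluxes, assembled from its coordinates. -/
noncomputable def fluxField (f : ℝ → E3 → S2 → ℝ) (q : ST) : E3 :=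
  WithLp.toLp 2 fun i => moment (fun ω => (ω : E3) i) f q

section

variable {I : Set ℝ} {f : ℝ → E3 → S2 → ℝ} {q : ST}

theorem flux_eq_fluxField (hf : ContDiffOn ℝ 2 (ext f) (domF I)) (hq : q ∈ dom I) :
    flux (f q.1 q.2) = fluxField f q := by
  ext i
  exact flux_eq_moment hf hq i

theorem contDiffOn_fluxField (hI : IsOpen I) (hf : ContDiffOn ℝ 2 (ext f) (domF I)) :
    ContDiffOn ℝ 2 (fluxField f) (dom I) :=
  contDiffOn_euclidean.2 fun i => contDiffOn_moment hI hf (continuous_coord i)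

theorem contDiffOn_flux (hI : IsOpen I) (hf : ContDiffOn ℝ 2 (ext f) (domF I)) :
    ContDiffOn ℝ 2 (fun q : ST => flux (f q.1 q.2)) (dom I) :=
  (contDiffOn_fluxField hI hf).congr fun _ hq => flux_eq_fluxField hf hq

theorem contDiffOn_density (hI : IsOpen I) (hf : ContDiffOn ℝ 2 (ext f) (domF I)) :
    ContDiffOn ℝ 2 (fun q : ST => density (f q.1 q.2)) (dom I) :=
  (contDiffOn_moment hI hf continuous_const).congr fun q _ => density_eq_moment f q

theorem integral_mul_stD_const (hI : IsOpen I) (hf : ContDiffOn ℝ 2 (ext f) (domF I))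
    (hq : q ∈ dom I) {φ : S2 → ℝ} (hφ : Continuous φ) (w : ST) :
    ∫ ω, φ ω * stD f q ω w ∂sigma = fderiv ℝ (moment φ f) q w := by
  have hi : Integrable (fun ω => φ ω • stD f q ω) sigma :=
    continuous_integrable (hφ.smul (continuous_slice (continuousOn_stD hI hf) hq))
  rw [fderiv_moment hI hf hφ hq, ContinuousLinearMap.integral_apply hi]
  rfl

theorem stD_space_coe (q : ST) (ω : S2) :
    stD f q ω (0, (ω : E3)) = ∑ i, (ω : E3) i * stD f q ω (0, e i) := by
  have h : ((0, (ω : E3)) : ST) = ∑ i, (ω : E3) i • ((0, e i) : ST) := by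
    conv_lhs => rw [← sum_e (ω : E3)]
    simp [Fin.sum_univ_three]
  rw [h, map_sum]
  exact Finset.sum_congr rfl fun i _ => by rw [map_smul, smul_eq_mul]

theorem integral_stD_space_coe (hI : IsOpen I) (hf : ContDiffOn ℝ 2 (ext f) (domF I))
    (hq : q ∈ dom I) :
    ∫ ω, stD f q ω (0, (ω : E3)) ∂sigma =
      ∑ i, fderiv ℝ (moment (fun ω => (ω : E3) i) f) q (0, e i) := by
  simp only [stD_space_coe]
  have hi : ∀ i, Integrable (fun ω : S2 => (ω : E3) i * stD f q ω (0, e i)) sigma := fun i =>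
    continuous_integrable ((continuous_coord i).mul
      (continuous_stD_apply hI hf hq continuous_const))
  rw [integral_finsetSum _ fun i _ => hi i]
  exact Finset.sum_congr rfl fun i _ => integral_mul_stD_const hI hf hq (continuous_coord i) _

theorem sphLap_const (c : ℝ) (ω : S2) : sphLap (fun _ => c) ω = 0 := by
  rw [sphLap, lapl_eq_sum]
  simp

end

/-! ### Regularity of the limit, convergence of orientations and the continuity equation. -/

namespace HydrodynamicLimit

variable {P : Params} {I : Set ℝ} {fε : ℝ → ℝ → E3 → S2 → ℝ} {vε : ℝ → ℝ → E3 → E3}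
  {pε : ℝ → ℝ → E3 → ℝ} {f : ℝ → E3 → S2 → ℝ} {v : ℝ → E3 → E3} {p : ℝ → E3 → ℝ} {q : ST}

theorem tendstoLocallyUniformlyOn_density (H : HydrodynamicLimit P I fε vε pε f v p) :
    TendstoLocallyUniformlyOn (fun ε => unc fun t x => density (fε ε t x))
      (unc fun t x => density (f t x)) (𝓝[>] (0 : ℝ)) (dom I) := by
  have h := tendsto_moment H.isOpen H.conv_f H.smooth_fε H.smooth_f (φ := fun _ => 1)
    continuous_const
  have e1 : ∀ f : ℝ → E3 → S2 → ℝ, (unc fun t x => density (f t x)) = moment (fun _ => 1) f :=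
    fun f => funext fun q => density_eq_moment f q
  simp only [e1]
  exact h

theorem tendsto_uncurry_flux (H : HydrodynamicLimit P I fε vε pε f v p) (hq : q ∈ dom I) :
    Tendsto (Function.uncurry fun ε (q : ST) => flux (fε ε q.1 q.2)) (𝓝[>] (0 : ℝ) ×ˢ 𝓝 q)
      (𝓝 (flux (f q.1 q.2))) := by
  have hopen := isOpen_dom H.isOpen
  have h1 : Tendsto (Function.uncurry fun ε => fluxField (fε ε)) (𝓝[>] (0 : ℝ) ×ˢ 𝓝 q)
      (𝓝 (fluxField f q)) := by
    refine ((PiLp.continuous_toLp 2 _).tendsto _).comp (tendsto_pi_nhds.2 fun i => ?_)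
    have := tendsto_uncurry_of_tendstoLocallyUniformlyOn
      (tendsto_moment H.isOpen H.conv_f H.smooth_fε H.smooth_f (continuous_coord i))
      (contDiffOn_moment H.isOpen H.smooth_f (continuous_coord i)).continuousOn hq
    rw [hopen.nhdsWithin_eq hq] at this
    exact this
  rw [flux_eq_fluxField H.smooth_f hq]
  refine h1.congr' ?_
  filter_upwards [Filter.Eventually.prod_mk H.smooth_fε (hopen.mem_nhds hq)] with z hz
  exact (flux_eq_fluxField hz.1 hz.2).symm

theorem density_nonneg (H : HydrodynamicLimit P I fε vε pε f v p) (hq : q ∈ dom I) :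
    0 ≤ density (f q.1 q.2) := integral_nonneg (H.nonneg hq)

theorem normalize_flux (H : HydrodynamicLimit P I fε vε pε f v p) {Ω : S2}
    (hΩ : ∀ ω, f q.1 q.2 ω = density (f q.1 q.2) * vonMises P.kappa Ω ω)
    (hρ : 0 < density (f q.1 q.2)) : ‖flux (f q.1 q.2)‖⁻¹ • flux (f q.1 q.2) = (Ω : E3) := by
  have hc : 0 < c1 P.kappa * density (f q.1 q.2) := mul_pos (c1_pos H.kappa_pos) hρ
  have h : flux (f q.1 q.2) = (c1 P.kappa * density (f q.1 q.2)) • (Ω : E3) := by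
    rw [flux_eq hΩ, smul_smul]
  rw [h, norm_smul, S2.norm_eq, mul_one, Real.norm_eq_abs, abs_of_pos hc, smul_smul,
    inv_mul_cancel₀ hc.ne', one_smul]

theorem flux_ne_zero (H : HydrodynamicLimit P I fε vε pε f v p) {Ω : S2}
    (hΩ : ∀ ω, f q.1 q.2 ω = density (f q.1 q.2) * vonMises P.kappa Ω ω)
    (hρ : 0 < density (f q.1 q.2)) : flux (f q.1 q.2) ≠ 0 := by
  rw [flux_eq hΩ]
  exact smul_ne_zero (c1_pos H.kappa_pos).ne' (smul_ne_zero hρ.ne' (S2.ne_zero Ω))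

section Macro

variable {Ω : ℝ → E3 → S2}

theorem isOpen_positive (H : HydrodynamicLimit P I fε vε pε f v p) :
    IsOpen {q ∈ dom I | 0 < density (f q.1 q.2)} :=
  (contDiffOn_density H.isOpen H.smooth_f).continuousOn.isOpen_inter_preimage
    (isOpen_dom H.isOpen) isOpen_Ioi

/-- Near points of positive density `Ω = j/|j|` with `j` of class `C²` and nonzero. -/
theorem contDiffAt_orientation (H : HydrodynamicLimit P I fε vε pε f v p)
    (hΩ : ∀ t ∈ I, ∀ x ω, f t x ω = density (f t x) * vonMises P.kappa (Ω t x) ω)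
    (hq : q ∈ dom I) (hρ : 0 < density (f q.1 q.2)) :
    ContDiffAt ℝ 2 (unc fun t x => (Ω t x : E3)) q := by
  have h1 : ContDiffAt ℝ 2 (fun q : ST => flux (f q.1 q.2)) q :=
    (contDiffOn_flux H.isOpen H.smooth_f).contDiffAt ((isOpen_dom H.isOpen).mem_nhds hq)
  have h0 := H.flux_ne_zero (hΩ q.1 hq.1 q.2) hρ
  refine (((h1.norm ℝ h0).inv (norm_ne_zero_iff.2 h0)).smul h1).congr_of_eventuallyEq ?_
  filter_upwards [H.isOpen_positive.mem_nhds ⟨hq, hρ⟩] with z hz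
  exact (H.normalize_flux (hΩ z.1 hz.1.1 z.2) hz.2).symm

theorem tendstoLocallyUniformlyOn_meanOrientation (H : HydrodynamicLimit P I fε vε pε f v p)
    (hΩ : ∀ t ∈ I, ∀ x ω, f t x ω = density (f t x) * vonMises P.kappa (Ω t x) ω) :
    TendstoLocallyUniformlyOn (fun ε => unc fun t x => meanOrientation (fε ε t x))
      (unc fun t x => (Ω t x : E3)) (𝓝[>] (0 : ℝ))
      {q ∈ dom I | 0 < density (f q.1 q.2)} := by
  refine tendstoLocallyUniformlyOn_of_tendsto_uncurry (fun q hq =>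
    (H.contDiffAt_orientation hΩ hq.1 hq.2).continuousAt.continuousWithinAt) fun q hq => ?_
  rw [H.isOpen_positive.nhdsWithin_eq hq]
  have h1 := H.tendsto_uncurry_flux hq.1
  have h0 := H.flux_ne_zero (hΩ q.1 hq.1.1 q.2) hq.2
  have h2 := (h1.norm.inv₀ (norm_ne_zero_iff.2 h0)).smul h1
  rw [H.normalize_flux (hΩ q.1 hq.1.1 q.2) hq.2] at h2
  exact h2

/-- The product `ρΩ` is a constant multiple of the flux, so it is regular even where `Ω` is
arbitrary. -/
theorem density_smul_orientation (H : HydrodynamicLimit P I fε vε pε f v p)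
    (hΩ : ∀ t ∈ I, ∀ x ω, f t x ω = density (f t x) * vonMises P.kappa (Ω t x) ω)
    (hq : q ∈ dom I) : density (f q.1 q.2) • (Ω q.1 q.2 : E3) =
      (c1 P.kappa)⁻¹ • flux (f q.1 q.2) := by
  rw [flux_eq (hΩ q.1 hq.1 q.2), smul_smul, inv_mul_cancel₀ (c1_pos H.kappa_pos).ne', one_smul]

theorem contDiffOn_density_smul_orientation (H : HydrodynamicLimit P I fε vε pε f v p)
    (hΩ : ∀ t ∈ I, ∀ x ω, f t x ω = density (f t x) * vonMises P.kappa (Ω t x) ω) :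
    ContDiffOn ℝ 2 (unc fun t x => density (f t x) • (Ω t x : E3)) (dom I) :=
  ((contDiffOn_flux H.isOpen H.smooth_f).const_smul (c1 P.kappa)⁻¹).congr
    fun _ hq => H.density_smul_orientation hΩ hq

theorem incompressible (H : HydrodynamicLimit P I fε vε pε f v p) (hq : q ∈ dom I) :
    divg (v q.1) q.2 = 0 := by
  have e1 : ∀ v : ℝ → E3 → E3, divg (v q.1) q.2 = (gradV (v q.1) q.2).trace := fun v => rfl
  have h1 := (continuous_id.matrix_trace.tendsto _).comp (H.tendsto_gradV hq)
  have h2 : ∀ᶠ ε in 𝓝[>] (0 : ℝ), (gradV (vε ε q.1) q.2).trace = 0 :=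
    H.sol.mono fun ε h => h.incompressible q.1 hq.1 q.2
  rw [e1]
  exact tendsto_nhds_unique h1 (tendsto_const_nhds.congr' (h2.mono fun ε h => h.symm))

/-- Mass is a collision invariant: the generator annihilates constants, so the factor `ε` can be
divided out before the limit. -/
theorem transport_one (H : HydrodynamicLimit P I fε vε pε f v p) (hq : q ∈ dom I) :
    transport P f v q (fun _ => 1) = 0 := by
  have h1 := H.tendsto_transport le_rfl hq (ψε := fun _ _ => 1) (ψ := fun _ => 1)
    (.of_forall fun _ => sphSmooth_const 1) (sphSmooth_const 1)
    (CConv.of_continuous continuous_const)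
    (CConv.of_continuous (sphSmooth_const (n := 2) (1 : ℝ)).sphGrad.continuous)
  refine tendsto_nhds_unique h1 (tendsto_const_nhds.congr' ?_)
  filter_upwards [H.sol, self_mem_nhdsWithin] with ε h hε
  have h2 := h.weak_transport H.D_pos.ne' H.isOpen hq (ψ := fun _ => 1) (sphSmooth_const 1)
  simp only [sphLap_const, sphGrad_const, inner_zero_right, mul_zero, add_zero,
    integral_zero] at h2
  exact ((mul_eq_zero.1 h2).resolve_left (ne_of_gt hε)).symm

/-- The transport term tested with `1` is `∂_tρ + v·∇ρ + a ∇·j`, where `j = c₁ρΩ` and `v` is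
divergence free. -/
theorem continuity (H : HydrodynamicLimit P I fε vε pε f v p)
    (hΩ : ∀ t ∈ I, ∀ x ω, f t x ω = density (f t x) * vonMises P.kappa (Ω t x) ω)
    {t : ℝ} (ht : t ∈ I) (x : E3) :
    deriv (fun s => density (f s x)) t
      + divg (fun y => density (f t y) • velU P (Ω t y) (v t y)) x = 0 := by
  have hq := mem_dom ht x
  have hU := isOpen_dom H.isOpen
  have hρ : DifferentiableAt ℝ (moment (fun _ => 1) f) (t, x) :=
    (hasFDerivAt_moment H.isOpen H.smooth_f continuous_const hq).differentiableAt
  have hj : DifferentiableAt ℝ (fluxField f) (t, x) :=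
    differentiableAt_of_contDiffOn_dom H.isOpen (contDiffOn_fluxField H.isOpen H.smooth_f)
      (by norm_num) hq
  have hv : DifferentiableAt ℝ (unc v) (t, x) :=
    differentiableAt_of_contDiffOn_dom H.isOpen H.smooth_v (by norm_num) hq
  have h0 := H.transport_one hq
  have e0 : ∀ ω : S2, (1 : ℝ) * stD f (t, x) ω (1, v t x + P.a • (ω : E3)) =
      (1 : ℝ) * stD f (t, x) ω (1, v t x) + P.a * stD f (t, x) ω (0, (ω : E3)) := fun ω => by
    have : ((1, v t x + P.a • (ω : E3)) : ST) = (1, v t x) + P.a • (0, (ω : E3)) := by simp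
    rw [this, map_add, map_smul, smul_eq_mul]
    ring
  simp only [transport, sphGrad_const, inner_zero_left, mul_zero, integral_zero, sub_zero, e0] at h0
  rw [sphere_integral_add
      ((continuous_stD_apply H.isOpen H.smooth_f hq continuous_const).const_mul _)
      ((continuous_stD_apply H.isOpen H.smooth_f hq (by fun_prop)).const_mul _),
    integral_mul_stD_const H.isOpen H.smooth_f hq continuous_const,
    integral_const_mul, integral_stD_space_coe H.isOpen H.smooth_f hq, map_time_space] at h0
  have e1 : (fun y => density (f t y) • velU P (Ω t y) (v t y)) =
      fun y => P.a • fluxField f (t, y) + moment (fun _ => 1) f (t, y) • unc v (t, y) := by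
    funext y
    have hy := mem_dom ht y
    have hfl : flux (f t y) = c1 P.kappa • (density (f t y) • (Ω t y : E3)) :=
      flux_eq (q := (t, y)) (hΩ t ht y)
    rw [← flux_eq_fluxField H.smooth_f hy, ← density_eq_moment, velU, smul_add]
    simp only [unc]
    congr 1
    rw [hfl]
    simp only [smul_smul]
    congr 1
    ring
  have e2 : (fun s => density (f s x)) = fun s => moment (fun _ => 1) f (s, x) :=
    funext fun s => density_eq_moment f (s, x)
  have hjs := (hasFDerivAt_space_slice hj.hasFDerivAt).differentiableAt
  have hρs := (hasFDerivAt_space_slice hρ.hasFDerivAt).differentiableAt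
  have hvs := (hasFDerivAt_space_slice hv.hasFDerivAt).differentiableAt
  have hdiv : divg (fun y => unc v (t, y)) x = 0 := H.incompressible hq
  have e3 : divg (fun y => P.a • fluxField f (t, y) + moment (fun _ => 1) f (t, y) • unc v (t, y)) x
      = P.a * divg (fun y => fluxField f (t, y)) x
        + divg (fun y => moment (fun _ => 1) f (t, y) • unc v (t, y)) x := by
    simp only [divg]
    have a1 : DifferentiableAt ℝ (fun y => P.a • fluxField f (t, y)) x := hjs.fun_const_smul _
    have a2 : DifferentiableAt ℝ (fun y => moment (fun _ => 1) f (t, y) • unc v (t, y)) x :=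
      hρs.smul hvs
    rw [fderiv_fun_add a1 a2, fderiv_fun_const_smul hjs]
    simp [Finset.sum_add_distrib, Finset.mul_sum]
  have e4 : divg (fun y => fluxField f (t, y)) x =
      ∑ i, fderiv ℝ (moment (fun ω => (ω : E3) i) f) (t, x) (0, e i) := by
    simp only [divg]
    refine Finset.sum_congr rfl fun i _ => ?_
    rw [fderiv_space_slice hj.hasFDerivAt, ← fderiv_apply_coord hj]
    rfl
  rw [e1, e2, (hasDerivAt_time_slice hρ.hasFDerivAt).deriv, e3, e4, divg_smul hρs hvs, hdiv,
    fderiv_space_slice hρ.hasFDerivAt]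
  simp only [unc]
  linarith

end Macro

end HydrodynamicLimit

/-! ### The generalised collision invariant as a test function -/

/-- The test function `H(Ω·ω) (w·ω)`. -/
noncomputable def gciTest (H : ℝ → ℝ) (Ω : S2) (w : E3) (ω : S2) : ℝ :=
  H (inner ℝ (Ω : E3) (ω : E3)) * inner ℝ w (ω : E3)

section Test

variable {H : ℝ → ℝ}

theorem sphSmooth_zonal {n : WithTop ℕ∞} (hH : ContDiff ℝ n H) (Ω : S2) :
    SphSmooth n fun ω : S2 => H (inner ℝ (Ω : E3) (ω : E3)) :=
  SphSmooth.comp hH (sphSmooth_inner_left _)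

theorem sphSmooth_gciTest {n : WithTop ℕ∞} (hH : ContDiff ℝ n H) (Ω : S2) (w : E3) :
    SphSmooth n (gciTest H Ω w) :=
  (sphSmooth_zonal hH Ω).mul (sphSmooth_inner_left w)

theorem sphGrad_zonal (hH : ContDiff ℝ 1 H) (Ω ω : S2) :
    sphGrad (fun ω : S2 => H (inner ℝ (Ω : E3) (ω : E3))) ω =
      deriv H (inner ℝ (Ω : E3) (ω : E3)) • proj ω (Ω : E3) := by
  have := sphGrad_comp (hH.differentiable one_ne_zero) (sphSmooth_inner_left (n := 1) (Ω : E3)) ω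
  rwa [sphGrad_inner] at this

theorem sphGrad_gciTest (hH : ContDiff ℝ 1 H) (Ω : S2) (w : E3) (ω : S2) :
    sphGrad (gciTest H Ω w) ω =
      (deriv H (inner ℝ (Ω : E3) (ω : E3)) * inner ℝ w (ω : E3)) • proj ω (Ω : E3)
        + H (inner ℝ (Ω : E3) (ω : E3)) • proj ω w := by
  have h := sphGrad_mul (sphSmooth_zonal hH Ω) (sphSmooth_inner_left (n := 1) w) ω
  rw [sphGrad_inner, sphGrad_zonal hH, smul_smul] at h
  rw [← add_comm, mul_comm (deriv H _)]
  exact h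

/-- With `μ = Ω·ω`, the coefficient `-4μ` of `H'` comes half from the Laplacian of `μ` and half from
the cross term `∇μ·∇(w·ω) = -μ (w·ω)`; the first spherical harmonic `w·ω` gives `-2H`. -/
theorem sphLap_gciTest (hH : ContDiff ℝ 2 H) {Ω : S2} {w : E3} (hw : inner ℝ (Ω : E3) w = 0)
    (ω : S2) : sphLap (gciTest H Ω w) ω = inner ℝ w (ω : E3) *
      ((1 - inner ℝ (Ω : E3) (ω : E3) ^ 2) * deriv (deriv H) (inner ℝ (Ω : E3) (ω : E3))
        - 4 * inner ℝ (Ω : E3) (ω : E3) * deriv H (inner ℝ (Ω : E3) (ω : E3))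
        - 2 * H (inner ℝ (Ω : E3) (ω : E3))) := by
  have hH1 : ContDiff ℝ 1 H := hH.of_le (by norm_num)
  have hH' : ContDiff ℝ 1 (deriv H) := by
    have h2 : ContDiff ℝ (1 + 1) H := hH
    exact (contDiff_succ_iff_deriv.1 h2).2.2
  have hwS := sphSmooth_inner_left (n := 1) w
  have s1 : SphSmooth 1 fun ω : S2 =>
      deriv H (inner ℝ (Ω : E3) (ω : E3)) * inner ℝ w (ω : E3) := (sphSmooth_zonal hH' Ω).mul hwS
  have s2 := sphSmooth_zonal hH1 Ω
  have pΩ : SphSmooth 1 fun ω : S2 => proj ω (Ω : E3) := (sphSmooth_const _).proj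
  have pw : SphSmooth 1 fun ω : S2 => proj ω w := (sphSmooth_const _).proj
  rw [sphLap_eq_sphDiv (sphSmooth_gciTest hH Ω w), funext (sphGrad_gciTest hH1 Ω w),
    sphDiv_add (s1.smul pΩ) (s2.smul pw), sphDiv_smul s1 pΩ, sphDiv_smul s2 pw, sphDiv_proj,
    sphDiv_proj, sphGrad_zonal hH1, sphGrad_mul (sphSmooth_zonal hH' Ω) hwS, sphGrad_zonal hH',
    sphGrad_inner, inner_add_left]
  simp only [real_inner_smul_left, inner_proj_proj, S2.inner_self, real_inner_comm (Ω : E3) w, hw]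
  simp only [real_inner_comm (ω : E3)]
  ring

/-- The differential equation for the profile is this identity divided by `w·ω`. Integrated against
any `f`, the generator thus returns `w·j`, which vanishes when `w` is orthogonal to the flux. -/
theorem IsSmoothProfile.generator_gciTest {κ : ℝ} (h : IsSmoothProfile κ H) {Ω : S2} {w : E3}
    (hw : inner ℝ (Ω : E3) w = 0) (ω : S2) :
    sphLap (gciTest H Ω w) ω + κ * inner ℝ (Ω : E3) (sphGrad (gciTest H Ω w) ω) =
      inner ℝ w (ω : E3) := by
  have hs := (h.solves _ (S2.inner_mem Ω ω)).eq
  have e1 : inner ℝ (Ω : E3) (proj ω (Ω : E3)) = 1 - inner ℝ (Ω : E3) (ω : E3) ^ 2 := by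
    simp only [proj, inner_sub_right, real_inner_smul_right, S2.inner_self, real_inner_comm (ω : E3)]
    rw [real_inner_comm]
    ring
  have e2 : inner ℝ (Ω : E3) (proj ω w) = -(inner ℝ w (ω : E3) * inner ℝ (Ω : E3) (ω : E3)) := by
    simp only [proj, inner_sub_right, real_inner_smul_right, hw]
    rw [real_inner_comm w]
    ring
  rw [sphLap_gciTest h.contDiff hw, sphGrad_gciTest (h.contDiff.of_le (by norm_num)),
    inner_add_right, real_inner_smul_right, real_inner_smul_right, e1, e2]
  linear_combination inner ℝ w (ω : E3) * hs

theorem integral_gciTest_mul_vonMises (κ : ℝ) {Ω : S2} {w : E3}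
    (hw : inner ℝ (Ω : E3) w = 0) :
    ∫ ω, gciTest H Ω w ω * vonMises κ Ω ω ∂sigma = 0 := by
  have := integral_zonal_mul_inner (Ω := Ω) (fun x => vmProfile κ x * H x) hw
  rw [← this]
  refine integral_congr_ae (.of_forall fun ω => ?_)
  simp only [gciTest, vonMises_eq]
  ring

theorem integral_gciTest_mul_vonMises_mul_inner (κ : ℝ) (hH : Continuous H) {Ω : S2} {w : E3}
    (hw : inner ℝ (Ω : E3) w = 0) (u : E3) :
    ∫ ω : S2, gciTest H Ω w ω * vonMises κ Ω ω * inner ℝ u (ω : E3) ∂sigma =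
      inner ℝ w u * gciMoment κ H 0 := by
  have := integral_zonal_mul_inner_mul_inner (φ := fun x => vmProfile κ x * H x) (by fun_prop) hw u
  simp only [gciMoment, pow_zero, mul_one]
  rw [← this]
  refine integral_congr_ae (.of_forall fun ω => ?_)
  simp only [gciTest, vonMises_eq]
  ring

theorem integral_gciTest_mul_vonMises_mul_quadratic (κ : ℝ) (hH : Continuous H) {Ω : S2} {w : E3}
    (hw : inner ℝ (Ω : E3) w = 0) (A : E3 →L[ℝ] E3) :
    ∫ ω : S2, gciTest H Ω w ω * vonMises κ Ω ω * inner ℝ (ω : E3) (A ω) ∂sigma =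
      (inner ℝ w (A Ω) + inner ℝ (Ω : E3) (A w)) * gciMoment κ H 1 := by
  have := integral_zonal_mul_inner_mul_quadratic (φ := fun x => vmProfile κ x * H x)
    (by fun_prop) hw A
  simp only [gciMoment, pow_one]
  rw [← this]
  refine integral_congr_ae (.of_forall fun ω => ?_)
  simp only [gciTest, vonMises_eq]
  ring

theorem integral_gciTest_mul_vonMises_mul_zonal_quadratic (κ : ℝ) (hH : Continuous H) {Ω : S2}
    {w : E3} (hw : inner ℝ (Ω : E3) w = 0) (A : E3 →L[ℝ] E3) :
    ∫ ω : S2, gciTest H Ω w ω * vonMises κ Ω ω *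
        (inner ℝ (Ω : E3) (ω : E3) * inner ℝ (ω : E3) (A ω)) ∂sigma =
      (inner ℝ w (A Ω) + inner ℝ (Ω : E3) (A w)) * gciMoment κ H 2 := by
  have := integral_zonal_mul_inner_mul_quadratic (φ := fun x => vmProfile κ x * H x * x)
    (by fun_prop) hw A
  have e1 : gciMoment κ H 2 = ∫ x in (-1 : ℝ)..1, vmProfile κ x * H x * x * x * (1 - x ^ 2) / 4 :=
    intervalIntegral.integral_congr fun x _ => by ring
  rw [e1, ← this]
  refine integral_congr_ae (.of_forall fun ω => ?_)
  simp only [gciTest, vonMises_eq]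
  ring

/-- The rotation term tested with the generalised collision invariant. -/
theorem integral_vonMises_mul_inner_sphGrad_gciTest (κ : ℝ) (hH : ContDiff ℝ 1 H) {Ω : S2}
    {w : E3} (hw : inner ℝ (Ω : E3) w = 0) (A : E3 →L[ℝ] E3) :
    ∫ ω : S2, vonMises κ Ω ω * inner ℝ (sphGrad (gciTest H Ω w) ω) (A ω) ∂sigma =
      (3 * gciMoment κ H 1 + κ * gciMoment κ H 2) *
        (inner ℝ w (A Ω) + inner ℝ (Ω : E3) (A w))
      - κ * gciMoment κ H 0 * inner ℝ (Ω : E3) (A w) := by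
  have hHc := hH.continuous
  have hM := sphSmooth_vonMises κ Ω (n := 1)
  have hA : SphSmooth 1 fun ω : S2 => A ω := SphSmooth.clm A sphSmooth_coe
  have hψ := sphSmooth_gciTest hH Ω w
  -- The gradient is moved off the test function, so that the result contains moments of `H` only
  -- and none of its derivative.
  have h := integral_mul_sphDiv hψ (hM.smul hA.proj) fun ω => by
    rw [real_inner_smul_right, proj_inner_self, mul_zero]
  have e1 : ∀ ω : S2, inner ℝ (sphGrad (gciTest H Ω w) ω) (vonMises κ Ω ω • proj ω (A ω)) =
      vonMises κ Ω ω * inner ℝ (sphGrad (gciTest H Ω w) ω) (A ω) := fun ω => by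
    rw [real_inner_smul_right, inner_proj_of_tangent (sphGrad_tangent _ ω)]
  set Ad := ContinuousLinearMap.adjoint A with hAd
  have e2 : ∀ ω : S2, gciTest H Ω w ω * sphDiv (fun ω => vonMises κ Ω ω • proj ω (A ω)) ω =
      (∑ i, A (e i) i) * (gciTest H Ω w ω * vonMises κ Ω ω)
      + (κ * (gciTest H Ω w ω * vonMises κ Ω ω * inner ℝ (Ad Ω) (ω : E3))
      - (3 * (gciTest H Ω w ω * vonMises κ Ω ω * inner ℝ (ω : E3) (A ω))
      + κ * (gciTest H Ω w ω * vonMises κ Ω ω *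
        (inner ℝ (Ω : E3) (ω : E3) * inner ℝ (ω : E3) (A ω))))) := fun ω => by
    rw [sphDiv_smul hM hA.proj, sphDiv_proj_clm, sphGrad_vonMises, real_inner_smul_left,
      inner_proj_proj, hAd, ContinuousLinearMap.adjoint_inner_left, real_inner_comm (Ω : E3) (ω : E3)]
    ring
  simp only [e1, e2] at h
  have cψ := hψ.continuous
  have cM := hM.continuous
  have cq : Continuous fun ω : S2 => inner ℝ (ω : E3) (A ω) := by fun_prop
  rw [sphere_integral_add (by fun_prop) (by fun_prop), sphere_integral_sub (by fun_prop) (by fun_prop),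
    sphere_integral_add (by fun_prop) (by fun_prop), integral_const_mul, integral_const_mul,
    integral_const_mul, integral_const_mul, integral_gciTest_mul_vonMises κ hw,
    integral_gciTest_mul_vonMises_mul_inner κ hHc hw,
    integral_gciTest_mul_vonMises_mul_quadratic κ hHc hw,
    integral_gciTest_mul_vonMises_mul_zonal_quadratic κ hHc hw, hAd,
    ContinuousLinearMap.adjoint_inner_right, real_inner_comm (Ω : E3) (A w)] at h
  linarith

end Test

/-! ### Matrix actions -/

theorem act_add (B B' : Matrix (Fin 3) (Fin 3) ℝ) (w : E3) : act (B + B') w = act B w + act B' w := by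
  simp [act, Matrix.add_mulVec]

theorem act_smul (c : ℝ) (B : Matrix (Fin 3) (Fin 3) ℝ) (w : E3) : act (c • B) w = c • act B w := by
  simp [act, Matrix.smul_mulVec]

theorem inner_act_transpose (B : Matrix (Fin 3) (Fin 3) ℝ) (u w : E3) :
    inner ℝ u (act Bᵀ w) = inner ℝ w (act B u) := by
  simp only [inner_eq_sum, act, Matrix.mulVec, dotProduct, Matrix.transpose_apply, Fin.sum_univ_three]
  ring

theorem inner_act_symV (v : E3 → E3) (x u w : E3) :
    inner ℝ u (act (symV v x) w) = inner ℝ w (act (symV v x) u) := by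
  rw [← inner_act_transpose]
  congr 2
  simp [symV, add_comm]

theorem inner_act_antiV (v : E3 → E3) (x u w : E3) :
    inner ℝ u (act (antiV v x) w) = -inner ℝ w (act (antiV v x) u) := by
  have h : (antiV v x)ᵀ = (-1 : ℝ) • antiV v x := by
    ext i j
    simp [antiV]
    ring
  rw [← inner_act_transpose, h, act_smul, real_inner_smul_right]
  ring

/-! ### Laplacians -/

theorem hasFDerivAt_fderiv_apply {X G : Type*} [NormedAddCommGroup X] [NormedSpace ℝ X]
    [NormedAddCommGroup G] [NormedSpace ℝ G] {F : X → G} {x : X} (hF : ContDiffAt ℝ 2 F x) (w : X) :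
    HasFDerivAt (fun y => fderiv ℝ F y w)
      ((ContinuousLinearMap.apply ℝ G w) ∘L fderiv ℝ (fderiv ℝ F) x) x := by
  have h : DifferentiableAt ℝ (fderiv ℝ F) x :=
    (hF.fderiv_right (m := 1) (by norm_num)).differentiableAt one_ne_zero
  exact (ContinuousLinearMap.apply ℝ G w).hasFDerivAt.comp x h.hasFDerivAt

/-- Intended for vacuum points: a nonnegative density has a minimum there, and all terms except the
Laplacian of `g` carry `g` or its gradient. -/
theorem lapl_smul_of_critical {g : E3 → ℝ} {W : E3 → E3} {x : E3} (hg : ContDiffAt ℝ 2 g x)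
    (hW : ContDiffAt ℝ 2 W x) (h0 : g x = 0) (h1 : fderiv ℝ g x = 0) :
    lapl (fun y => g y • W y) x = lapl g x • W x := by
  have hgW : ContDiffAt ℝ 2 (fun y => g y • W y) x := hg.smul hW
  rw [lapl_eq_sum, lapl_eq_sum, Finset.sum_smul]
  refine Finset.sum_congr rfl fun i _ => ?_
  have e1 : (fun y => fderiv ℝ (fun y => g y • W y) y (e i)) =ᶠ[𝓝 x]
      fun y => g y • fderiv ℝ W y (e i) + fderiv ℝ g y (e i) • W y := by
    filter_upwards [hg.eventually (by simp), hW.eventually (by simp)] with y a b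
    rw [fderiv_fun_smul (a.differentiableAt (by norm_num)) (b.differentiableAt (by norm_num))]
    simp
  have h2 := (hasFDerivAt_fderiv_apply hgW (e i)).congr_of_eventuallyEq e1.symm
  have h3 := ((hg.differentiableAt (by norm_num)).hasFDerivAt.smul (hasFDerivAt_fderiv_apply hW (e i))).add
    ((hasFDerivAt_fderiv_apply hg (e i)).smul (hW.differentiableAt (by norm_num)).hasFDerivAt)
  have h4 := congrArg (fun L => L (e i)) (h2.unique h3)
  simpa [h0, h1] using h4

theorem lapl_apply {F : E3 → E3} {x : E3} (hF : ContDiffAt ℝ 2 F x) (i : Fin 3) :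
    lapl (fun y => F y i) x = lapl F x i :=
  hF.laplacian_CLM_comp_left (l := EuclideanSpace.proj (𝕜 := ℝ) i)

namespace HydrodynamicLimit

variable {P : Params} {I : Set ℝ} {fε : ℝ → ℝ → E3 → S2 → ℝ} {vε : ℝ → ℝ → E3 → E3}
  {pε : ℝ → ℝ → E3 → ℝ} {f : ℝ → E3 → S2 → ℝ} {v : ℝ → E3 → E3} {p : ℝ → E3 → ℝ} {q : ST}
  {Ω : ℝ → E3 → S2} {H : ℝ → ℝ} {w : E3}

/-! ### The orientation equation -/

theorem inner_nonlocalFlux_eq_zero {F : E3 → S2 → ℝ} {ε : ℝ} {x u : E3}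
    (h1 : ‖nonlocalOrientation P ε F x‖ = 1) (h : inner ℝ (nonlocalOrientation P ε F x) u = 0) :
    inner ℝ (nonlocalFlux P ε F x) u = 0 := by
  rw [nonlocalOrientation, real_inner_smul_left] at h
  refine (mul_eq_zero.1 h).resolve_left fun h0 => ?_
  rw [nonlocalOrientation, h0, zero_smul, norm_zero] at h1
  exact zero_ne_one h1

/-- The limit of the kinetic equation tested with the generalised collision invariant. -/
theorem transport_gciTest (L : HydrodynamicLimit P I fε vε pε f v p)
    (hH : IsSmoothProfile P.kappa H) (hq : q ∈ dom I) (hρ : density (f q.1 q.2) ≠ 0) {Ω : S2}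
    (hΩ : ∀ ω, f q.1 q.2 ω = density (f q.1 q.2) * vonMises P.kappa Ω ω)
    (hw : inner ℝ (Ω : E3) w = 0) :
    transport P f v q (gciTest H Ω w) =
      -(P.D * P.k0 * inner ℝ w (lapl (fun y => flux (f q.1 y)) q.2)) := by
  obtain ⟨t, x⟩ := q
  have ht : t ∈ I := hq.1
  set m0 := ∫ z : E3, P.K ‖z‖ with hm0
  -- The nonlocal orientation as a point of the sphere; the dummy value of `dir` is irrelevant,
  -- since eventually the vector has norm one.
  set Ωε : ℝ → S2 := fun ε => dir (nonlocalOrientation P ε (fε ε t) x) with hΩε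
  have hlim0 := L.tendsto_nonlocalOrientation hq hρ hΩ
  have hunit := L.norm_nonlocalOrientation hq hρ
  have hcoe : ∀ᶠ ε in 𝓝[>] (0 : ℝ), nonlocalOrientation P ε (fε ε t) x = (Ωε ε : E3) := by
    filter_upwards [hunit] with ε h
    have h0 : nonlocalOrientation P ε (fε ε t) x ≠ 0 := fun h' => by
      change ‖nonlocalOrientation P ε (fε ε t) x‖ = 1 at h
      rw [h', norm_zero] at h
      exact zero_ne_one h
    rw [hΩε, coe_dir h0, h, inv_one, one_smul]
  have hlim : Tendsto (fun ε => (Ωε ε : E3)) (𝓝[>] (0 : ℝ)) (𝓝 (Ω : E3)) := hlim0.congr' hcoe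
  -- Projecting `w` makes the test direction exactly orthogonal to `ω̄^ε` for each `ε`; it converges
  -- to `w` because `w ⊥ Ω`.
  set wε : ℝ → E3 := fun ε => proj (Ωε ε) w with hwε
  have hwlim : Tendsto wε (𝓝[>] (0 : ℝ)) (𝓝 w) := by
    have : Tendsto (fun ε => w - inner ℝ (Ωε ε : E3) w • (Ωε ε : E3)) (𝓝[>] (0 : ℝ))
        (𝓝 (w - inner ℝ (Ω : E3) w • (Ω : E3))) :=
      tendsto_const_nhds.sub ((Tendsto.inner (𝕜 := ℝ) hlim tendsto_const_nhds).smul hlim)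
    rwa [hw, zero_smul, sub_zero] at this
  have hH1 : ContDiff ℝ 1 H := hH.contDiff.of_le (by norm_num)
  have cΩ := CConv.of_tendsto hlim
  have cw := CConv.of_tendsto hwlim
  have cω : CConv (𝓝[>] (0 : ℝ)) (fun _ (ω : S2) => (ω : E3)) (fun ω : S2 => (ω : E3)) :=
    CConv.of_continuous continuous_subtype_val
  have cμ := cΩ.inner cω
  have cproj : ∀ {u : ℝ → E3} {u0 : E3}, Tendsto u (𝓝[>] (0 : ℝ)) (𝓝 u0) →
      CConv (𝓝[>] (0 : ℝ)) (fun ε ω => proj ω (u ε)) (fun ω => proj ω u0) := fun {u u0} hu ω =>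
    (CConv.of_tendsto hu ω).sub ((cω.inner (CConv.of_tendsto hu)).smul cω ω)
  have cψ : CConv (𝓝[>] (0 : ℝ)) (fun ε => gciTest H (Ωε ε) (wε ε)) (gciTest H Ω w) :=
    (cμ.map hH.continuous).mul (cw.inner cω)
  have cgrad : CConv (𝓝[>] (0 : ℝ)) (fun ε => sphGrad (gciTest H (Ωε ε) (wε ε)))
      (sphGrad (gciTest H Ω w)) := by
    have := (((cμ.map hH.continuous_deriv).mul (cw.inner cω)).smul (cproj hlim)).add
      ((cμ.map hH.continuous).smul (cproj hwlim))
    simp only [← sphGrad_gciTest hH1] at this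
    exact this
  have hT := L.tendsto_transport le_rfl hq (.of_forall fun ε =>
    sphSmooth_gciTest hH.contDiff (Ωε ε) (wε ε)) (sphSmooth_gciTest hH.contDiff Ω w) cψ cgrad
  obtain ⟨C, hC⟩ := L.bdd t ht
  -- The normalised nonlocal flux minus the local flux, divided by `ε`, tends to `k₀ Δj`.
  have hexp := fun i => tendsto_nonlocalFlux L.R_pos L.integrable_K L.integrable_K_sq L.K_pos
    L.isOpen L.conv_f L.smooth_fε L.smooth_f ht (L.sol.mono fun ε h => h.nonneg t ht) hC x i
  have hwi : ∀ i, Tendsto (fun ε => wε ε i) (𝓝[>] (0 : ℝ)) (𝓝 (w i)) := fun i =>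
    ((EuclideanSpace.proj (𝕜 := ℝ) i).continuous.tendsto w).comp hwlim
  have hsum := (tendsto_finsetSum Finset.univ fun i _ => (hwi i).mul (hexp i)).const_mul (-P.D)
  have hlap : ∀ i, lapl (fun y => moment (fun ω => (ω : E3) i) f (t, y)) x =
      lapl (fun y => flux (f t y)) x i := fun i => by
    have hc : ContDiffAt ℝ 2 (fun y => flux (f t y)) x :=
      ((contDiffOn_flux L.isOpen L.smooth_f).contDiffAt
        ((isOpen_dom L.isOpen).mem_nhds hq)).comp x
        ((contDiff_const.prodMk contDiff_id).contDiffAt (f := fun y : E3 => ((t, y) : ST)))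
    rw [← lapl_apply hc]
    congr 1
    funext y
    exact (flux_eq_moment L.smooth_f (mem_dom ht y) i).symm
  have hres : -P.D * ∑ i, w i * (P.k0 * lapl (fun y => moment (fun ω => (ω : E3) i) f (t, y)) x) =
      -(P.D * P.k0 * inner ℝ w (lapl (fun y => flux (f t y)) x)) := by
    simp only [hlap, inner_eq_sum, Fin.sum_univ_three]
    ring
  rw [hres] at hsum
  refine tendsto_nhds_unique hT (hsum.congr' ?_)
  filter_upwards [hcoe, hunit, L.sol, self_mem_nhdsWithin, L.smooth_fε] with ε h1 h2 h3 h4 h5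
  have hε : ε ≠ 0 := ne_of_gt h4
  have hperp : inner ℝ (Ωε ε : E3) (wε ε) = 0 := proj_inner_self _ _
  have hk := h3.weak_transport L.D_pos.ne' L.isOpen hq (sphSmooth_gciTest hH.contDiff (Ωε ε) (wε ε))
  change ε * _ = P.D * ∫ ω, fε ε t x ω * (_ + P.kappa *
    inner ℝ (nonlocalOrientation P ε (fε ε t) x) _) ∂sigma at hk
  -- By the collision invariant property the collision integral is exactly `w^ε·j^ε`.
  have hgen : ∀ ω, fε ε t x ω * (sphLap (gciTest H (Ωε ε) (wε ε)) ω
      + P.kappa * inner ℝ (Ωε ε : E3) (sphGrad (gciTest H (Ωε ε) (wε ε)) ω)) =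
      inner ℝ (wε ε) (fε ε t x ω • (ω : E3)) := fun ω => by
    rw [hH.generator_gciTest hperp, real_inner_smul_right]
  have hi : Integrable (fun ω : S2 => fε ε t x ω • (ω : E3)) sigma :=
    continuous_integrable ((sphSmooth_slice h5 hq).continuous.smul continuous_subtype_val)
  simp only [h1, hgen] at hk
  rw [integral_inner hi] at hk
  change ε * _ = P.D * inner ℝ (wε ε) (flux (fε ε t x)) at hk
  -- The nonlocal flux is parallel to `ω̄^ε`, hence orthogonal to `w^ε`. So `w^ε·j^ε` equals minus
  -- the pairing of `w^ε` with normalised nonlocal flux minus local flux, which is of order `ε`.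
  have hJ : inner ℝ (wε ε) (nonlocalFlux P ε (fε ε t) x) = 0 := by
    rw [real_inner_comm]
    refine inner_nonlocalFlux_eq_zero h2 ?_
    rw [h1, hperp]
  have hfl : ∀ i, moment (fun ω => (ω : E3) i) (fε ε) (t, x) = flux (fε ε t x) i := fun i =>
    (flux_eq_moment h5 hq i).symm
  simp only [hfl]
  have e1 : -P.D * ∑ i, wε ε i * (ε⁻¹ * (((Real.sqrt ε * P.R) ^ 3 * m0)⁻¹ *
        nonlocalFlux P ε (fε ε t) x i - flux (fε ε t x) i)) =
      -P.D * (ε⁻¹ * (((Real.sqrt ε * P.R) ^ 3 * m0)⁻¹ *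
        inner ℝ (wε ε) (nonlocalFlux P ε (fε ε t) x) - inner ℝ (wε ε) (flux (fε ε t x)))) := by
    simp only [inner_eq_sum, Fin.sum_univ_three]
    ring
  rw [e1, hJ, mul_zero, zero_sub]
  field_simp
  linarith

theorem hasFDerivAt_inner_right {F : ST → E3} {D : ST →L[ℝ] E3} (h : HasFDerivAt F D q) (u : E3) :
    HasFDerivAt (fun z => inner ℝ (F z) u) ((innerSL ℝ u) ∘L D) q := by
  have := (innerSL ℝ u).hasFDerivAt.comp q h
  refine this.congr_of_eventuallyEq (.of_forall fun z => ?_)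
  exact real_inner_comm _ _

theorem stD_equilibrium (L : HydrodynamicLimit P I fε vε pε f v p)
    (hΩ : ∀ t ∈ I, ∀ x ω, f t x ω = density (f t x) * vonMises P.kappa (Ω t x) ω)
    (hq : q ∈ dom I) (hd : DifferentiableAt ℝ (unc fun t x => (Ω t x : E3)) q) (ω : S2) (z : ST) :
    stD f q ω z = vonMises P.kappa (Ω q.1 q.2) ω *
      (fderiv ℝ (fun q : ST => density (f q.1 q.2)) q z + P.kappa * density (f q.1 q.2) *
        inner ℝ (fderiv ℝ (unc fun t x => (Ω t x : E3)) q z) (ω : E3)) := by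
  have hρ := (differentiableAt_of_contDiffOn_dom L.isOpen
    (contDiffOn_density L.isOpen L.smooth_f) (by norm_num) hq).hasFDerivAt
  have h1 := hasFDerivAt_inner_right hd.hasFDerivAt (ω : E3)
  have h2 := (hasDerivAt_vmProfile P.kappa (inner ℝ (Ω q.1 q.2 : E3) (ω : E3))).comp_hasFDerivAt q h1
  have h3 := hρ.mul h2
  have h4 : (fun q : ST => f q.1 q.2 ω) =ᶠ[𝓝 q] fun q : ST => density (f q.1 q.2) *
      vmProfile P.kappa (inner ℝ (Ω q.1 q.2 : E3) (ω : E3)) := by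
    filter_upwards [(isOpen_dom L.isOpen).mem_nhds hq] with z hz
    rw [hΩ z.1 hz.1, vonMises_eq]
  have h5 := (hasFDerivAt_field L.isOpen L.smooth_f hq ω).unique (h3.congr_of_eventuallyEq h4)
  rw [h5, vonMises_eq]
  simp only [Function.comp_apply, unc, _root_.add_apply, _root_.smul_apply, smul_eq_mul,
    ContinuousLinearMap.comp_apply, innerSL_apply_apply]
  rw [real_inner_comm _ (ω : E3)]
  ring

theorem inner_fderiv_orientation (hd : DifferentiableAt ℝ (unc fun t x => (Ω t x : E3)) q) (z : ST) :
    inner ℝ (Ω q.1 q.2 : E3) (fderiv ℝ (unc fun t x => (Ω t x : E3)) q z) = 0 := by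
  have h := hd.hasFDerivAt.inner ℝ hd.hasFDerivAt
  have h1 : (fun z : ST => inner ℝ (unc (fun t x => (Ω t x : E3)) z)
      (unc (fun t x => (Ω t x : E3)) z)) = fun _ => (1 : ℝ) := funext fun z => S2.inner_self _
  rw [h1] at h
  have h2 := congrArg (fun L => L z) (h.unique (hasFDerivAt_const (1 : ℝ) q))
  simp only [ContinuousLinearMap.comp_apply, ContinuousLinearMap.prod_apply,
    fderivInnerCLM_apply, _root_.zero_apply, unc] at h2
  rw [real_inner_comm (Ω q.1 q.2 : E3)] at h2
  linarith

/-- The transport term of an equilibrium tested with the generalised collision invariant. -/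
theorem integral_gciTest_mul_stD (L : HydrodynamicLimit P I fε vε pε f v p)
    (hΩ : ∀ t ∈ I, ∀ x ω, f t x ω = density (f t x) * vonMises P.kappa (Ω t x) ω)
    (hq : q ∈ dom I) (hd : DifferentiableAt ℝ (unc fun t x => (Ω t x : E3)) q)
    (hH : IsSmoothProfile P.kappa H) (hw : inner ℝ (Ω q.1 q.2 : E3) w = 0) (u : E3) :
    ∫ ω, gciTest H (Ω q.1 q.2) w ω * stD f q ω (1, u + P.a • (ω : E3)) ∂sigma =
      gciMoment P.kappa H 0 * (P.kappa * density (f q.1 q.2) *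
          inner ℝ w (fderiv ℝ (unc fun t x => (Ω t x : E3)) q (1, u))
        + P.a * fderiv ℝ (fun q : ST => density (f q.1 q.2)) q (0, w))
      + gciMoment P.kappa H 1 * (P.kappa * density (f q.1 q.2) * P.a *
          inner ℝ w (fderiv ℝ (unc fun t x => (Ω t x : E3)) q (0, (Ω q.1 q.2 : E3)))) := by
  set κ := P.kappa with hκ
  set ρ := density (f q.1 q.2) with hρ
  set dρ := fderiv ℝ (fun q : ST => density (f q.1 q.2)) q with hdρ
  set dΩ := fderiv ℝ (unc fun t x => (Ω t x : E3)) q with hdΩ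
  set Ω0 := Ω q.1 q.2 with hΩ0
  set A : E3 →L[ℝ] E3 := spRestr₁ dΩ with hA
  set g : E3 := (InnerProductSpace.toDual ℝ E3).symm (spRestr₁ dρ) with hg
  have hgi : ∀ u : E3, inner ℝ g u = dρ (0, u) := fun u => by
    rw [hg, InnerProductSpace.toDual_symm_apply]
    rfl
  have hsplit : ∀ {G : Type} [NormedAddCommGroup G] [NormedSpace ℝ G] (D : ST →L[ℝ] G) (y : E3),
      D (1, u + P.a • y) = D (1, u) + P.a • D (0, y) := fun D y => by
    rw [← map_smul, ← map_add]
    simp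
  have e1 : ∀ ω : S2, gciTest H Ω0 w ω * stD f q ω (1, u + P.a • (ω : E3)) =
      dρ (1, u) * (gciTest H Ω0 w ω * vonMises κ Ω0 ω)
      + (P.a * (gciTest H Ω0 w ω * vonMises κ Ω0 ω * inner ℝ g (ω : E3))
      + (κ * ρ * (gciTest H Ω0 w ω * vonMises κ Ω0 ω * inner ℝ (dΩ (1, u)) (ω : E3))
      + κ * ρ * P.a * (gciTest H Ω0 w ω * vonMises κ Ω0 ω * inner ℝ (ω : E3) (A ω)))) := by
    intro ω
    rw [L.stD_equilibrium hΩ hq hd, hgi, hsplit, hsplit, inner_add_left, real_inner_smul_left,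
      hA, spRestr₁_apply, real_inner_comm (dΩ (0, (ω : E3)))]
    simp only [smul_eq_mul, ← hκ, ← hρ, ← hdρ, ← hdΩ, ← hΩ0]
    ring
  have hHc := hH.continuous
  have cψ : Continuous (gciTest H Ω0 w) := (sphSmooth_gciTest hH.contDiff Ω0 w).continuous
  have cM := (sphSmooth_vonMises κ Ω0 (n := 1)).continuous
  have cq : Continuous fun ω : S2 => inner ℝ (ω : E3) (A ω) := by fun_prop
  simp only [e1]
  rw [sphere_integral_add (by fun_prop) (by fun_prop), sphere_integral_add (by fun_prop) (by fun_prop),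
    sphere_integral_add (by fun_prop) (by fun_prop), integral_const_mul, integral_const_mul,
    integral_const_mul, integral_const_mul, integral_gciTest_mul_vonMises κ hw,
    integral_gciTest_mul_vonMises_mul_inner κ hHc hw,
    integral_gciTest_mul_vonMises_mul_inner κ hHc hw,
    integral_gciTest_mul_vonMises_mul_quadratic κ hHc hw, real_inner_comm g w, hgi]
  -- Derivatives of the unit vector `Ω` are tangential, so one half of the symmetrised moment drops
  -- out.
  have h0 : inner ℝ (Ω0 : E3) (A w) = 0 := inner_fderiv_orientation hd (0, w)
  rw [h0, hA, spRestr₁_apply]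
  ring

/-- The rotation term of an equilibrium tested with the generalised collision invariant. -/
theorem integral_mul_inner_sphGrad_gciTest (L : HydrodynamicLimit P I fε vε pε f v p)
    (hH : IsSmoothProfile P.kappa H) {Ω : S2}
    (hΩ : ∀ ω, f q.1 q.2 ω = density (f q.1 q.2) * vonMises P.kappa Ω ω)
    (hw : inner ℝ (Ω : E3) w = 0) :
    ∫ ω, f q.1 q.2 ω * inner ℝ (sphGrad (gciTest H Ω w) ω) (act (strain P.lam v q) (ω : E3)) ∂sigma =
      P.kappa * gciMoment P.kappa H 0 * (density (f q.1 q.2) *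
        inner ℝ w (act (strain P.lambdaTilde v q) (Ω : E3))) := by
  have hκ := L.kappa_pos.ne'
  have hB := hH.gciMoment_zero_neg.ne
  have h := integral_vonMises_mul_inner_sphGrad_gciTest P.kappa (hH.contDiff.of_le (by norm_num)) hw
    (actL (strain P.lam v q))
  have e1 : ∀ ω, f q.1 q.2 ω * inner ℝ (sphGrad (gciTest H Ω w) ω) (act (strain P.lam v q) (ω : E3)) =
      density (f q.1 q.2) * (vonMises P.kappa Ω ω *
        inner ℝ (sphGrad (gciTest H Ω w) ω) (actL (strain P.lam v q) ω)) := fun ω => by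
    rw [actL_apply]
    conv_lhs => rw [hΩ]
    ring
  simp only [e1]
  rw [integral_const_mul, h]
  simp only [actL_apply, strain, act_add, act_smul, inner_add_right, real_inner_smul_right,
    Params.lambdaTilde, Params.lambda0, hH.c2_eq, hH.c3_eq]
  -- The two halves `w·BΩ` and `Ω·Bw` agree for `S` and are opposite for `A`. Divided by `κB₀`, the
  -- symmetric part gets `6c₂/κ + c₃ - 1` and the antisymmetric part gets `1`.
  rw [inner_act_symV _ _ (Ω : E3) w, inner_act_antiV _ _ (Ω : E3) w]
  field_simp
  ring

/-- The limit identity for the collision invariant, divided by `κB₀ ≠ 0`. The transport moments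
`B₁/B₀` give `c₂` in `V`; the diffusion coefficient is `-D k₀ c₁/(κB₀)`, which equals `γ` by `c₁ =
-κ(2B₀ + κB₁)` and `ν = κD`. -/
theorem inner_orientation (L : HydrodynamicLimit P I fε vε pε f v p)
    (hΩ : ∀ t ∈ I, ∀ x ω, f t x ω = density (f t x) * vonMises P.kappa (Ω t x) ω)
    (hq : q ∈ dom I) (hρ : density (f q.1 q.2) ≠ 0)
    (hd : DifferentiableAt ℝ (unc fun t x => (Ω t x : E3)) q)
    (hw : inner ℝ (Ω q.1 q.2 : E3) w = 0) :
    density (f q.1 q.2) * inner ℝ w (fderiv ℝ (unc fun t x => (Ω t x : E3)) q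
        (1, velV P (Ω q.1 q.2) (v q.1 q.2)))
      + P.a / P.kappa * fderiv ℝ (fun q : ST => density (f q.1 q.2)) q (0, w) =
    P.gamma * inner ℝ w (lapl (fun y => density (f q.1 y) • (Ω q.1 y : E3)) q.2)
      + density (f q.1 q.2) * inner ℝ w (act (strain P.lambdaTilde v q) (Ω q.1 q.2 : E3)) := by
  obtain ⟨H, hH⟩ := exists_isSmoothProfile P.kappa
  have hκ := L.kappa_pos.ne'
  have hB := hH.gciMoment_zero_neg.ne
  have h1 := L.transport_gciTest hH hq hρ (hΩ q.1 hq.1 q.2) hw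
  rw [transport, L.integral_gciTest_mul_stD hΩ hq hd hH hw,
    L.integral_mul_inner_sphGrad_gciTest hH (hΩ q.1 hq.1 q.2) hw] at h1
  have e1 : (fun y => flux (f q.1 y)) =
      c1 P.kappa • fun y => density (f q.1 y) • (Ω q.1 y : E3) := by
    funext y
    exact flux_eq (q := (q.1, y)) (hΩ q.1 hq.1 y)
  have hincl : ContDiffAt ℝ 2 (fun y : E3 => ((q.1, y) : ST)) q.2 :=
    (contDiff_const.prodMk contDiff_id).contDiffAt
  have hc : ContDiffAt ℝ 2 (fun y => density (f q.1 y) • (Ω q.1 y : E3)) q.2 :=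
    ContDiffAt.comp (g := unc fun t x => density (f t x) • (Ω t x : E3)) q.2
      ((L.contDiffOn_density_smul_orientation hΩ).contDiffAt
        ((isOpen_dom L.isOpen).mem_nhds hq)) hincl
  have e2 : lapl (fun y => flux (f q.1 y)) q.2 =
      c1 P.kappa • lapl (fun y => density (f q.1 y) • (Ω q.1 y : E3)) q.2 := by
    rw [e1]
    exact InnerProductSpace.laplacian_smul _ hc
  rw [e2, real_inner_smul_right, c1_eq_variance, hH.variance_eq] at h1
  have e3 : fderiv ℝ (unc fun t x => (Ω t x : E3)) q (1, velV P (Ω q.1 q.2) (v q.1 q.2)) =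
      fderiv ℝ (unc fun t x => (Ω t x : E3)) q (1, v q.1 q.2)
      + (P.a * c2 P.kappa) •
        fderiv ℝ (unc fun t x => (Ω t x : E3)) q (0, (Ω q.1 q.2 : E3)) := by
    rw [← map_smul, ← map_add]
    simp [velV, add_comm]
  have hν : P.nu = P.kappa * P.D := by
    rw [Params.kappa, div_mul_cancel₀ _ L.D_pos.ne']
  rw [e3, inner_add_right, real_inner_smul_right, Params.gamma, hH.c2_eq, hν]
  have hBκ : P.kappa * gciMoment P.kappa H 0 ≠ 0 := mul_ne_zero hκ hB
  refine mul_left_cancel₀ hBκ ?_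
  field_simp
  field_simp at h1
  linarith

/-- Outside vacuum both sides are tangential and agree against every tangential vector. In vacuum
the equation is trivial where `Ω` is `C²`. -/
theorem orientationEq (L : HydrodynamicLimit P I fε vε pε f v p)
    (hΩ : ∀ t ∈ I, ∀ x ω, f t x ω = density (f t x) * vonMises P.kappa (Ω t x) ω)
    {t : ℝ} (ht : t ∈ I) (x : E3) (hsm : ContDiffAt ℝ 2 (unc fun t x => (Ω t x : E3)) (t, x)) :
    OrientationEq P (fun t x => density (f t x)) Ω v t x := by
  have hq := mem_dom ht x
  have hU := (isOpen_dom L.isOpen).mem_nhds hq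
  have hincl : ContDiffAt ℝ 2 (fun y : E3 => ((t, y) : ST)) x :=
    (contDiff_const.prodMk contDiff_id).contDiffAt
  have hρs : ContDiffAt ℝ 2 (fun y => density (f t y)) x :=
    ((contDiffOn_density L.isOpen L.smooth_f).contDiffAt hU).comp x hincl
  have hgrad : ∀ u, inner ℝ (gradient (fun y => density (f t y)) x) u =
      fderiv ℝ (fun y => density (f t y)) x u := fun u => by simp [gradient]
  unfold OrientationEq
  beta_reduce
  by_cases hρ : density (f t x) = 0
  -- The density is nonnegative and zero at `x`, so `x` is a critical point: `∇ρ = 0`, and `Δ(ρΩ) =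
  -- (Δρ)Ω` is removed by the projection.
  · have hmin : fderiv ℝ (fun y => density (f t y)) x = 0 :=
      IsLocalMin.fderiv_eq_zero (.of_forall fun y => by
        simp only [hρ]
        exact L.density_nonneg (mem_dom ht y))
    have hΩs : ContDiffAt ℝ 2 (fun y => (Ω t y : E3)) x := hsm.comp x hincl
    have h1 : gradient (fun y => density (f t y)) x = 0 := by simp [gradient, hmin]
    rw [hρ, h1, lapl_smul_of_critical hρs hΩs hρ hmin]
    simp [proj, real_inner_smul_right]
  · have hd : DifferentiableAt ℝ (unc fun t x => (Ω t x : E3)) (t, x) :=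
      hsm.differentiableAt (by norm_num)
    have hρd := differentiableAt_of_contDiffOn_dom L.isOpen
      (contDiffOn_density L.isOpen L.smooth_f) (by norm_num) hq
    have et : deriv (fun s => (Ω s x : E3)) t = fderiv ℝ (unc fun t x => (Ω t x : E3)) (t, x) (1, 0) :=
      (hasDerivAt_time_slice hd.hasFDerivAt).deriv
    have ex : ∀ u, fderiv ℝ (fun y => (Ω t y : E3)) x u =
        fderiv ℝ (unc fun t x => (Ω t x : E3)) (t, x) (0, u) := fderiv_space_slice hd.hasFDerivAt
    have eρ : ∀ u, fderiv ℝ (fun y => density (f t y)) x u =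
        fderiv ℝ (fun q : ST => density (f q.1 q.2)) (t, x) (0, u) :=
      fderiv_space_slice hρd.hasFDerivAt
    rw [et, ex, ← smul_add, ← map_time_space, ← sub_eq_zero]
    obtain ⟨X, hX⟩ : ∃ X, X = density (f t x) • fderiv ℝ (unc fun t x => (Ω t x : E3)) (t, x)
          (1, velV P (Ω t x) (v t x))
        + (P.a / P.kappa) • proj (Ω t x) (gradient (fun y => density (f t y)) x)
        - (P.gamma • proj (Ω t x) (lapl (fun y => density (f t y) • (Ω t y : E3)) x)
          + density (f t x) • proj (Ω t x)
            (act (P.lambdaTilde • symV (v t) x + antiV (v t) x) (Ω t x : E3))) := ⟨_, rfl⟩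
    rw [← hX]
    have hpX : inner ℝ (Ω t x : E3) X = 0 := by
      have := inner_fderiv_orientation hd (1, velV P (Ω t x) (v t x))
      rw [hX]
      simp only [inner_sub_right, inner_add_right, real_inner_smul_right, proj_inner_self]
      rw [show inner ℝ (Ω t x : E3) _ = (0 : ℝ) from this]
      simp
    have hproj : ∀ u, inner ℝ X (proj (Ω t x) u) = inner ℝ X u := inner_proj_of_tangent hpX
    -- The difference `X` of the two sides is itself tangential, hence an admissible test direction;
    -- this gives `|X|² = 0`.
    have h := L.inner_orientation hΩ hq hρ hd hpX
    rw [← eρ, ← hgrad, real_inner_comm X (gradient _ _)] at h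
    have hXX : inner ℝ X X = 0 := by
      nth_rewrite 2 [hX]
      simp only [inner_sub_right, inner_add_right, real_inner_smul_right, hproj]
      rw [sub_eq_zero]
      exact h
    exact inner_self_eq_zero.1 hXX

end HydrodynamicLimit

/-! ### Convergence of values and first derivatives at a point -/

/-- Convergence of values and first derivatives at the point `q`. -/
structure C1Conv {G : Type*} [NormedAddCommGroup G] [NormedSpace ℝ G] (q : ST) (Fε : ℝ → ST → G)
    (F : ST → G) : Prop where
  diff_ε : ∀ᶠ ε in 𝓝[>] (0 : ℝ), DifferentiableAt ℝ (Fε ε) q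
  diff : DifferentiableAt ℝ F q
  val : Tendsto (fun ε => Fε ε q) (𝓝[>] (0 : ℝ)) (𝓝 (F q))
  der : Tendsto (fun ε => fderiv ℝ (Fε ε) q) (𝓝[>] (0 : ℝ)) (𝓝 (fderiv ℝ F q))

namespace C1Conv

variable {G G' : Type*} [NormedAddCommGroup G] [NormedSpace ℝ G] [NormedAddCommGroup G']
  [NormedSpace ℝ G'] {q : ST} {Fε Kε : ℝ → ST → G} {F K : ST → G}

theorem const (c : G) : C1Conv q (fun _ _ => c) (fun _ => c) :=
  ⟨.of_forall fun _ => differentiableAt_const c, differentiableAt_const c, tendsto_const_nhds,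
    tendsto_const_nhds⟩

theorem add (h : C1Conv q Fε F) (k : C1Conv q Kε K) :
    C1Conv q (fun ε z => Fε ε z + Kε ε z) (fun z => F z + K z) := by
  refine ⟨(h.diff_ε.and k.diff_ε).mono fun ε a => a.1.add a.2, h.diff.add k.diff, h.val.add k.val, ?_⟩
  rw [fderiv_fun_add h.diff k.diff]
  exact (h.der.add k.der).congr' ((h.diff_ε.and k.diff_ε).mono fun ε a =>
    (fderiv_fun_add a.1 a.2).symm)

theorem smul {fε : ℝ → ST → ℝ} {f : ST → ℝ} (h : C1Conv q fε f) (k : C1Conv q Kε K) :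
    C1Conv q (fun ε z => fε ε z • Kε ε z) (fun z => f z • K z) := by
  refine ⟨(h.diff_ε.and k.diff_ε).mono fun ε a => a.1.smul a.2, h.diff.smul k.diff,
    h.val.smul k.val, ?_⟩
  rw [fderiv_fun_smul h.diff k.diff]
  have h1 : Tendsto (fun ε => (fderiv ℝ (fε ε) q).smulRight (Kε ε q)) (𝓝[>] (0 : ℝ))
      (𝓝 ((fderiv ℝ f q).smulRight (K q))) :=
    (isBoundedBilinearMap_smulRight.continuous.tendsto (fderiv ℝ f q, K q)).comp
      (h.der.prodMk_nhds k.val)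
  exact ((h.val.smul k.der).add h1).congr' ((h.diff_ε.and k.diff_ε).mono fun ε a =>
    (fderiv_fun_smul a.1 a.2).symm)

theorem clm (h : C1Conv q Fε F) (A : G →L[ℝ] G') :
    C1Conv q (fun ε z => A (Fε ε z)) (fun z => A (F z)) := by
  have e1 : ∀ {F : ST → G}, DifferentiableAt ℝ F q →
      fderiv ℝ (fun z => A (F z)) q = A ∘L fderiv ℝ F q := fun h =>
    (A.hasFDerivAt.comp q h.hasFDerivAt).fderiv
  refine ⟨h.diff_ε.mono fun ε a => A.differentiableAt.comp q a, A.differentiableAt.comp q h.diff,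
    (A.continuous.tendsto _).comp h.val, ?_⟩
  rw [e1 h.diff]
  exact ((((ContinuousLinearMap.compL ℝ ST G G') A).continuous.tendsto _).comp h.der).congr'
    (h.diff_ε.mono fun ε a => (e1 a).symm)

theorem congr (h : C1Conv q Fε F) (h1 : ∀ᶠ ε in 𝓝[>] (0 : ℝ), Fε ε =ᶠ[𝓝 q] Kε ε)
    (h2 : F =ᶠ[𝓝 q] K) : C1Conv q Kε K := by
  refine ⟨(h.diff_ε.and h1).mono fun ε a => a.1.congr_of_eventuallyEq a.2.symm,
    h.diff.congr_of_eventuallyEq h2.symm, ?_, ?_⟩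
  · rw [← h2.eq_of_nhds]
    exact h.val.congr' (h1.mono fun ε a => a.eq_of_nhds)
  · rw [← h2.fderiv_eq]
    exact h.der.congr' (h1.mono fun ε a => a.fderiv_eq)

theorem mul {fε gε : ℝ → ST → ℝ} {f g : ST → ℝ} (h : C1Conv q fε f) (k : C1Conv q gε g) :
    C1Conv q (fun ε z => fε ε z * gε ε z) (fun z => f z * g z) := h.smul k

theorem coord {Fε : ℝ → ST → E3} {F : ST → E3} (h : C1Conv q Fε F) (i : Fin 3) :
    C1Conv q (fun ε z => Fε ε z i) (fun z => F z i) := h.clm (EuclideanSpace.proj (𝕜 := ℝ) i)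

theorem tendsto_apply (h : C1Conv q Fε F) (w : ST) :
    Tendsto (fun ε => fderiv ℝ (Fε ε) q w) (𝓝[>] (0 : ℝ)) (𝓝 (fderiv ℝ F q w)) :=
  ((ContinuousLinearMap.apply ℝ G w).continuous.tendsto _).comp h.der

end C1Conv

theorem C1Conv.of_tendstoCk {G : Type*} [NormedAddCommGroup G] [NormedSpace ℝ G] {I : Set ℝ}
    (hI : IsOpen I) {q : ST} (hq : q ∈ dom I) {k : ℕ} (hk : 1 ≤ k) {Fε : ℝ → ST → G} {F : ST → G}
    (h : TendstoCk k (dom I) Fε F) {n : WithTop ℕ∞} (hn : n ≠ 0)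
    (hFε : ∀ᶠ ε in 𝓝[>] (0 : ℝ), ContDiffOn ℝ n (Fε ε) (dom I)) (hF : ContDiffOn ℝ n F (dom I)) :
    C1Conv q Fε F :=
  ⟨hFε.mono fun _ a => differentiableAt_of_contDiffOn_dom hI a hn hq,
    differentiableAt_of_contDiffOn_dom hI hF hn hq, h.tendsto.tendsto_at hq,
    (h.tendsto_fderiv hk).tendsto_at hq⟩

/-! ### The momentum equation -/

theorem kinMomentumFlux_apply (P : Params) (F : S2 → ℝ) (u : E3) (i j : Fin 3) :
    kinMomentumFlux P F u i j = (P.Re + P.cbar * density F) * (u i * u j)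
      + (P.a * P.cbar) * (u i * flux F j + flux F i * u j)
      + (P.a ^ 2 * P.cbar + P.b) * qTensor F i j := rfl

theorem qTensor_eq_moment (f : ℝ → E3 → S2 → ℝ) (q : ST) (i j : Fin 3) :
    qTensor (f q.1 q.2) i j = moment (fun ω => (tens (ω : E3) (ω : E3)
      - (1 / 3 : ℝ) • (1 : Matrix (Fin 3) (Fin 3) ℝ)) i j) f q := rfl

theorem continuous_qWeight (i j : Fin 3) : Continuous fun ω : S2 => (tens (ω : E3) (ω : E3)
    - (1 / 3 : ℝ) • (1 : Matrix (Fin 3) (Fin 3) ℝ)) i j :=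
  ((continuous_coord i).mul (continuous_coord j)).sub continuous_const

/-- Residual of the `j`-th component of the momentum equation. -/
noncomputable def momentumResidual (P : Params) (f : ℝ → E3 → S2 → ℝ) (v : ℝ → E3 → E3)
    (p : ℝ → E3 → ℝ) (q : ST) (j : Fin 3) : ℝ :=
  fderiv ℝ (fun z : ST => kinMomentum P (f z.1 z.2) (v z.1 z.2)) q (1, 0) j
    + ∑ i, fderiv ℝ (fun z : ST => kinMomentumFlux P (f z.1 z.2) (v z.1 z.2) i j) q (0, e i)
    + fderiv ℝ (fun z : ST => p z.1 z.2 + P.a ^ 2 * P.cbar / 3 * density (f z.1 z.2)) q (0, e j)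
    - (∑ i, fderiv ℝ (fderiv ℝ (unc v)) q (0, e i) (0, e i)) j

/-- Written through space-time derivatives at one point, the equation is stable under the available
convergence. The equivalence is used forwards for the approximations and backwards for the limit. -/
theorem momentum_iff_residual {P : Params} {f : ℝ → E3 → S2 → ℝ} {v : ℝ → E3 → E3}
    {p : ℝ → E3 → ℝ} {I : Set ℝ} (hI : IsOpen I) {t : ℝ} (ht : t ∈ I) (x : E3)
    (hv : ContDiffOn ℝ 2 (unc v) (dom I))
    (hM : DifferentiableAt ℝ (fun z : ST => kinMomentum P (f z.1 z.2) (v z.1 z.2)) (t, x))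
    (hF : ∀ i j, DifferentiableAt ℝ
      (fun z : ST => kinMomentumFlux P (f z.1 z.2) (v z.1 z.2) i j) (t, x))
    (hp : DifferentiableAt ℝ
      (fun z : ST => p z.1 z.2 + P.a ^ 2 * P.cbar / 3 * density (f z.1 z.2)) (t, x)) :
    (deriv (fun s => kinMomentum P (f s x) (v s x)) t
      + divT (fun y => kinMomentumFlux P (f t y) (v t y)) x
      = - gradient (fun y => p t y + P.a ^ 2 * P.cbar / 3 * density (f t y)) x + lapl (v t) x) ↔
    ∀ j, momentumResidual P f v p (t, x) j = 0 := by
  have e1 : deriv (fun s => kinMomentum P (f s x) (v s x)) t =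
      fderiv ℝ (fun z : ST => kinMomentum P (f z.1 z.2) (v z.1 z.2)) (t, x) (1, 0) :=
    (hasDerivAt_time_slice hM.hasFDerivAt).deriv
  have e2 : ∀ j, divT (fun y => kinMomentumFlux P (f t y) (v t y)) x j =
      ∑ i, fderiv ℝ (fun z : ST => kinMomentumFlux P (f z.1 z.2) (v z.1 z.2) i j) (t, x)
        (0, e i) := fun j => by
    simp only [divT]
    exact Finset.sum_congr rfl fun i _ => fderiv_space_slice (hF i j).hasFDerivAt (e i)
  have e3 : ∀ j, gradient (fun y => p t y + P.a ^ 2 * P.cbar / 3 * density (f t y)) x j =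
      fderiv ℝ (fun z : ST => p z.1 z.2 + P.a ^ 2 * P.cbar / 3 * density (f z.1 z.2)) (t, x)
        (0, e j) := fun j => by
    rw [← inner_e, ← fderiv_space_slice hp.hasFDerivAt (e j)]
    simp [gradient]
  have e4 : lapl (v t) x = ∑ i, fderiv ℝ (fderiv ℝ (unc v)) (t, x) (0, e i) (0, e i) :=
    lapl_space_slice hI hv ht x
  constructor
  · intro h j
    have hj := congrArg (fun u : E3 => u j) h
    simp only [PiLp.add_apply, PiLp.neg_apply, e1, e2, e3, e4] at hj
    rw [momentumResidual]
    linarith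
  · intro h
    ext j
    have hj := h j
    rw [momentumResidual] at hj
    simp only [PiLp.add_apply, PiLp.neg_apply, e1, e2, e3, e4]
    linarith

/-! ### Passing to the limit in the momentum balance. -/

namespace HydrodynamicLimit

variable {P : Params} {I : Set ℝ} {fε : ℝ → ℝ → E3 → S2 → ℝ} {vε : ℝ → ℝ → E3 → E3}
  {pε : ℝ → ℝ → E3 → ℝ} {f : ℝ → E3 → S2 → ℝ} {v : ℝ → E3 → E3} {p : ℝ → E3 → ℝ} {q : ST}
  {Ω : ℝ → E3 → S2}

theorem c1Conv_moment (L : HydrodynamicLimit P I fε vε pε f v p) (hq : q ∈ dom I) {φ : S2 → ℝ}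
    (hφ : Continuous φ) : C1Conv q (fun ε => moment φ (fε ε)) (moment φ f) :=
  ⟨L.smooth_fε.mono fun _ h => (hasFDerivAt_moment L.isOpen h hφ hq).differentiableAt,
    (hasFDerivAt_moment L.isOpen L.smooth_f hφ hq).differentiableAt,
    (tendsto_moment L.isOpen L.conv_f L.smooth_fε L.smooth_f hφ).tendsto_at hq,
    (tendsto_fderiv_moment L.isOpen L.conv_f L.smooth_fε L.smooth_f hφ).tendsto_at hq⟩

theorem c1Conv_density (L : HydrodynamicLimit P I fε vε pε f v p) (hq : q ∈ dom I) :
    C1Conv q (fun ε z => density (fε ε z.1 z.2)) (fun z => density (f z.1 z.2)) := by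
  simp only [density_eq_moment]
  exact L.c1Conv_moment hq continuous_const

theorem c1Conv_flux (L : HydrodynamicLimit P I fε vε pε f v p) (hq : q ∈ dom I) :
    C1Conv q (fun ε z => flux (fε ε z.1 z.2)) (fun z => flux (f z.1 z.2)) := by
  have hU := (isOpen_dom L.isOpen).mem_nhds hq
  have h1 : ∀ i, C1Conv q (fun ε z => moment (fun ω => (ω : E3) i) (fε ε) z • e i)
      (fun z => moment (fun ω => (ω : E3) i) f z • e i) := fun i =>
    (L.c1Conv_moment hq (continuous_coord i)).smul (C1Conv.const (e i))
  -- The flux is reassembled from its coordinate moments, whose convergence is known.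
  have e1 : ∀ {f : ℝ → E3 → S2 → ℝ}, ContDiffOn ℝ 2 (ext f) (domF I) →
      (fun z => moment (fun ω => (ω : E3) 0) f z • e 0 + moment (fun ω => (ω : E3) 1) f z • e 1
        + moment (fun ω => (ω : E3) 2) f z • e 2) =ᶠ[𝓝 q] fun z => flux (f z.1 z.2) := by
    intro f hf
    filter_upwards [hU] with z hz
    simp only [← flux_eq_moment hf hz]
    rw [← Fin.sum_univ_three (fun i => flux (f z.1 z.2) i • e i), sum_e]
  exact (((h1 0).add (h1 1)).add (h1 2)).congr (L.smooth_fε.mono fun ε h => e1 h) (e1 L.smooth_f)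

theorem c1Conv_v (L : HydrodynamicLimit P I fε vε pε f v p) (hq : q ∈ dom I) :
    C1Conv q (fun ε z => vε ε z.1 z.2) (fun z => v z.1 z.2) :=
  C1Conv.of_tendstoCk L.isOpen hq (by norm_num) L.conv_v (by norm_num)
    (L.sol.mono fun _ h => h.smooth_v) L.smooth_v

theorem c1Conv_p (L : HydrodynamicLimit P I fε vε pε f v p) (hq : q ∈ dom I) :
    C1Conv q (fun ε z => pε ε z.1 z.2) (fun z => p z.1 z.2) :=
  C1Conv.of_tendstoCk L.isOpen hq le_rfl L.conv_p one_ne_zero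
    (L.sol.mono fun _ h => h.smooth_p) L.smooth_p

theorem c1Conv_kinMomentum (L : HydrodynamicLimit P I fε vε pε f v p) (hq : q ∈ dom I) :
    C1Conv q (fun ε z => kinMomentum P (fε ε z.1 z.2) (vε ε z.1 z.2))
      (fun z => kinMomentum P (f z.1 z.2) (v z.1 z.2)) :=
  (((C1Conv.const P.Re).add ((C1Conv.const P.cbar).mul (L.c1Conv_density hq))).smul
    (L.c1Conv_v hq)).add ((C1Conv.const (P.a * P.cbar)).smul (L.c1Conv_flux hq))

theorem c1Conv_kinMomentumFlux (L : HydrodynamicLimit P I fε vε pε f v p) (hq : q ∈ dom I)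
    (i j : Fin 3) :
    C1Conv q (fun ε z => kinMomentumFlux P (fε ε z.1 z.2) (vε ε z.1 z.2) i j)
      (fun z => kinMomentumFlux P (f z.1 z.2) (v z.1 z.2) i j) := by
  have hv := L.c1Conv_v hq
  have hj := L.c1Conv_flux hq
  simp only [kinMomentumFlux_apply, qTensor_eq_moment]
  exact ((((C1Conv.const P.Re).add ((C1Conv.const P.cbar).mul (L.c1Conv_density hq))).mul
    ((hv.coord i).mul (hv.coord j))).add ((C1Conv.const (P.a * P.cbar)).mul
    (((hv.coord i).mul (hj.coord j)).add ((hj.coord i).mul (hv.coord j))))).add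
    ((C1Conv.const (P.a ^ 2 * P.cbar + P.b)).mul (L.c1Conv_moment hq (continuous_qWeight i j)))

theorem c1Conv_pressure (L : HydrodynamicLimit P I fε vε pε f v p) (hq : q ∈ dom I) :
    C1Conv q (fun ε z => pε ε z.1 z.2 + P.a ^ 2 * P.cbar / 3 * density (fε ε z.1 z.2))
      (fun z => p z.1 z.2 + P.a ^ 2 * P.cbar / 3 * density (f z.1 z.2)) :=
  (L.c1Conv_p hq).add ((C1Conv.const _).mul (L.c1Conv_density hq))

theorem tendsto_momentumResidual (L : HydrodynamicLimit P I fε vε pε f v p) (hq : q ∈ dom I)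
    (j : Fin 3) : Tendsto (fun ε => momentumResidual P (fε ε) (vε ε) (pε ε) q j) (𝓝[>] (0 : ℝ))
      (𝓝 (momentumResidual P f v p q j)) := by
  have hproj : ∀ j : Fin 3, Continuous fun u : E3 => u j := fun j =>
    (EuclideanSpace.proj (𝕜 := ℝ) j).continuous
  have h1 := ((hproj j).tendsto _).comp ((L.c1Conv_kinMomentum hq).tendsto_apply (1, 0))
  have h2 := tendsto_finsetSum Finset.univ fun i _ =>
    (L.c1Conv_kinMomentumFlux hq i j).tendsto_apply (0, e i)
  have h3 := (L.c1Conv_pressure hq).tendsto_apply (0, e j)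
  have h4 := (L.conv_v.tendsto_fderiv_fderiv le_rfl).tendsto_at hq
  have h5 : ∀ w : ST, Tendsto (fun ε => fderiv ℝ (fderiv ℝ (unc (vε ε))) q w w) (𝓝[>] (0 : ℝ))
      (𝓝 (fderiv ℝ (fderiv ℝ (unc v)) q w w)) := fun w =>
    ((ContinuousLinearMap.apply ℝ E3 w).continuous.tendsto _).comp
      (((ContinuousLinearMap.apply ℝ (ST →L[ℝ] E3) w).continuous.tendsto _).comp h4)
  have h6 := ((hproj j).tendsto _).comp
    (tendsto_finsetSum Finset.univ fun i _ => h5 ((0, e i) : ST))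
  exact ((h1.add h2).add h3).sub h6

/-- The residual vanishes for small `ε` and converges. The first order terms need convergence of
values and first derivatives; only `Δv` needs second derivatives. -/
theorem kinetic_momentum (L : HydrodynamicLimit P I fε vε pε f v p) {t : ℝ} (ht : t ∈ I) (x : E3) :
    deriv (fun s => kinMomentum P (f s x) (v s x)) t
      + divT (fun y => kinMomentumFlux P (f t y) (v t y)) x
      = - gradient (fun y => p t y + P.a ^ 2 * P.cbar / 3 * density (f t y)) x
        + lapl (v t) x := by
  have hq := mem_dom ht x
  have hM := L.c1Conv_kinMomentum hq
  have hF := L.c1Conv_kinMomentumFlux hq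
  have hp := L.c1Conv_pressure hq
  rw [momentum_iff_residual L.isOpen ht x L.smooth_v hM.diff (fun i j => (hF i j).diff) hp.diff]
  intro j
  refine tendsto_nhds_unique (L.tendsto_momentumResidual hq j) (tendsto_const_nhds.congr' ?_)
  filter_upwards [L.sol, hM.diff_ε, eventually_all.2 fun i => eventually_all.2 fun j =>
    (hF i j).diff_ε, hp.diff_ε] with ε h1 h2 h3 h4
  exact ((momentum_iff_residual L.isOpen ht x h1.smooth_v h2 h3 h4).1 (h1.momentum t ht x) j).symm

/-- Closure: at equilibrium the flux is `c₁ρΩ` and the Q-tensor is `ρ𝒬(Ω)`. -/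
theorem momentum (L : HydrodynamicLimit P I fε vε pε f v p)
    (hΩ : ∀ t ∈ I, ∀ x ω, f t x ω = density (f t x) * vonMises P.kappa (Ω t x) ω)
    {t : ℝ} (ht : t ∈ I) (x : E3) :
    deriv (fun s => macroMomentum P (density (f s x)) (Ω s x) (v s x)) t
      + divT (fun y => macroMomentumFlux P (density (f t y)) (Ω t y) (v t y)) x
      = - gradient (fun y => p t y + P.a ^ 2 * P.cbar / 3 * density (f t y)) x
        + lapl (v t) x := by
  have hfl : ∀ s ∈ I, ∀ y, flux (f s y) = c1 P.kappa • (density (f s y) • (Ω s y : E3)) :=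
    fun s hs y => flux_eq (q := (s, y)) (hΩ s hs y)
  have hQ : ∀ s ∈ I, ∀ y, qTensor (f s y) = density (f s y) • macroQ P (Ω s y) := fun s hs y => by
    conv_lhs => rw [funext (hΩ s hs y)]
    rw [qTensor_smul, qTensor_vonMises, macroQ]
  have e1 : (fun s => macroMomentum P (density (f s x)) (Ω s x) (v s x)) =ᶠ[𝓝 t]
      fun s => kinMomentum P (f s x) (v s x) := by
    filter_upwards [L.isOpen.mem_nhds ht] with s hs
    rw [macroMomentum, kinMomentum, hfl s hs, smul_smul, smul_smul]
    congr 2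
    ring
  have e2 : (fun y => macroMomentumFlux P (density (f t y)) (Ω t y) (v t y)) =
      fun y => kinMomentumFlux P (f t y) (v t y) := by
    funext y
    ext i j
    rw [kinMomentumFlux_apply, hfl t ht, hQ t ht]
    simp only [macroMomentumFlux, tens, Matrix.add_apply, Matrix.smul_apply, Matrix.of_apply,
      smul_eq_mul, PiLp.smul_apply]
    ring
  rw [e1.deriv_eq, e2]
  exact L.kinetic_momentum ht x

theorem isMacroSolution (L : HydrodynamicLimit P I fε vε pε f v p)
    (hΩ : ∀ t ∈ I, ∀ x ω, f t x ω = density (f t x) * vonMises P.kappa (Ω t x) ω) :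
    IsMacroSolution P I (fun t x => density (f t x)) Ω v p where
  nonneg _ ht x := L.density_nonneg (mem_dom ht x)
  smooth_rho := contDiffOn_density L.isOpen L.smooth_f
  smooth_rhoOmega := L.contDiffOn_density_smul_orientation hΩ
  smooth_Omega _ ht x hρ := L.contDiffAt_orientation hΩ (mem_dom ht x) hρ
  continuity _ ht x := L.continuity hΩ ht x
  orientation _ ht x hsm := L.orientationEq hΩ ht x hsm
  momentum _ ht x := L.momentum hΩ ht x
  incompressible _ ht x := L.incompressible (mem_dom ht x)

end HydrodynamicLimit

end VicsekNS

/-! ### The hydrodynamic limit theorem. -/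

theorem theorem6p6
    (P : VicsekNS.Params) (hnu : 0 < P.nu) (hD : 0 < P.D) (hR : 0 < P.R)
    (hK : ∀ r, 0 ≤ r → 0 ≤ P.K r)
    (hK0 : Integrable fun z : VicsekNS.E3 => P.K ‖z‖)
    (hK2 : Integrable fun z : VicsekNS.E3 => P.K ‖z‖ * ‖z‖ ^ 2)
    (hKpos : 0 < ∫ z : VicsekNS.E3, P.K ‖z‖)
    (I : Set ℝ) (hI : IsOpen I)
    -- the solutions of the rescaled system and their limit
    (fε : ℝ → ℝ → VicsekNS.E3 → VicsekNS.S2 → ℝ)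
    (vε : ℝ → ℝ → VicsekNS.E3 → VicsekNS.E3)
    (pε : ℝ → ℝ → VicsekNS.E3 → ℝ)
    (f : ℝ → VicsekNS.E3 → VicsekNS.S2 → ℝ)
    (v : ℝ → VicsekNS.E3 → VicsekNS.E3)
    (p : ℝ → VicsekNS.E3 → ℝ)
    (hsol : ∀ᶠ ε in 𝓝[>] (0 : ℝ), VicsekNS.IsScaledSolution P ε I (fε ε) (vε ε) (pε ε))
    -- the limit is smooth enough
    (hf : ContDiffOn ℝ 2 (VicsekNS.ext f) (VicsekNS.domF I))
    (hv : ContDiffOn ℝ 2 (VicsekNS.unc v) (VicsekNS.dom I))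
    (hp : ContDiffOn ℝ 1 (VicsekNS.unc p) (VicsekNS.dom I))
    -- the convergence is strong enough
    (hfε : VicsekNS.TendstoCk 2 (VicsekNS.domF I)
      (fun ε => VicsekNS.ext (fε ε)) (VicsekNS.ext f))
    (hvε : VicsekNS.TendstoCk 2 (VicsekNS.dom I)
      (fun ε => VicsekNS.unc (vε ε)) (VicsekNS.unc v))
    (hpε : VicsekNS.TendstoCk 1 (VicsekNS.dom I)
      (fun ε => VicsekNS.unc (pε ε)) (VicsekNS.unc p))
    (hbdd : ∀ t ∈ I, ∃ C : ℝ, ∀ᶠ ε in 𝓝[>] (0 : ℝ), ∀ x ω, fε ε t x ω ≤ C) :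
    -- the limit is a local equilibrium
    (∃ Ω : ℝ → VicsekNS.E3 → VicsekNS.S2, ∀ t ∈ I, ∀ x ω,
      f t x ω = VicsekNS.density (f t x) * VicsekNS.vonMises P.kappa (Ω t x) ω) ∧
    -- its density and orientation are the limits of the local ones ...
    ∀ Ω : ℝ → VicsekNS.E3 → VicsekNS.S2,
      (∀ t ∈ I, ∀ x ω,
        f t x ω = VicsekNS.density (f t x) * VicsekNS.vonMises P.kappa (Ω t x) ω) →
      TendstoLocallyUniformlyOn
        (fun ε => VicsekNS.unc fun t x => VicsekNS.density (fε ε t x))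
        (VicsekNS.unc fun t x => VicsekNS.density (f t x))
        (𝓝[>] (0 : ℝ)) (VicsekNS.dom I) ∧
      TendstoLocallyUniformlyOn
        (fun ε => VicsekNS.unc fun t x => VicsekNS.meanOrientation (fε ε t x))
        (VicsekNS.unc fun t x => (Ω t x : VicsekNS.E3))
        (𝓝[>] (0 : ℝ)) {q ∈ VicsekNS.dom I | 0 < VicsekNS.density (f q.1 q.2)} ∧
      -- ... and solve the macroscopic system
      VicsekNS.IsMacroSolution P I (fun t x => VicsekNS.density (f t x)) Ω v p := by
  have L : VicsekNS.HydrodynamicLimit P I fε vε pε f v p :=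
    ⟨hnu, hD, hR, hK0, hK2, hKpos, hI, hsol, hf, hv, hp, hfε, hvε, hpε, hbdd⟩
  refine ⟨?_, fun Ω hΩ => ⟨L.tendstoLocallyUniformlyOn_density,
    L.tendstoLocallyUniformlyOn_meanOrientation hΩ, L.isMacroSolution hΩ⟩⟩
  classical
  -- The orientation is chosen pointwise, with an irrelevant value for times outside `I`; its
  -- regularity outside vacuum is automatic.
  refine ⟨fun t x => if ht : t ∈ I then
    (L.exists_equilibrium (VicsekNS.mem_dom ht x)).choose else VicsekNS.pole, fun t ht x ω => ?_⟩
  simp only [dif_pos ht]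
  exact (L.exists_equilibrium (VicsekNS.mem_dom ht x)).choose_spec ω
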